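/- Let $k\ge 0$ be an integer and let $0<\beta<\alpha<1$. Let $\Omega\subset\mathbb C$ be a bounded domain whose boundary is of class $C^{k+1+\alpha}$, i.e. $\partial\Omega$ is a finite disjoint union of simple closed curves with regular parametrizations of class $C^{k+1}$ whose $(k+1)$-st derivatives are Hölder continuous of exponent $\alpha$. Let $\Omega'=\mathbb C\setminus\overline\Omega$, let $d\sigma$ be the arc-length element of $\partial\Omega$, and for a complex-valued function $f$ on $\partial\Omega$ let $$Wf(z)=\frac1\pi\int_{\partial\Omega}f(\zeta)\log|z-\zeta|\,d\sigma(\zeta),\qquad z\in\mathbb C,$$ be its single layer potential. Suppose that $f\in C^{k+\beta}(\partial\Omega)\setminus C^{k+\alpha}(\partial\Omega)$. Then the integral converges absolutely for every $z\in\mathbb C$, and $Wf$ is harmonic on $\Omega$ and on $\Omega'$. The two harmonic functions $Wf|_{\Omega}$ and $Wf|_{\Omega'}$ have the same boundary value: at every $\zeta\in\partial\Omega$ both tend to $Wf(\zeta)$. The boundary value $Wf|_{\partial\Omega}$ is in $C^{k+1+\beta}(\partial\Omega)$, but not in $C^{k+1+\alpha}(\partial\Omega)$. Moreover, $Wf\in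 C^{1-\epsilon}(\mathbb C)$ for every $0<\epsilon<1$, in the sense that there is a constant $C$ with $|Wf(z)-Wf(w)|\le C|z-w|^{1-\epsilon}$ for all $z,w\in\mathbb C$. -/

import Mathlib

open Set Filter Topology MeasureTheory

/-- Class `C^{l+β}` (order `l`, Hölder exponent `β`) on the real line: `g` is `l` times
continuously differentiable and its `l`-th derivative is Hölder of exponent `β`. It is only used
for periodic `g`, where boundedness of the derivatives is automatic. -/
def IsHolderClass (l : ℕ) (β : ℝ) (g : ℝ → ℂ) : Prop :=
  ContDiff ℝ l g ∧
    ∃ C : ℝ, ∀ s t : ℝ, ‖iteratedDeriv l g s - iteratedDeriv l g t‖ ≤ C * |s - t| ^ β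

/-- A parametrization of the boundary of `Ω` as a finite disjoint union of regular simple closed
curves of class `C^{l+α}` (with `l ≥ 1`). For a bounded domain `Ω` in the plane the existence of
one says that `∂Ω` is of class `C^{l+α}`. -/
structure HolderBoundary (Ω : Set ℂ) (l : ℕ) (α : ℝ) where
  /-- number of boundary curves -/
  n : ℕ
  /-- period of each curve -/
  period : Fin n → ℝ
  /-- the boundary curves, as periodic functions on the line -/
  curve : Fin n → ℝ → ℂ
  period_pos : ∀ i, 0 < period i
  periodic : ∀ i, Function.Periodic (curve i) (period i)
  simple : ∀ i, InjOn (curve i) (Ico 0 (period i))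
  disjoint : Pairwise fun i j => Disjoint (range (curve i)) (range (curve j))
  holder : ∀ i, IsHolderClass l α (curve i)
  regular : ∀ i t, deriv (curve i) t ≠ 0
  frontier_eq : frontier Ω = ⋃ i, range (curve i)

namespace HolderBoundary

variable {Ω : Set ℂ} {l : ℕ} {α : ℝ}

/-- `g` restricted to `∂Ω` is of class `C^{j+β}`. Only the values of `g` on `∂Ω` matter. For
`j + β ≤ l + α` this does not depend on the parametrization. -/
def MemHolder (Γ : HolderBoundary Ω l α) (j : ℕ) (β : ℝ) (g : ℂ → ℂ) : Prop :=
  ∀ i, IsHolderClass j β fun t => g (Γ.curve i t)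

/-- The density `f(ζ) log|z - ζ| dσ(ζ)` at `ζ = γ_i(t)`, with `dσ = |γ_i'(t)| dt` the arc-length
element of `∂Ω`. -/
noncomputable def layerIntegrand (Γ : HolderBoundary Ω l α) (f : ℂ → ℂ) (z : ℂ) (i : Fin Γ.n)
    (t : ℝ) : ℂ :=
  f (Γ.curve i t) * ((Real.log ‖z - Γ.curve i t‖ * ‖deriv (Γ.curve i) t‖ : ℝ) : ℂ)

/-- The single layer potential `Wf(z) = (1/π) ∫_{∂Ω} f(ζ) log|z - ζ| dσ(ζ)`, for every `z` in the
plane. Only the values of `f` on `∂Ω` matter. -/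
noncomputable def singleLayer (Γ : HolderBoundary Ω l α) (f : ℂ → ℂ) (z : ℂ) : ℂ :=
  ((1 / Real.pi : ℝ) : ℂ) *
    ∑ i : Fin Γ.n, ∫ t in (0 : ℝ)..Γ.period i, Γ.layerIntegrand f z i t

end HolderBoundary

/-! The problem is local to one boundary curve `γ` with period `L`. With arc length absorbed into
the density, `g = f |γ'|`, the boundary value on that curve is `logPot` of `g` up to the factor
`1/π`, plus the potentials of the other curves. These are real analytic near `γ`, so along `γ` they
are as smooth as the parametrization (`holderPer_planePot_comp`). Since `|γ'|` is of class `C^{k+α}`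
and has no zeros, `f` and `g` have the same regularity in the scale between `C^{k+β}` and `C^{k+α}`.

The derivative of `logPot` is minus the principal value of `∫ g(s) Re(γ'(t) / (γ(s) - γ(t))) ds`
(`hasDerivAt_logPot`). Splitting the real part expresses it through the Cauchy singular integral
`cauchyOp` of `γ`, applied to `g / γ'` and to `conj g / γ'` (`logPotDeriv_eq`). Two smoothing facts
simplify this modulo `C^{k+α}`: the commutator of `cauchyOp` with multiplication by a `C^{k+α}`
function maps `C^{k+β}` into `C^{k+α}` (`holderPer_commutator`), and so does the difference between
the operators of `γ` and of the circle (`holderPer_cauchyOp_sub_circle`). For orders above zero both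
use that `cauchyOp` intertwines `d/dζ = (1/γ') d/dt` with itself (`hasDerivAt_cauchyOp`). The circle
operator `H` commutes with conjugation up to a multiple of the mean, so altogether `logPot' = -H g`
modulo `C^{k+α}` (`holderPer_logPotDeriv_add`).

On the circle `H` is a Fourier multiplier with values `π i` and `-π i`. Hence `H ∘ H = -π²`, and `H`
preserves each class `C^{k+β}`, `0 < β < 1`. Thus the boundary value gains exactly one derivative:
it lies in `C^{k+1+β}`, and if it lay in `C^{k+1+α}`, then `H g`, therefore `g = -π⁻² H (H g)`,
therefore `f`, would be of class `C^{k+α}`.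

In the plane, a bound on `∫ |z - γ(s)|^{-θ} ds` uniform in `z` gives Hölder continuity of every
exponent below one (`planePot_holder`). Continuity then yields the common boundary values, and off
the curves the logarithm is locally the real part of a holomorphic function. -/

/-! ### Periodic Hölder classes -/

/-- The class `C^{k+α}` of `L`-periodic functions, by recursion on `k`. -/
def HolderPer (L α : ℝ) : ℕ → (ℝ → ℂ) → Prop
  | 0, g => Function.Periodic g L ∧ ∃ C : ℝ, ∀ s t : ℝ, ‖g s - g t‖ ≤ C * |s - t| ^ α
  | k + 1, g => Function.Periodic g L ∧ Differentiable ℝ g ∧ HolderPer L α k (deriv g)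

theorem Function.Periodic.deriv_periodic {g : ℝ → ℂ} {L : ℝ} (hg : Function.Periodic g L) :
    Function.Periodic (deriv g) L := by
  intro t
  have h : (fun x => g (x + L)) = g := funext hg
  rw [← deriv_comp_add_const, h]

theorem Function.Periodic.exists_norm_le {g : ℝ → ℂ} {L : ℝ} (hL : 0 < L)
    (hg : Function.Periodic g L) (hc : Continuous g) : ∃ B : ℝ, 0 < B ∧ ∀ t, ‖g t‖ ≤ B := by
  obtain ⟨B, hB⟩ := (isCompact_Icc (a := (0 : ℝ)) (b := L)).exists_bound_of_continuousOn
    hc.continuousOn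
  refine ⟨max B 1, by positivity, fun t => ?_⟩
  obtain ⟨s, hs, hst⟩ := hg.exists_mem_Ico₀ hL t
  rw [hst]
  exact (hB s ⟨hs.1, hs.2.le⟩).trans (le_max_left _ _)

theorem continuous_of_holder {g : ℝ → ℂ} {α C : ℝ} (hα : 0 < α)
    (h : ∀ s t : ℝ, ‖g s - g t‖ ≤ C * |s - t| ^ α) : Continuous g := by
  rw [continuous_iff_continuousAt]
  intro t
  rw [ContinuousAt, tendsto_iff_norm_sub_tendsto_zero]
  have h1 : Tendsto (fun s : ℝ => C * |s - t| ^ α) (𝓝 t) (𝓝 0) := by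
    have : ContinuousAt (fun s : ℝ => C * |s - t| ^ α) t := by
      refine continuousAt_const.mul (ContinuousAt.rpow_const (by fun_prop) (Or.inr hα.le))
    have h2 := this.tendsto
    simpa [Real.zero_rpow hα.ne'] using h2
  exact squeeze_zero (fun _ => norm_nonneg _) (fun s => h s t) h1

/-- Increments longer than `δ` are controlled by boundedness alone, which is where the constant `2 *
B / δ ^ α` comes from. Later estimates therefore need only small positive steps. -/
theorem HolderPer.zero_of_local {g : ℝ → ℂ} {L α δ B C : ℝ} (hα : 0 < α) (hδ : 0 < δ)
    (hp : Function.Periodic g L) (hB : ∀ t, ‖g t‖ ≤ B)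
    (h : ∀ t u : ℝ, 0 < u → u ≤ δ → ‖g (t + u) - g t‖ ≤ C * u ^ α) : HolderPer L α 0 g := by
  refine ⟨hp, max C (2 * B / δ ^ α), ?_⟩
  have hB0 : 0 ≤ B := (norm_nonneg _).trans (hB 0)
  have key : ∀ s t : ℝ, s ≤ t → ‖g t - g s‖ ≤ max C (2 * B / δ ^ α) * |t - s| ^ α := by
    intro s t hst
    rcases hst.eq_or_lt with rfl | hst
    · simp [Real.zero_rpow hα.ne']
    rw [abs_of_pos (sub_pos.2 hst)]
    by_cases hd : t - s ≤ δ
    · have h1 := h s (t - s) (sub_pos.2 hst) hd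
      rw [add_sub_cancel] at h1
      exact h1.trans (mul_le_mul_of_nonneg_right (le_max_left _ _)
        (Real.rpow_nonneg (sub_pos.2 hst).le _))
    · push Not at hd
      have h1 : δ ^ α ≤ (t - s) ^ α := Real.rpow_le_rpow hδ.le hd.le hα.le
      have h2 : 0 < δ ^ α := Real.rpow_pos_of_pos hδ _
      calc ‖g t - g s‖ ≤ ‖g t‖ + ‖g s‖ := norm_sub_le _ _
        _ ≤ 2 * B := by linarith [hB t, hB s]
        _ = 2 * B / δ ^ α * δ ^ α := by field_simp
        _ ≤ max C (2 * B / δ ^ α) * (t - s) ^ α := by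
          gcongr
          exact le_max_right _ _
  intro s t
  rcases le_total s t with hst | hst
  · rw [norm_sub_rev, abs_sub_comm]; exact key s t hst
  · exact key t s hst

namespace HolderPer

variable {L α β : ℝ} {k : ℕ} {f g : ℝ → ℂ}

theorem periodic (hg : HolderPer L α k g) : Function.Periodic g L := by
  cases k <;> exact hg.1

theorem continuous (hα : 0 < α) (hg : HolderPer L α k g) : Continuous g := by
  cases k with
  | zero => exact continuous_of_holder hα hg.2.choose_spec
  | succ k => exact hg.2.1.continuous

theorem exists_norm_le (hL : 0 < L) (hα : 0 < α) (hg : HolderPer L α k g) :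
    ∃ B : ℝ, 0 < B ∧ ∀ t, ‖g t‖ ≤ B :=
  hg.periodic.exists_norm_le hL (hg.continuous hα)

theorem zero_of_deriv_continuous (hL : 0 < L) (hα : 0 < α) (hα1 : α ≤ 1)
    (hp : Function.Periodic g L) (hd : Differentiable ℝ g) (hc : Continuous (deriv g)) :
    HolderPer L α 0 g := by
  obtain ⟨B, hB0, hB⟩ := hp.exists_norm_le hL hd.continuous
  obtain ⟨D, hD0, hD⟩ := hp.deriv_periodic.exists_norm_le hL hc
  refine zero_of_local (δ := 1) (C := D) hα one_pos hp hB fun t u hu hu1 => ?_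
  have h := Convex.norm_image_sub_le_of_norm_deriv_le (f := g) (s := univ) (x := t) (y := t + u)
    (fun x _ => hd x) (fun x _ => hD x) convex_univ (mem_univ _) (mem_univ _)
  rw [add_sub_cancel_left, Real.norm_of_nonneg hu.le] at h
  refine h.trans (mul_le_mul_of_nonneg_left ?_ hD0.le)
  calc u = u ^ (1 : ℝ) := (Real.rpow_one u).symm
    _ ≤ u ^ α := Real.rpow_le_rpow_of_exponent_ge hu hu1 hα1

theorem of_succ (hL : 0 < L) (hα : 0 < α) (hα1 : α ≤ 1) (hg : HolderPer L α (k + 1) g) :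
    HolderPer L α k g := by
  induction k generalizing g with
  | zero => exact zero_of_deriv_continuous hL hα hα1 hg.1 hg.2.1 (hg.2.2.continuous hα)
  | succ k ih => exact ⟨hg.1, hg.2.1, ih hg.2.2⟩

theorem of_le (hL : 0 < L) (hα : 0 < α) (hα1 : α ≤ 1) {j : ℕ} (hjk : j ≤ k)
    (hg : HolderPer L α k g) : HolderPer L α j g := by
  induction k with
  | zero => obtain rfl := Nat.le_zero.1 hjk; exact hg
  | succ k ih =>
    rcases Nat.le_succ_iff.1 hjk with h | rfl
    · exact ih h (hg.of_succ hL hα hα1)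
    · exact hg

theorem mono_exponent (hL : 0 < L) (hβ : 0 < β) (hβα : β ≤ α) (hg : HolderPer L α k g) :
    HolderPer L β k g := by
  induction k generalizing g with
  | zero =>
    obtain ⟨B, hB0, hB⟩ := hg.exists_norm_le hL (hβ.trans_le hβα)
    obtain ⟨C, hC⟩ := hg.2
    refine zero_of_local (δ := 1) (C := |C|) hβ one_pos hg.1 hB fun t u hu hu1 => ?_
    have h := hC (t + u) t
    rw [add_sub_cancel_left, abs_of_pos hu] at h
    have h2 : u ^ α ≤ u ^ β := Real.rpow_le_rpow_of_exponent_ge hu hu1 hβα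
    calc _ ≤ C * u ^ α := h
      _ ≤ |C| * u ^ β := by
        gcongr
        exact le_abs_self C
  | succ k ih => exact ⟨hg.1, hg.2.1, ih hg.2.2⟩

theorem congr (hg : HolderPer L α k g) (h : ∀ t, f t = g t) : HolderPer L α k f := by
  rwa [show f = g from funext h]

theorem const (c : ℂ) : HolderPer L α k fun _ => c := by
  induction k generalizing c with
  | zero => exact ⟨fun _ => rfl, 0, fun s t => by simp⟩
  | succ k ih => exact ⟨fun _ => rfl, differentiable_const c, by simpa using ih 0⟩

theorem add (hf : HolderPer L α k f) (hg : HolderPer L α k g) :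
    HolderPer L α k fun t => f t + g t := by
  induction k generalizing f g with
  | zero =>
    obtain ⟨C, hC⟩ := hf.2
    obtain ⟨D, hD⟩ := hg.2
    refine ⟨hf.1.add hg.1, C + D, fun s t => ?_⟩
    calc ‖f s + g s - (f t + g t)‖ = ‖(f s - f t) + (g s - g t)‖ := by congr 1; ring
      _ ≤ ‖f s - f t‖ + ‖g s - g t‖ := norm_add_le _ _
      _ ≤ _ := by rw [add_mul]; exact add_le_add (hC s t) (hD s t)
  | succ k ih =>
    refine ⟨hf.1.add hg.1, hf.2.1.add hg.2.1, (ih hf.2.2 hg.2.2).congr fun t => ?_⟩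
    exact deriv_fun_add (hf.2.1 t) (hg.2.1 t)

theorem mul (hL : 0 < L) (hα : 0 < α) (hα1 : α ≤ 1) (hf : HolderPer L α k f)
    (hg : HolderPer L α k g) : HolderPer L α k fun t => f t * g t := by
  induction k generalizing f g with
  | zero =>
    obtain ⟨C, hC⟩ := hf.2
    obtain ⟨D, hD⟩ := hg.2
    obtain ⟨A, hA0, hA⟩ := hf.exists_norm_le hL hα
    obtain ⟨B, hB0, hB⟩ := hg.exists_norm_le hL hα
    refine ⟨hf.1.mul hg.1, C * B + A * D, fun s t => ?_⟩
    calc ‖f s * g s - f t * g t‖ = ‖(f s - f t) * g s + f t * (g s - g t)‖ := by congr 1; ring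
      _ ≤ ‖f s - f t‖ * ‖g s‖ + ‖f t‖ * ‖g s - g t‖ := by
        refine (norm_add_le _ _).trans ?_
        rw [norm_mul, norm_mul]
      _ ≤ (C * |s - t| ^ α) * B + A * (D * |s - t| ^ α) := by
        have h1 := hC s t
        have h2 := hD s t
        have h3 := hA t
        have h4 := hB s
        have h5 := (norm_nonneg _).trans h1
        gcongr
      _ = _ := by ring
  | succ k ih =>
    refine ⟨hf.1.mul hg.1, hf.2.1.mul hg.2.1,
      ((ih hf.2.2 (hg.of_succ hL hα hα1)).add (ih (hf.of_succ hL hα hα1) hg.2.2)).congr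
        fun t => ?_⟩
    exact deriv_fun_mul (hf.2.1 t) (hg.2.1 t)

theorem const_mul (hL : 0 < L) (hα : 0 < α) (hα1 : α ≤ 1) (c : ℂ) (hg : HolderPer L α k g) :
    HolderPer L α k fun t => c * g t := (const c).mul hL hα hα1 hg

theorem sub (hL : 0 < L) (hα : 0 < α) (hα1 : α ≤ 1) (hf : HolderPer L α k f)
    (hg : HolderPer L α k g) : HolderPer L α k fun t => f t - g t :=
  (hf.add (hg.const_mul hL hα hα1 (-1))).congr fun t => by ring

theorem finsetSum {ι : Type*} (s : Finset ι) (F : ι → ℝ → ℂ)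
    (h : ∀ i ∈ s, HolderPer L α k (F i)) : HolderPer L α k fun t => ∑ i ∈ s, F i t := by
  classical
  induction s using Finset.induction_on with
  | empty => simpa using const 0
  | insert a s ha ih =>
    refine ((h a (Finset.mem_insert_self a s)).add
      (ih fun i hi => h i (Finset.mem_insert_of_mem hi))).congr fun t => ?_
    exact Finset.sum_insert ha

theorem conj (hg : HolderPer L α k g) : HolderPer L α k fun t => (starRingEnd ℂ) (g t) := by
  induction k generalizing g with
  | zero =>
    obtain ⟨C, hC⟩ := hg.2
    refine ⟨fun t => by simp [hg.1 t], C, fun s t => ?_⟩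
    rw [← map_sub, RCLike.norm_conj]
    exact hC s t
  | succ k ih =>
    have h : ∀ t, HasDerivAt (fun t => (starRingEnd ℂ) (g t)) ((starRingEnd ℂ) (deriv g t)) t :=
      fun t => Complex.conjCLE.toContinuousLinearMap.hasFDerivAt.comp_hasDerivAt t
        (hg.2.1 t).hasDerivAt
    exact ⟨fun t => by simp [hg.1 t], fun t => (h t).differentiableAt,
      (ih hg.2.2).congr fun t => (h t).deriv⟩

theorem exists_le_norm (hL : 0 < L) (hα : 0 < α) (hg : HolderPer L α k g)
    (h0 : ∀ t, g t ≠ 0) : ∃ c : ℝ, 0 < c ∧ ∀ t, c ≤ ‖g t‖ := by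
  obtain ⟨x, -, hx⟩ := (isCompact_Icc (a := (0 : ℝ)) (b := L)).exists_isMinOn
    ⟨0, le_rfl, hL.le⟩ (hg.continuous hα).norm.continuousOn
  refine ⟨‖g x‖, norm_pos_iff.2 (h0 x), fun t => ?_⟩
  obtain ⟨s, hs, hst⟩ := hg.periodic.exists_mem_Ico₀ hL t
  rw [hst]
  exact hx ⟨hs.1, hs.2.le⟩

theorem inv (hL : 0 < L) (hα : 0 < α) (hα1 : α ≤ 1) (hg : HolderPer L α k g)
    (h0 : ∀ t, g t ≠ 0) : HolderPer L α k fun t => (g t)⁻¹ := by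
  induction k generalizing g with
  | zero =>
    obtain ⟨c, hc0, hc⟩ := hg.exists_le_norm hL hα h0
    obtain ⟨C, hC⟩ := hg.2
    refine ⟨fun t => by simp [hg.1 t], C / (c * c), fun s t => ?_⟩
    have h1 : (g s)⁻¹ - (g t)⁻¹ = (g t - g s) / (g s * g t) := by
      field_simp [h0 s, h0 t]
    rw [h1, norm_div, norm_mul, norm_sub_rev, div_mul_eq_mul_div]
    have h5 := (norm_nonneg _).trans (hC s t)
    exact div_le_div₀ h5 (hC s t) (by positivity) (mul_le_mul (hc s) (hc t) hc0.le (norm_nonneg _))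
  | succ k ih =>
    refine ⟨fun t => by simp [hg.1 t], hg.2.1.inv h0, ?_⟩
    have h1 := ih (hg.of_succ hL hα hα1) h0
    refine ((hg.2.2.mul hL hα hα1 (h1.mul hL hα hα1 h1)).const_mul hL hα hα1 (-1)).congr
      fun t => ?_
    have h2 : deriv (fun t => (g t)⁻¹) t = -deriv g t / g t ^ 2 :=
      ((hg.2.1 t).hasDerivAt.inv (h0 t)).deriv
    rw [h2]
    field_simp [h0 t]

/-- Away from zeros the derivative of `|g|` is `Re(g' conj g) / |g|`, so the induction runs through
products, conjugates and the inverse of `|g|` one order lower. It is what makes the arc-length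
factor `|γ'|` as regular as `γ'`. -/
theorem norm (hL : 0 < L) (hα : 0 < α) (hα1 : α ≤ 1) (hg : HolderPer L α k g)
    (h0 : ∀ t, g t ≠ 0) : HolderPer L α k fun t => ((‖g t‖ : ℝ) : ℂ) := by
  induction k generalizing g with
  | zero =>
    obtain ⟨C, hC⟩ := hg.2
    refine ⟨fun t => by simp [hg.1 t], C, fun s t => ?_⟩
    rw [← Complex.ofReal_sub, Complex.norm_real]
    exact (abs_norm_sub_norm_le _ _).trans (hC s t)
  | succ k ih =>
    have h1 := ih (hg.of_succ hL hα hα1) h0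
    have h1' := h1.inv hL hα hα1 fun t => by simpa using h0 t
    have hg' := hg.of_succ hL hα hα1
    have hd : ∀ t, HasDerivAt (fun t => ((‖g t‖ : ℝ) : ℂ))
        (2⁻¹ * ((deriv g t * (starRingEnd ℂ) (g t) + g t * (starRingEnd ℂ) (deriv g t)) *
          ((‖g t‖ : ℝ) : ℂ)⁻¹)) t := by
      intro t
      have h2 := ((hg.2.1 t).hasDerivAt.norm_sq).sqrt (by simpa using h0 t)
      have h3 : (fun y => √(‖g y‖ ^ 2)) = fun y => ‖g y‖ := by
        funext y; exact Real.sqrt_sq (norm_nonneg _)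
      rw [h3] at h2
      convert h2.ofReal_comp using 1
      rw [Real.sqrt_sq (norm_nonneg _)]
      have h4 : ((inner ℝ (g t) (deriv g t) : ℝ) : ℂ) =
          2⁻¹ * (deriv g t * (starRingEnd ℂ) (g t) + g t * (starRingEnd ℂ) (deriv g t)) := by
        rw [Complex.inner]
        apply Complex.ext <;> simp <;> ring
      push_cast
      rw [h4]
      have h5 : ((‖g t‖ : ℝ) : ℂ) ≠ 0 := by simpa using h0 t
      field_simp
    refine ⟨fun t => by simp [hg.1 t], fun t => (hd t).differentiableAt, ?_⟩
    exact ((((hg.2.2.mul hL hα hα1 hg'.conj).add (hg'.mul hL hα hα1 hg.2.2.conj)).mul hL hα hα1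
      h1').const_mul hL hα hα1 2⁻¹).congr fun t => (hd t).deriv

/-- The recursive class peels off one derivative at a time, which suits every induction below; this
is the bridge to the class used in the theorem. -/
theorem iff_isHolderClass (hα : 0 < α) :
    HolderPer L α k g ↔ Function.Periodic g L ∧ IsHolderClass k α g := by
  induction k generalizing g with
  | zero =>
    simp only [HolderPer, IsHolderClass, iteratedDeriv_zero, Nat.cast_zero, contDiff_zero]
    exact ⟨fun h => ⟨h.1, continuous_of_holder hα h.2.choose_spec, h.2⟩, fun h => ⟨h.1, h.2.2⟩⟩
  | succ k ih =>
    simp only [HolderPer, ih, IsHolderClass, iteratedDeriv_succ', Nat.cast_succ,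
      contDiff_succ_iff_deriv]
    constructor
    · rintro ⟨h1, h2, -, h3, h4⟩
      exact ⟨h1, ⟨h2, by simp, h3⟩, h4⟩
    · rintro ⟨h1, ⟨h2, -, h3⟩, h4⟩
      exact ⟨h1, h2, h1.deriv_periodic, h3, h4⟩

end HolderPer

/-! ### Regular closed curves and their Cauchy kernels -/

/-- A closed curve with `L`-periodic parametrization of class `C^{1+α}`, simple and regular. -/
structure RegularCurve (L α : ℝ) (γ : ℝ → ℂ) : Prop where
  holder : HolderPer L α 1 γ
  simple : InjOn γ (Ico 0 L)
  regular : ∀ t, deriv γ t ≠ 0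

/-- Quantitative form of `RegularCurve`. -/
structure CurveBounds (L α A B c : ℝ) (γ : ℝ → ℂ) : Prop where
  L_pos : 0 < L
  α_pos : 0 < α
  A_pos : 0 < A
  B_pos : 0 < B
  c_pos : 0 < c
  differentiable : Differentiable ℝ γ
  holder : ∀ s t, ‖deriv γ s - deriv γ t‖ ≤ A * |s - t| ^ α
  bound : ∀ t, ‖deriv γ t‖ ≤ B
  chord : ∀ t u, |u| ≤ 3 * L / 4 → c * |u| ≤ ‖γ (t + u) - γ t‖

/-- A translation by a multiple of the period brings `s` into the fundamental interval; `t` then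
lies there too, or does after removing one more period. -/
theorem RegularCurve.ne {L α : ℝ} {γ : ℝ → ℂ} (hL : 0 < L) (h : RegularCurve L α γ)
    {s t : ℝ} (hst : s < t) (hst' : t < s + L) : γ t ≠ γ s := by
  intro heq
  have hp := h.holder.periodic
  obtain ⟨m, hm⟩ : ∃ m : ℤ, s + m • L ∈ Ico 0 (0 + L) := by
    obtain ⟨m, hm, -⟩ := existsUnique_add_zsmul_mem_Ico hL s 0
    exact ⟨m, hm⟩
  rw [zero_add] at hm
  set s' := s + m • L with hs'
  have e1 : γ s' = γ s := hp.zsmul m s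
  have e2 : γ (t + m • L) = γ t := hp.zsmul m t
  by_cases hlt : t + m • L < L
  · have := h.simple (x₁ := t + m • L) (x₂ := s') ⟨by linarith [hm.1], hlt⟩ hm (by rw [e1, e2, heq])
    linarith
  · push Not at hlt
    have e3 : γ (t + m • L - L) = γ t := by rw [hp.sub_eq, e2]
    have := h.simple (x₁ := t + m • L - L) (x₂ := s') ⟨by linarith, by linarith [hm.2]⟩ hm
      (by rw [e1, e3, heq])
    linarith

/-- The difference quotient extends continuously to `u = 0` as the mean of `γ'` over the segment,
and it never vanishes: by simplicity for `u ≠ 0`, by regularity for `u = 0`. Compactness then gives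
a lower bound. The range `3L/4` is below a full period, yet leaves room for `|u| ≤ L/2` shifted by
`δ ≤ L/8`. -/
theorem RegularCurve.exists_chord {L α : ℝ} {γ : ℝ → ℂ} (hL : 0 < L) (hα : 0 < α)
    (h : RegularCurve L α γ) : ∃ c : ℝ, 0 < c ∧
    ∀ t u, |u| ≤ 3 * L / 4 → c * |u| ≤ ‖γ (t + u) - γ t‖ := by
  have hd : Differentiable ℝ γ := h.holder.2.1
  have hc : Continuous (deriv γ) := h.holder.2.2.continuous hα
  let M : ℝ × ℝ → ℂ := fun p => ∫ θ in (0 : ℝ)..1, deriv γ (p.1 + θ * p.2)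
  have hM : Continuous M := by
    apply intervalIntegral.continuous_parametric_intervalIntegral_of_continuous'
    exact hc.comp (by fun_prop)
  have hMu : ∀ t u : ℝ, (u : ℂ) * M (t, u) = γ (t + u) - γ t := by
    intro t u
    have := intervalIntegral.integral_unitInterval_deriv_eq_sub (𝕜 := ℝ) (f := γ) (f' := deriv γ) (z₀ := t)
      (z₁ := u) (by exact (hc.comp (by fun_prop)).continuousOn) (fun x _ => (hd _).hasDerivAt)
    rw [← this, Complex.real_smul]
    rfl
  have hp := h.holder.periodic
  have hM0 : ∀ t u : ℝ, |u| ≤ 3 * L / 4 → M (t, u) ≠ 0 := by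
    intro t u hu h0
    rcases lt_trichotomy u 0 with hu0 | rfl | hu0
    · rw [abs_of_neg hu0] at hu
      have h1 := hMu t u
      rw [h0, mul_zero] at h1
      exact h.ne hL (s := t + u) (t := t) (by linarith) (by linarith) (sub_eq_zero.1 h1.symm).symm
    · simp only [M, mul_zero, add_zero, intervalIntegral.integral_const] at h0
      simp at h0
      exact h.regular t h0
    · rw [abs_of_pos hu0] at hu
      have h1 := hMu t u
      rw [h0, mul_zero] at h1
      exact h.ne hL (s := t) (t := t + u) (by linarith) (by linarith) (sub_eq_zero.1 h1.symm)
  obtain ⟨x, hx, hxmin⟩ := (isCompact_Icc (a := (0 : ℝ)) (b := L)).prod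
    (isCompact_Icc (a := -(3 * L / 4)) (b := 3 * L / 4)) |>.exists_isMinOn
    ⟨(0, 0), ⟨le_rfl, hL.le⟩, ⟨by simp; positivity, by positivity⟩⟩ hM.norm.continuousOn
  refine ⟨‖M x‖, norm_pos_iff.2 (hM0 x.1 x.2 (abs_le.2 hx.2)), fun t u hu => ?_⟩
  have hMper : M (t, u) = M (toIcoMod hL 0 t, u) := by
    have hp' : Function.Periodic (fun t => M (t, u)) L := by
      intro t
      simp only [M]
      congr 1
      funext θ
      rw [show t + L + θ * u = (t + θ * u) + L by ring]
      exact hp.deriv_periodic _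
    obtain ⟨m, hm⟩ : ∃ m : ℤ, toIcoMod hL 0 t = t - m • L := ⟨_, rfl⟩
    rw [hm]
    exact (hp'.sub_zsmul_eq m (x := t)).symm
  rw [← hMu, norm_mul, Complex.norm_real, Real.norm_eq_abs, mul_comm, hMper]
  refine mul_le_mul_of_nonneg_left (hxmin ⟨?_, abs_le.1 hu⟩) (abs_nonneg _)
  have := toIcoMod_mem_Ico hL 0 t
  exact ⟨this.1, by simpa using this.2.le⟩

theorem RegularCurve.exists_bounds {L α : ℝ} {γ : ℝ → ℂ} (hL : 0 < L) (hα : 0 < α)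
    (h : RegularCurve L α γ) : ∃ A B c : ℝ, CurveBounds L α A B c γ := by
  obtain ⟨c, hc0, hc⟩ := h.exists_chord hL hα
  obtain ⟨B, hB0, hB⟩ := h.holder.2.2.exists_norm_le hL hα
  obtain ⟨A, hA⟩ := h.holder.2.2.2
  exact ⟨|A| + 1, B, c, hL, hα, by positivity, hB0, hc0, h.holder.2.1,
    fun s t => (hA s t).trans (mul_le_mul_of_nonneg_right (by linarith [le_abs_self A])
      (by positivity)), hB, hc⟩

/-- The mean value inequality is applied to `f(x) - x f'(r)` on the interval of radius `ρ` about
`r`, where its derivative is at most `A ρ^α`. Keeping the base point `r` free allows differences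
between two points both distinct from it. -/
theorem taylor_of_deriv_holder {f : ℝ → ℂ} {α A : ℝ} (hf : Differentiable ℝ f)
    (hA : ∀ s t, ‖deriv f s - deriv f t‖ ≤ A * |s - t| ^ α) (hA0 : 0 ≤ A) (hα : 0 ≤ α)
    {s t r ρ : ℝ} (hs : |s - r| ≤ ρ) (ht : |t - r| ≤ ρ) :
    ‖f s - f t - (s - t : ℝ) * deriv f r‖ ≤ A * ρ ^ α * |s - t| := by
  have hd : ∀ x, HasDerivAt (fun x : ℝ => f x - (x : ℂ) * deriv f r)
      (deriv f x - deriv f r) x := by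
    intro x
    have := (hf x).hasDerivAt.fun_sub
      ((Complex.ofRealCLM.hasDerivAt (x := x)).mul_const (deriv f r))
    simpa using this
  have hconv := Convex.norm_image_sub_le_of_norm_hasDerivWithin_le
    (f := fun x : ℝ => f x - (x : ℂ) * deriv f r) (f' := fun x => deriv f x - deriv f r)
    (s := Icc (r - ρ) (r + ρ)) (x := t) (y := s) (C := A * ρ ^ α)
    (fun x _ => (hd x).hasDerivWithinAt) (fun x hx => (hA x r).trans ?_) (convex_Icc _ _)
    (by rw [abs_le] at ht; exact ⟨by linarith, by linarith⟩)
    (by rw [abs_le] at hs; exact ⟨by linarith, by linarith⟩)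
  · rw [Real.norm_eq_abs] at hconv
    refine le_trans (le_of_eq ?_) hconv
    congr 1
    push_cast
    ring
  · have : |x - r| ≤ ρ := abs_le.2 ⟨by linarith [hx.1], by linarith [hx.2]⟩
    exact mul_le_mul_of_nonneg_left (Real.rpow_le_rpow (abs_nonneg _) this hα) hA0

namespace CurveBounds

variable {L α A B c : ℝ} {γ : ℝ → ℂ}

theorem taylor (h : CurveBounds L α A B c γ) {s t r ρ : ℝ} (hs : |s - r| ≤ ρ) (ht : |t - r| ≤ ρ) :
    ‖γ s - γ t - (s - t : ℝ) * deriv γ r‖ ≤ A * ρ ^ α * |s - t| :=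
  taylor_of_deriv_holder h.differentiable h.holder h.A_pos.le h.α_pos.le hs ht

theorem lipschitz (h : CurveBounds L α A B c γ) (s t : ℝ) : ‖γ s - γ t‖ ≤ B * |s - t| := by
  have := Convex.norm_image_sub_le_of_norm_deriv_le (f := γ) (s := univ) (x := t) (y := s)
    (fun x _ => h.differentiable x) (fun x _ => h.bound x) convex_univ (mem_univ _) (mem_univ _)
  simpa using this

theorem chord' (h : CurveBounds L α A B c γ) {s t : ℝ} (hst : |s - t| ≤ 3 * L / 4) :
    c * |s - t| ≤ ‖γ s - γ t‖ := by
  have := h.chord t (s - t) hst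
  rwa [add_sub_cancel] at this

theorem sub_ne_zero (h : CurveBounds L α A B c γ) {s t : ℝ} (h0 : s - t ≠ 0)
    (hst : |s - t| ≤ 3 * L / 4) : γ s - γ t ≠ 0 := by
  rw [← norm_pos_iff]
  exact (mul_pos h.c_pos (abs_pos.2 h0)).trans_le (h.chord' hst)

/-- The leading singularity is `1 / (s - t)` whatever the curve; this is why operators attached to
different curves can be compared. -/
theorem kernel_sub_inv (h : CurveBounds L α A B c γ) {s t : ℝ} (h0 : s - t ≠ 0)
    (hst : |s - t| ≤ 3 * L / 4) :
    ‖deriv γ s / (γ s - γ t) - ((s - t : ℝ) : ℂ)⁻¹‖ ≤ A / c * |s - t| ^ (α - 1) := by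
  have hΔ := h.sub_ne_zero h0 hst
  have hu : ((s - t : ℝ) : ℂ) ≠ 0 := by exact_mod_cast h0
  have e : deriv γ s / (γ s - γ t) - ((s - t : ℝ) : ℂ)⁻¹ =
      -(γ s - γ t - (s - t : ℝ) * deriv γ s) / ((γ s - γ t) * (s - t : ℝ)) := by
    field_simp
    ring
  have hp := abs_pos.2 h0
  rw [e, norm_div, norm_neg, norm_mul, Complex.norm_real, Real.norm_eq_abs,
    Real.rpow_sub_one hp.ne']
  have h1 := h.taylor (s := s) (t := t) (r := s) (ρ := |s - t|) (by simp)
    (by rw [abs_sub_comm])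
  have h2 := h.chord' hst
  have hc := h.c_pos
  have hA := h.A_pos
  calc _ ≤ A * |s - t| ^ α * |s - t| / ((c * |s - t|) * |s - t|) := by gcongr
    _ = _ := by field_simp

theorem norm_kernel_le (h : CurveBounds L α A B c γ) {s t : ℝ} (h0 : s - t ≠ 0)
    (hst : |s - t| ≤ 3 * L / 4) :
    ‖deriv γ s / (γ s - γ t)‖ ≤ B / c * |s - t|⁻¹ := by
  have hp := abs_pos.2 h0
  have hc := h.c_pos
  have hB := h.B_pos
  rw [norm_div]
  calc _ ≤ B / (c * |s - t|) := by
        gcongr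
        · exact h.bound s
        · exact h.chord' hst
    _ = _ := by field_simp

theorem norm_kernel_sub_le (h : CurveBounds L α A B c γ) {s t t' : ℝ} (h0 : s - t ≠ 0)
    (hst : |s - t| ≤ 3 * L / 4) (h0' : s - t' ≠ 0) (hst' : |s - t'| ≤ 3 * L / 4) :
    ‖deriv γ s / (γ s - γ t) - deriv γ s / (γ s - γ t')‖ ≤
      B ^ 2 / c ^ 2 * |t - t'| / (|s - t| * |s - t'|) := by
  have hΔ := h.sub_ne_zero h0 hst
  have hΔ' := h.sub_ne_zero h0' hst'
  have e : deriv γ s / (γ s - γ t) - deriv γ s / (γ s - γ t') =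
      deriv γ s * (γ t - γ t') / ((γ s - γ t) * (γ s - γ t')) := by
    field_simp
    ring
  have hp := abs_pos.2 h0
  have hp' := abs_pos.2 h0'
  have hc := h.c_pos
  have hB := h.B_pos
  rw [e, norm_div, norm_mul, norm_mul]
  calc _ ≤ B * (B * |t - t'|) / ((c * |s - t|) * (c * |s - t'|)) := by
        gcongr
        · exact h.bound s
        · exact h.lipschitz t t'
        · exact h.chord' hst
        · exact h.chord' hst'
    _ = _ := by field_simp

/-- Once the universal part `1 / (s - t)` is removed, increments of the kernel in `t` gain a factor
`ρ^α` over `norm_kernel_sub_le`. -/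
theorem norm_kernel_sub_sub_le (h : CurveBounds L α A B c γ) {s t t' ρ : ℝ} (h0 : s - t ≠ 0)
    (hst : |s - t| ≤ 3 * L / 4) (h0' : s - t' ≠ 0) (hst' : |s - t'| ≤ 3 * L / 4)
    (hρ : |s - t| ≤ ρ) (hρ' : |s - t'| ≤ ρ) :
    ‖deriv γ s / (γ s - γ t) - deriv γ s / (γ s - γ t') -
        (((s - t : ℝ) : ℂ)⁻¹ - ((s - t' : ℝ) : ℂ)⁻¹)‖ ≤
      3 * A * B / c ^ 2 * |t - t'| * ρ ^ α / (|s - t| * |s - t'|) := by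
  have hΔ := h.sub_ne_zero h0 hst
  have hΔ' := h.sub_ne_zero h0' hst'
  have hu : ((s - t : ℝ) : ℂ) ≠ 0 := by exact_mod_cast h0
  have hu' : ((s - t' : ℝ) : ℂ) ≠ 0 := by exact_mod_cast h0'
  have b1 := h.taylor (s := s) (t := t) (r := s) (ρ := ρ)
    (by simpa using (abs_nonneg _).trans hρ) (by rwa [abs_sub_comm])
  have b2 := h.taylor (s := s) (t := t') (r := s) (ρ := ρ)
    (by simpa using (abs_nonneg _).trans hρ) (by rwa [abs_sub_comm])
  have b3 := h.taylor (s := t) (t := t') (r := s) (ρ := ρ) (by rwa [abs_sub_comm])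
    (by rwa [abs_sub_comm])
  have b4 := h.lipschitz s t'
  have b5 := h.bound s
  have c1 := h.chord' hst
  have c2 := h.chord' hst'
  -- The numerator is arranged as three terms, each containing one Taylor remainder at `s`; this
  -- accounts for the factor 3.
  have e : deriv γ s / (γ s - γ t) - deriv γ s / (γ s - γ t') -
        (((s - t : ℝ) : ℂ)⁻¹ - ((s - t' : ℝ) : ℂ)⁻¹) =
      (deriv γ s * (γ t - γ t' - (t - t' : ℝ) * deriv γ s) * ((s - t : ℝ) * (s - t' : ℝ)) -
        (t - t' : ℝ) * (s - t : ℝ) * deriv γ s * (γ s - γ t' - (s - t' : ℝ) * deriv γ s) -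
        (t - t' : ℝ) * (γ s - γ t - (s - t : ℝ) * deriv γ s) * (γ s - γ t')) /
      (((γ s - γ t) * (γ s - γ t')) * ((s - t : ℝ) * (s - t' : ℝ))) := by
    field_simp
    push_cast
    ring
  have hp := abs_pos.2 h0
  have hp' := abs_pos.2 h0'
  have hc := h.c_pos
  have hB := h.B_pos
  have hA := h.A_pos
  have hρ0 : 0 ≤ ρ := (abs_nonneg _).trans hρ
  rw [e, norm_div]
  have hn : ∀ x : ℝ, ‖(x : ℂ)‖ = |x| := fun x => by rw [Complex.norm_real, Real.norm_eq_abs]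
  calc _ ≤ (B * (A * ρ ^ α * |t - t'|) * (|s - t| * |s - t'|) +
        |t - t'| * |s - t| * B * (A * ρ ^ α * |s - t'|) +
        |t - t'| * (A * ρ ^ α * |s - t|) * (B * |s - t'|)) /
        (((c * |s - t|) * (c * |s - t'|)) * (|s - t| * |s - t'|)) := by
        gcongr
        · refine (norm_sub_le _ _).trans (add_le_add ((norm_sub_le _ _).trans (add_le_add ?_ ?_)) ?_)
          · simp only [norm_mul, hn]
            gcongr
          · simp only [norm_mul, hn]
            gcongr
          · simp only [norm_mul, hn]
            gcongr
        · simp only [norm_mul, hn]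
          gcongr
    _ = _ := by field_simp; ring

end CurveBounds

/-! ### Weakly singular integrals -/

theorem intervalIntegrable_abs_rpow {r : ℝ} (hr : -1 < r) (a b : ℝ) :
    IntervalIntegrable (fun u : ℝ => |u| ^ r) volume a b := by
  have h0 : ∀ x : ℝ, 0 ≤ x → IntervalIntegrable (fun u : ℝ => |u| ^ r) volume 0 x := by
    intro x hx
    refine (intervalIntegral.intervalIntegrable_rpow' hr (a := 0) (b := x)).congr fun u hu => ?_
    rw [uIoc_of_le hx] at hu
    simp only [abs_of_pos hu.1]
  have h1 : ∀ x : ℝ, IntervalIntegrable (fun u : ℝ => |u| ^ r) volume 0 x := by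
    intro x
    rcases le_total 0 x with hx | hx
    · exact h0 x hx
    · have := (h0 (-x) (by linarith)).comp_mul_left (c := -1)
      simpa using this
  exact (h1 a).symm.trans (h1 b)

theorem integral_abs_rpow {r : ℝ} (hr : -1 < r) {a : ℝ} (ha : 0 ≤ a) :
    ∫ u in -a..a, |u| ^ r = 2 * a ^ (r + 1) / (r + 1) := by
  have h1 : ∫ u in (0 : ℝ)..a, |u| ^ r = a ^ (r + 1) / (r + 1) := by
    rw [intervalIntegral.integral_congr (g := fun u : ℝ => u ^ r), integral_rpow (Or.inl hr),
      Real.zero_rpow (by linarith), sub_zero]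
    intro u hu
    rw [uIcc_of_le ha] at hu
    simp only [abs_of_nonneg hu.1]
  have h2 : ∫ u in -a..(0 : ℝ), |u| ^ r = a ^ (r + 1) / (r + 1) := by
    have := intervalIntegral.integral_comp_neg (fun u : ℝ => |u| ^ r) (a := 0) (b := a)
    simp only [abs_neg, neg_zero] at this
    rw [← this, h1]
  rw [← intervalIntegral.integral_add_adjacent_intervals (intervalIntegrable_abs_rpow hr _ 0)
    (intervalIntegrable_abs_rpow hr _ _), h1, h2]
  ring

theorem ae_ne_zero : ∀ᵐ u : ℝ, u ≠ 0 := by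
  rw [ae_iff]
  simp

theorem intervalIntegrable_of_le_abs_rpow {E : Type*} [NormedAddCommGroup E] [MeasurableSpace E]
    [BorelSpace E] [SecondCountableTopology E] {F : ℝ → E} {a r C : ℝ} (hr : -1 < r)
    (hF : Measurable F) (h : ∀ u, u ≠ 0 → |u| ≤ a → ‖F u‖ ≤ C * |u| ^ r) {p q : ℝ}
    (hp : |p| ≤ a) (hq : |q| ≤ a) : IntervalIntegrable F volume p q := by
  refine ((intervalIntegrable_abs_rpow hr p q).const_mul C).mono_fun'
    hF.aestronglyMeasurable ?_
  rw [ae_restrict_eq measurableSet_uIoc, EventuallyLE]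
  refine eventually_inf_principal.2 ?_
  filter_upwards [ae_ne_zero] with u hu0 hu
  refine h u hu0 ?_
  rcases le_total p q with hpq | hpq
  · rw [uIoc_of_le hpq] at hu
    rw [abs_le] at *
    exact ⟨by linarith [hu.1], by linarith [hu.2]⟩
  · rw [uIoc_of_ge hpq] at hu
    rw [abs_le] at *
    exact ⟨by linarith [hu.1], by linarith [hu.2]⟩

theorem norm_integral_le_of_le_abs_rpow {E : Type*} [NormedAddCommGroup E] [NormedSpace ℝ E]
    {F : ℝ → E} {a r C : ℝ} (hr : -1 < r) (hC : 0 ≤ C)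
    (h : ∀ u, u ≠ 0 → |u| ≤ a → ‖F u‖ ≤ C * |u| ^ r) {p q : ℝ}
    (hp : -a ≤ p) (hpq : p ≤ q) (hq : q ≤ a) :
    ‖∫ u in p..q, F u‖ ≤ C * (2 * a ^ (r + 1) / (r + 1)) := by
  have ha : 0 ≤ a := by linarith
  rw [← integral_abs_rpow hr ha, ← intervalIntegral.integral_const_mul]
  refine (intervalIntegral.norm_integral_le_of_norm_le hpq ?_
    ((intervalIntegrable_abs_rpow hr p q).const_mul C)).trans ?_
  · filter_upwards [ae_ne_zero] with u hu0 hu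
    exact h u hu0 (abs_le.2 ⟨by linarith [hu.1], by linarith [hu.2]⟩)
  · exact intervalIntegral.integral_mono_interval hp hpq hq
      (Eventually.of_forall fun u => by positivity)
      ((intervalIntegrable_abs_rpow hr _ _).const_mul C)

/-- Integrating `δ u^{α-2}` from `2δ` outwards produces `δ · δ^{α-1} / (1 - α)`. The restriction `α
< 1` is essential here. -/
theorem norm_tail_le {F : ℝ → ℂ} {α D δ a : ℝ} (hα1 : α < 1) (hD : 0 ≤ D) (hδ : 0 < δ)
    (ha : 2 * δ ≤ a)
    (h : ∀ u, 2 * δ ≤ |u| → |u| ≤ a → ‖F u‖ ≤ D * δ * |u| ^ (α - 2)) :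
    ‖(∫ u in -a..-(2 * δ), F u) + ∫ u in 2 * δ..a, F u‖ ≤ 2 * D / (1 - α) * δ ^ α := by
  have key : ∀ G : ℝ → ℂ, (∀ u, 2 * δ ≤ u → u ≤ a → ‖G u‖ ≤ D * δ * u ^ (α - 2)) →
      ‖∫ u in 2 * δ..a, G u‖ ≤ D / (1 - α) * δ ^ α := by
    intro G hG
    have h0 : (0 : ℝ) ∉ uIcc (2 * δ) a := by
      rw [uIcc_of_le ha]
      intro h
      linarith [h.1]
    have h1 : IntervalIntegrable (fun u : ℝ => D * δ * u ^ (α - 2)) volume (2 * δ) a :=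
      (intervalIntegral.intervalIntegrable_rpow (Or.inr h0)).const_mul _
    refine (intervalIntegral.norm_integral_le_of_norm_le ha (Eventually.of_forall
      fun u hu => hG u hu.1.le hu.2) h1).trans ?_
    rw [intervalIntegral.integral_const_mul, integral_rpow (Or.inr ⟨by linarith, h0⟩),
      show α - 2 + 1 = α - 1 by ring]
    have h2 : (2 * δ) ^ (α - 1) ≤ δ ^ (α - 1) :=
      Real.rpow_le_rpow_of_nonpos hδ (by linarith) (by linarith)
    have h3 : 0 ≤ a ^ (α - 1) := Real.rpow_nonneg (by linarith) _
    have h4 : 0 < 1 - α := by linarith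
    calc D * δ * ((a ^ (α - 1) - (2 * δ) ^ (α - 1)) / (α - 1))
        = D * δ * (((2 * δ) ^ (α - 1) - a ^ (α - 1)) / (1 - α)) := by
          rw [← neg_sub 1 α, div_neg, ← neg_div, neg_sub]
      _ ≤ D * δ * (δ ^ (α - 1) / (1 - α)) := by gcongr; linarith
      _ = _ := by rw [Real.rpow_sub_one hδ.ne']; field_simp
  have h1 : ∫ u in -a..-(2 * δ), F u = ∫ u in 2 * δ..a, F (-u) :=
    (intervalIntegral.integral_comp_neg F).symm
  rw [h1]
  refine (norm_add_le _ _).trans ?_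
  have k1 := key F fun u hu hu' => by
    have := h u (by rwa [abs_of_pos (by linarith)]) (by rwa [abs_of_pos (by linarith)])
    rwa [abs_of_pos (by linarith)] at this
  have k2 := key (fun u => F (-u)) fun u hu hu' => by
    have := h (-u) (by rwa [abs_neg, abs_of_pos (by linarith)])
      (by rwa [abs_neg, abs_of_pos (by linarith)])
    rwa [abs_neg, abs_of_pos (by linarith)] at this
  calc _ ≤ _ := add_le_add k2 k1
    _ = _ := by ring

/-- An integral operator with a periodic kernel of size `|s - t| ^ (α - 1)` and suitable increments
away from the diagonal produces Hölder functions. -/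
theorem holderPer_of_kernel {N : ℝ → ℝ → ℂ} {L α C D : ℝ} (hL : 0 < L) (hα : 0 < α)
    (hC : 0 ≤ C) (hm : ∀ t, Measurable (N t)) (hper : ∀ t, Function.Periodic (N t) L)
    (hper' : ∀ t s, N (t + L) s = N t s)
    (hb : ∀ t u, u ≠ 0 → |u| ≤ L / 2 → ‖N t (t + u)‖ ≤ C * |u| ^ (α - 1))
    (hinc : ∀ t δ, 0 < δ → δ ≤ L / 8 →
      ‖(∫ u in -(L / 2)..-(2 * δ), (N t (t + u) - N (t + δ) (t + u))) +
        ∫ u in 2 * δ..L / 2, (N t (t + u) - N (t + δ) (t + u))‖ ≤ D * δ ^ α) :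
    HolderPer L α 0 fun t => ∫ u in -(L / 2)..L / 2, N t (t + u) := by
  have hr : -1 < α - 1 := by linarith
  have hmt : ∀ t t' : ℝ, Measurable fun u => N t (t' + u) := fun t t' =>
    (hm t).comp (by fun_prop)
  have hint : ∀ t p q, |p| ≤ L / 2 → |q| ≤ L / 2 →
      IntervalIntegrable (fun u => N t (t + u)) volume p q := fun t p q hp hq =>
    intervalIntegrable_of_le_abs_rpow hr (hmt t t) (hb t) hp hq
  have hpt : ∀ t t', Function.Periodic (fun u => N t (t' + u)) L := by
    intro t t' u
    show N t (t' + (u + L)) = N t (t' + u)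
    rw [← add_assoc]
    exact hper t _
  have hint' : ∀ t p q, IntervalIntegrable (fun u => N t (t + u)) volume p q := by
    intro t p q
    refine (hpt t t).intervalIntegrable hL.ne' (t := -(L / 2)) ?_ p q
    rw [show -(L / 2) + L = L / 2 by ring]
    exact hint t _ _ (by rw [abs_neg, abs_of_pos (by positivity)])
      (by rw [abs_of_pos (by positivity)])
  have hint2 : ∀ t δ p q, IntervalIntegrable (fun u => N (t + δ) (t + u)) volume p q := by
    intro t δ p q
    have := (hint' (t + δ) (p - δ) (q - δ)).comp_sub_right δ
    simpa [add_assoc] using this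
  -- The window `|u| ≤ 2δ` is estimated by size alone, once for the kernel at `t` and once for the
  -- kernel at `t + δ`, where it lies within distance `3δ`; these give the terms with `2 ^ α` and `3
  -- ^ α`. The far part contributes `D`.
  refine HolderPer.zero_of_local (δ := L / 8) (B := C * (2 * (L / 2) ^ (α - 1 + 1) / (α - 1 + 1)))
    (C := C * (2 * 2 ^ α / α) + C * (2 * 3 ^ α / α) + D) hα (by positivity) ?_ ?_ ?_
  · intro t
    simp only [hper']
    congr 1
    funext u
    rw [show t + L + u = t + u + L by ring]
    exact hper t _
  · intro t
    exact norm_integral_le_of_le_abs_rpow hr hC (hb t) le_rfl (by linarith) le_rfl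
  · intro t δ hδ hδL
    -- By periodicity the integral at `t + δ` may be taken over the window centred at `t`, so that
    -- both kernels are compared at the same point `t + u`.
    have e1 : ∫ u in -(L / 2)..L / 2, N (t + δ) (t + δ + u) =
        ∫ u in -(L / 2)..L / 2, N (t + δ) (t + u) := by
      have h1 := intervalIntegral.integral_comp_add_right (a := -(L / 2)) (b := L / 2)
        (fun v => N (t + δ) (t + v)) δ
      have h2 := (hpt (t + δ) t).intervalIntegral_add_eq (-(L / 2) + δ) (-(L / 2))
      rw [show -(L / 2) + δ + L = L / 2 + δ by ring, show -(L / 2) + L = L / 2 by ring, ← h1] at h2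
      rw [← h2]
      congr 1
      funext u
      rw [add_assoc, add_comm δ]
    have i1 := hint2 t δ
    have i0 := hint' t
    have isub : ∀ p q, IntervalIntegrable (fun u => N t (t + u) - N (t + δ) (t + u)) volume p q :=
      fun p q => (i0 p q).sub (i1 p q)
    have e2 : (∫ u in -(L / 2)..L / 2, N t (t + u)) - ∫ u in -(L / 2)..L / 2, N (t + δ) (t + u) =
        (∫ u in -(2 * δ)..2 * δ, N t (t + u)) - (∫ u in -(2 * δ)..2 * δ, N (t + δ) (t + u)) +
        ((∫ u in -(L / 2)..-(2 * δ), (N t (t + u) - N (t + δ) (t + u))) +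
        ∫ u in 2 * δ..L / 2, (N t (t + u) - N (t + δ) (t + u))) := by
      rw [← intervalIntegral.integral_sub (i0 _ _) (i1 _ _),
        ← intervalIntegral.integral_sub (i0 _ _) (i1 _ _),
        ← intervalIntegral.integral_add_adjacent_intervals (isub _ (-(2 * δ))) (isub _ _),
        ← intervalIntegral.integral_add_adjacent_intervals (isub (-(2 * δ)) (2 * δ)) (isub _ _)]
      ring
    have b1 : ‖∫ u in -(2 * δ)..2 * δ, N t (t + u)‖ ≤ C * (2 * 2 ^ α / α) * δ ^ α := by
      refine (norm_integral_le_of_le_abs_rpow (a := 2 * δ) hr hC (fun u hu hu' => hb t u hu ?_)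
        le_rfl (by linarith) le_rfl).trans (le_of_eq ?_)
      · linarith
      · rw [sub_add_cancel, Real.mul_rpow (by norm_num) hδ.le]
        ring
    have b2 : ‖∫ u in -(2 * δ)..2 * δ, N (t + δ) (t + u)‖ ≤ C * (2 * 3 ^ α / α) * δ ^ α := by
      have h1 : ∫ u in -(2 * δ)..2 * δ, N (t + δ) (t + u) =
          ∫ u in -(3 * δ)..δ, N (t + δ) (t + δ + u) := by
        have h1 := intervalIntegral.integral_comp_add_right (a := -(3 * δ)) (b := δ)
          (fun v => N (t + δ) (t + v)) δ
        rw [show -(3 * δ) + δ = -(2 * δ) by ring, show δ + δ = 2 * δ by ring] at h1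
        rw [← h1]
        congr 1
        funext u
        rw [add_assoc, add_comm δ]
      rw [h1]
      refine (norm_integral_le_of_le_abs_rpow (a := 3 * δ) hr hC
        (fun u hu hu' => hb (t + δ) u hu ?_) le_rfl (by linarith) (by linarith)).trans
        (le_of_eq ?_)
      · linarith
      · rw [sub_add_cancel, Real.mul_rpow (by norm_num) hδ.le]
        ring
    rw [e1, norm_sub_rev, e2]
    refine (norm_add_le _ _).trans ?_
    rw [add_mul, add_mul]
    exact add_le_add ((norm_sub_le _ _).trans (add_le_add b1 b2)) (hinc t δ hδ hδL)

/-! ### The Cauchy singular integral at order zero -/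

/-- The principal value Cauchy integral `∫ g(s) γ'(s) / (γ(s) - γ(t)) ds` over one period. -/
noncomputable def cauchyOp (L : ℝ) (γ g : ℝ → ℂ) (t : ℝ) : ℂ :=
  ∫ u in -(L / 2)..L / 2,
    (g (t + u) * (deriv γ (t + u) / (γ (t + u) - γ t)) - g t * (u : ℂ)⁻¹)

theorem RegularCurve.mono {L α β : ℝ} {γ : ℝ → ℂ} (hL : 0 < L) (hβ : 0 < β) (hβα : β ≤ α)
    (h : RegularCurve L α γ) : RegularCurve L β γ :=
  ⟨h.holder.mono_exponent hL hβ hβα, h.simple, h.regular⟩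

theorem measurable_cauchyKernel {γ : ℝ → ℂ} (hγ : Continuous γ) (hγ' : Continuous (deriv γ))
    (t : ℝ) : Measurable fun s => deriv γ s / (γ s - γ t) :=
  hγ'.measurable.div (hγ.measurable.sub_const _)

theorem CurveBounds.continuous {L α A B c : ℝ} {γ : ℝ → ℂ} (h : CurveBounds L α A B c γ) :
    Continuous γ := h.differentiable.continuous

theorem CurveBounds.continuous_deriv {L α A B c : ℝ} {γ : ℝ → ℂ} (h : CurveBounds L α A B c γ) :
    Continuous (deriv γ) := continuous_of_holder h.α_pos h.holder

theorem measurable_cauchyIntegrand {γ g : ℝ → ℂ} (hγ : Continuous γ) (hγ' : Continuous (deriv γ))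
    (hg : Continuous g) (t : ℝ) : Measurable fun u : ℝ =>
      g (t + u) * (deriv γ (t + u) / (γ (t + u) - γ t)) - g t * (u : ℂ)⁻¹ := by
  have h1 : Measurable fun u : ℝ => deriv γ (t + u) / (γ (t + u) - γ t) :=
    (measurable_cauchyKernel hγ hγ' t).comp (by fun_prop : Measurable fun u : ℝ => t + u)
  have h2 : Measurable fun u : ℝ => g (t + u) := (hg.comp (by fun_prop)).measurable
  exact (h2.mul h1).sub ((Complex.measurable_ofReal.inv).const_mul _)

/-- The term `g(t) / u` is odd, so subtracting it does not alter the principal value, while it makes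
the integrand absolutely integrable: one error comes from the Hölder continuity of `g`, the other
from `kernel_sub_inv`. -/
theorem norm_cauchyIntegrand_le {L β A B c G M : ℝ} {γ g : ℝ → ℂ}
    (h : CurveBounds L β A B c γ) (hg : ∀ s t, ‖g s - g t‖ ≤ G * |s - t| ^ β)
    (hM : ∀ t, ‖g t‖ ≤ M) (t u : ℝ) (hu : u ≠ 0) (huL : |u| ≤ L / 2) :
    ‖g (t + u) * (deriv γ (t + u) / (γ (t + u) - γ t)) - g t * (u : ℂ)⁻¹‖ ≤
      (G * (B / c) + M * (A / c)) * |u| ^ (β - 1) := by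
  have hL := h.L_pos
  have huL' : |t + u - t| ≤ 3 * L / 4 := by rw [add_sub_cancel_left]; linarith
  have hu' : t + u - t ≠ 0 := by rwa [add_sub_cancel_left]
  have h1 := h.kernel_sub_inv hu' huL'
  have h2 := h.norm_kernel_le hu' huL'
  have h3 := hg (t + u) t
  rw [add_sub_cancel_left] at h1 h2 h3
  have hp := abs_pos.2 hu
  have e : g (t + u) * (deriv γ (t + u) / (γ (t + u) - γ t)) - g t * (u : ℂ)⁻¹ =
      (g (t + u) - g t) * (deriv γ (t + u) / (γ (t + u) - γ t)) +
      g t * (deriv γ (t + u) / (γ (t + u) - γ t) - (u : ℂ)⁻¹) := by ring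
  rw [e]
  refine (norm_add_le _ _).trans ?_
  rw [norm_mul, norm_mul, add_mul]
  have h4 := (norm_nonneg _).trans h3
  have h5 := (norm_nonneg _).trans (hM t)
  refine add_le_add ?_ ?_
  · calc _ ≤ (G * |u| ^ β) * (B / c * |u|⁻¹) := by gcongr
      _ = _ := by rw [Real.rpow_sub_one hp.ne']; ring
  · calc _ ≤ M * (A / c * |u| ^ (β - 1)) := by
          gcongr
          exact hM t
      _ = _ := by ring

theorem intervalIntegrable_cauchyIntegrand {L β : ℝ} {γ g : ℝ → ℂ} (hL : 0 < L) (hβ : 0 < β)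
    (hγ : RegularCurve L β γ) (hg : HolderPer L β 0 g) (t : ℝ) {p q : ℝ} (hp : |p| ≤ L / 2)
    (hq : |q| ≤ L / 2) : IntervalIntegrable (fun u : ℝ =>
      g (t + u) * (deriv γ (t + u) / (γ (t + u) - γ t)) - g t * (u : ℂ)⁻¹) volume p q := by
  obtain ⟨A, B, c, h⟩ := hγ.exists_bounds hL hβ
  obtain ⟨G, hG⟩ := hg.2
  obtain ⟨M, -, hM⟩ := hg.exists_norm_le hL hβ
  exact intervalIntegrable_of_le_abs_rpow (by linarith)
    (measurable_cauchyIntegrand h.continuous h.continuous_deriv (hg.continuous hβ) t)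
    (norm_cauchyIntegrand_le h hG hM t) hp hq

theorem cauchyOp_add {L β : ℝ} {γ g₁ g₂ : ℝ → ℂ} (hL : 0 < L) (hβ : 0 < β)
    (hγ : RegularCurve L β γ) (hg₁ : HolderPer L β 0 g₁) (hg₂ : HolderPer L β 0 g₂) (t : ℝ) :
    cauchyOp L γ (fun t => g₁ t + g₂ t) t = cauchyOp L γ g₁ t + cauchyOp L γ g₂ t := by
  have hL2 : |L / 2| ≤ L / 2 := by rw [abs_of_pos (by positivity)]
  have hL2' : |-(L / 2)| ≤ L / 2 := by rwa [abs_neg]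
  unfold cauchyOp
  rw [← intervalIntegral.integral_add (intervalIntegrable_cauchyIntegrand hL hβ hγ hg₁ t hL2' hL2)
    (intervalIntegrable_cauchyIntegrand hL hβ hγ hg₂ t hL2' hL2)]
  congr 1
  funext u
  ring

theorem cauchyOp_periodic {L : ℝ} {γ g : ℝ → ℂ} (hγ : Function.Periodic γ L)
    (hg : Function.Periodic g L) : Function.Periodic (cauchyOp L γ g) L := by
  intro t
  unfold cauchyOp
  congr 1
  funext u
  rw [show t + L + u = t + u + L by ring, hg, hγ, hγ, hγ.deriv_periodic, hg]

/-- The two tails of `g(t) / u` cancel by oddness, so subtracting it is free; what remains is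
dominated by an integrable power, uniformly in `t` and in the truncation. -/
theorem exists_norm_tail_cauchy_le {L β : ℝ} {γ g : ℝ → ℂ} (hL : 0 < L) (hβ : 0 < β)
    (hγ : RegularCurve L β γ) (hg : HolderPer L β 0 g) : ∃ K : ℝ, 0 ≤ K ∧ ∀ t η, 0 < η →
    η ≤ L / 2 → ‖(∫ u in -(L / 2)..-η, g (t + u) * (deriv γ (t + u) / (γ (t + u) - γ t))) +
      ∫ u in η..L / 2, g (t + u) * (deriv γ (t + u) / (γ (t + u) - γ t))‖ ≤ K := by
  obtain ⟨A, B, c, h⟩ := hγ.exists_bounds hL hβ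
  obtain ⟨G, hG⟩ := hg.2
  obtain ⟨M, hM0, hM⟩ := hg.exists_norm_le hL hβ
  have hA := h.A_pos
  have hB := h.B_pos
  have hc := h.c_pos
  have hC : 0 ≤ |G| * (B / c) + M * (A / c) := by positivity
  have hG' : ∀ s t, ‖g s - g t‖ ≤ |G| * |s - t| ^ β := fun s t =>
    (hG s t).trans (mul_le_mul_of_nonneg_right (le_abs_self G) (by positivity))
  have hr : -1 < β - 1 := by linarith
  refine ⟨2 * ((|G| * (B / c) + M * (A / c)) * (2 * (L / 2) ^ (β - 1 + 1) / (β - 1 + 1))),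
    by rw [sub_add_cancel]; positivity, fun t η hη hηL => ?_⟩
  have key := norm_cauchyIntegrand_le h hG' hM t
  have b1 := norm_integral_le_of_le_abs_rpow hr hC key le_rfl (by linarith : -(L / 2) ≤ -η)
    (by linarith)
  have b2 := norm_integral_le_of_le_abs_rpow hr hC key (by linarith) hηL le_rfl
  have hinv : ∀ p q : ℝ, (0 : ℝ) ∉ uIcc p q →
      IntervalIntegrable (fun u : ℝ => g t * (u : ℂ)⁻¹) volume p q := by
    intro p q h0
    refine ContinuousOn.intervalIntegrable (continuousOn_const.mul
      (ContinuousOn.inv₀ (by fun_prop) fun u hu => ?_))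
    intro h1
    rw [Complex.ofReal_eq_zero] at h1
    exact h0 (h1 ▸ hu)
  have hn1 : (0 : ℝ) ∉ uIcc (-(L / 2)) (-η) := by
    rw [uIcc_of_le (by linarith)]; intro h; linarith [h.2]
  have hn2 : (0 : ℝ) ∉ uIcc η (L / 2) := by
    rw [uIcc_of_le (by linarith)]; intro h; linarith [h.1]
  have hint : ∀ p q : ℝ, |p| ≤ L / 2 → |q| ≤ L / 2 → (0 : ℝ) ∉ uIcc p q →
      ∫ u in p..q, g (t + u) * (deriv γ (t + u) / (γ (t + u) - γ t)) =
      (∫ u in p..q, (g (t + u) * (deriv γ (t + u) / (γ (t + u) - γ t)) - g t * (u : ℂ)⁻¹)) +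
      ∫ u in p..q, g t * (u : ℂ)⁻¹ := by
    intro p q hp hq h0
    rw [← intervalIntegral.integral_add
      (intervalIntegrable_cauchyIntegrand hL hβ hγ hg t hp hq) (hinv p q h0)]
    congr 1
    funext u
    ring
  have hL2 : |L / 2| ≤ L / 2 := by rw [abs_of_pos (by positivity)]
  have hη2 : |η| ≤ L / 2 := by rwa [abs_of_pos hη]
  have hodd : ∫ u in -(L / 2)..-η, g t * (u : ℂ)⁻¹ = -∫ u in η..L / 2, g t * (u : ℂ)⁻¹ := by
    rw [← intervalIntegral.integral_comp_neg, ← intervalIntegral.integral_neg]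
    congr 1
    funext u
    push_cast
    rw [inv_neg, mul_neg]
  rw [hint _ _ (by rwa [abs_neg]) (by rwa [abs_neg]) hn1, hint _ _ hη2 hL2 hn2, hodd, two_mul]
  refine le_trans (le_of_eq ?_) ((norm_add_le _ _).trans (add_le_add b1 b2))
  congr 1
  ring

theorem half_abs_le_abs_sub {u δ : ℝ} (hδ : 0 < δ) (h : 2 * δ ≤ |u|) :
    |u| / 2 ≤ |u - δ| ∧ |u - δ| ≤ 2 * |u| ∧ |u - δ| ≤ |u| + δ ∧ u - δ ≠ 0 ∧ u ≠ 0 := by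
  have h1 : |u - δ| ≤ |u| + |δ| := abs_sub _ _
  have h2 : |u| - |δ| ≤ |u - δ| := abs_sub_abs_le_abs_sub _ _
  rw [abs_of_pos hδ] at h1 h2
  refine ⟨by linarith, by linarith, h1, ?_, ?_⟩
  · rw [← abs_pos]; linarith
  · rw [← abs_pos]; linarith

theorem rpow_div_mul_le {u v α : ℝ} (hα1 : α ≤ 1) (hu : 0 < u) (h1 : u / 2 ≤ v) :
    (2 * u) ^ α / (u * v) ≤ 4 * u ^ (α - 2) := by
  have e : u ^ (α - 2) = u ^ α / (u * u) := by
    rw [Real.rpow_sub hu]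
    norm_num
    rw [pow_two]
  have h2 : (2 : ℝ) ^ α ≤ 2 := by
    calc (2 : ℝ) ^ α ≤ 2 ^ (1 : ℝ) := Real.rpow_le_rpow_of_exponent_le (by norm_num) hα1
      _ = 2 := Real.rpow_one 2
  rw [e, Real.mul_rpow (by norm_num) hu.le]
  calc 2 ^ α * u ^ α / (u * v) ≤ 2 * u ^ α / (u * (u / 2)) := by gcongr
    _ = _ := by field_simp; ring

/-- The factor `a(s) - a(t)` weakens the singularity to `|s - t|^{α-1}`, so the exponent of `a`
decides. The smaller exponent of `g` enters only through the boundedness of `g` and of its truncated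
Cauchy integrals. -/
theorem holderPer_commutator_zero {L α β : ℝ} {γ a g : ℝ → ℂ} (hL : 0 < L) (hβ : 0 < β)
    (hβα : β ≤ α) (hα1 : α < 1) (hγ : RegularCurve L α γ) (ha : HolderPer L α 0 a)
    (hg : HolderPer L β 0 g) : HolderPer L α 0
      fun t => cauchyOp L γ (fun t => a t * g t) t - a t * cauchyOp L γ g t := by
  have hα : 0 < α := hβ.trans_le hβα
  have hγβ := hγ.mono hL hβ hβα
  have hL2 : |L / 2| ≤ L / 2 := by rw [abs_of_pos (by positivity)]
  have hL2' : |-(L / 2)| ≤ L / 2 := by rwa [abs_neg]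
  obtain ⟨A, B, c, h⟩ := hγ.exists_bounds hL hα
  obtain ⟨M, hM0, hM⟩ := hg.exists_norm_le hL hβ
  obtain ⟨a', ha'⟩ := ha.2
  obtain ⟨K, hK0, hK⟩ := exists_norm_tail_cauchy_le hL hβ hγβ hg
  have hB := h.B_pos
  have hc := h.c_pos
  have hd : ∀ s t, ‖a s - a t‖ ≤ |a'| * |s - t| ^ α := fun s t =>
    (ha' s t).trans (mul_le_mul_of_nonneg_right (le_abs_self a') (by positivity))
  have hgc := hg.continuous hβ
  have hac := ha.continuous hα
  let N : ℝ → ℝ → ℂ := fun t s => (a s - a t) * (g s * (deriv γ s / (γ s - γ t)))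
  have hm : ∀ t, Measurable (N t) := fun t =>
    (hac.measurable.sub_const _).mul
      (hgc.measurable.mul (measurable_cauchyKernel h.continuous h.continuous_deriv t))
  have hb : ∀ t u, u ≠ 0 → |u| ≤ L / 2 →
      ‖N t (t + u)‖ ≤ |a'| * (M * (B / c)) * |u| ^ (α - 1) := by
    intro t u hu huL
    have h2 := h.norm_kernel_le (s := t + u) (t := t) (by rwa [add_sub_cancel_left])
      (by rw [add_sub_cancel_left]; linarith)
    have h3 := hd (t + u) t
    rw [add_sub_cancel_left] at h2 h3
    simp only [N, norm_mul]
    calc _ ≤ (|a'| * |u| ^ α) * (M * (B / c * |u|⁻¹)) := by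
          gcongr
          exact hM _
      _ = _ := by rw [Real.rpow_sub_one (abs_pos.2 hu).ne']; ring
  have hγp := hγ.holder.periodic
  refine (holderPer_of_kernel (N := N) (C := |a'| * (M * (B / c)))
    (D := |a'| * K + 2 * (4 * |a'| * M * (B ^ 2 / c ^ 2)) / (1 - α)) hL hα (by positivity) hm
    ?_ ?_ hb ?_).congr ?_
  · intro t s
    simp only [N]
    rw [ha.1, hg.1, hγp, hγp.deriv_periodic]
  · intro t s
    simp only [N]
    rw [ha.1, hγp]
  · intro t δ hδ hδL
    -- The first term is an increment of `a`, constant in `u`, times a truncated Cauchy integrand,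
    -- bounded after integration. The second has the increment of the kernel, and decays like `δ
    -- |u|^{α-2}`.
    have e : ∀ u, N t (t + u) - N (t + δ) (t + u) =
        (a (t + δ) - a t) * (g (t + u) * (deriv γ (t + u) / (γ (t + u) - γ t))) +
        (a (t + u) - a (t + δ)) * (g (t + u) * (deriv γ (t + u) / (γ (t + u) - γ t) -
          deriv γ (t + u) / (γ (t + u) - γ (t + δ)))) := by
      intro u; simp only [N]; ring
    have hκ : ∀ t' p q : ℝ, (∀ u ∈ uIcc p q, γ (t + u) - γ t' ≠ 0) → IntervalIntegrable
        (fun u => deriv γ (t + u) / (γ (t + u) - γ t')) volume p q := by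
      intro t' p q h0
      refine ContinuousOn.intervalIntegrable (ContinuousOn.div ?_ ?_ h0)
      · exact (h.continuous_deriv.comp (by fun_prop)).continuousOn
      · exact ((h.continuous.comp (by fun_prop)).sub continuous_const).continuousOn
    have hne : ∀ u, 2 * δ ≤ |u| → |u| ≤ L / 2 →
        γ (t + u) - γ t ≠ 0 ∧ γ (t + u) - γ (t + δ) ≠ 0 := by
      intro u hu huL
      obtain ⟨h1, h2, h3, h4, h5⟩ := half_abs_le_abs_sub hδ hu
      exact ⟨h.sub_ne_zero (by rwa [add_sub_cancel_left]) (by rw [add_sub_cancel_left]; linarith),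
        h.sub_ne_zero (by rwa [add_sub_add_left_eq_sub])
          (by rw [add_sub_add_left_eq_sub]; linarith)⟩
    have hm1 : ∀ u ∈ uIcc (-(L / 2)) (-(2 * δ)), 2 * δ ≤ |u| ∧ |u| ≤ L / 2 := by
      intro u hu
      rw [uIcc_of_le (by linarith)] at hu
      rw [abs_of_neg (by linarith [hu.2])]
      exact ⟨by linarith [hu.2], by linarith [hu.1]⟩
    have hm2 : ∀ u ∈ uIcc (2 * δ) (L / 2), 2 * δ ≤ |u| ∧ |u| ≤ L / 2 := by
      intro u hu
      rw [uIcc_of_le (by linarith)] at hu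
      rw [abs_of_pos (by linarith [hu.1])]
      exact ⟨by linarith [hu.1], by linarith [hu.2]⟩
    have split : ∀ p q : ℝ, (∀ u ∈ uIcc p q, 2 * δ ≤ |u| ∧ |u| ≤ L / 2) →
        ∫ u in p..q, (N t (t + u) - N (t + δ) (t + u)) =
        (a (t + δ) - a t) *
          (∫ u in p..q, g (t + u) * (deriv γ (t + u) / (γ (t + u) - γ t))) +
        ∫ u in p..q, (a (t + u) - a (t + δ)) * (g (t + u) *
          (deriv γ (t + u) / (γ (t + u) - γ t) -
          deriv γ (t + u) / (γ (t + u) - γ (t + δ)))) := by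
      intro p q hpq
      have i1 := hκ t p q fun u hu => (hne u (hpq u hu).1 (hpq u hu).2).1
      have i2 := hκ (t + δ) p q fun u hu => (hne u (hpq u hu).1 (hpq u hu).2).2
      rw [← intervalIntegral.integral_const_mul, ← intervalIntegral.integral_add]
      · simp only [e]
      · exact (i1.continuousOn_mul (hgc.comp (by fun_prop)).continuousOn).const_mul _
      · exact ((i1.sub i2).continuousOn_mul
          (hgc.comp (by fun_prop)).continuousOn).continuousOn_mul
          ((hac.comp (by fun_prop)).sub continuous_const).continuousOn
    rw [split _ _ hm1, split _ _ hm2]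
    have T1 := hK t (2 * δ) (by positivity) (by linarith)
    have T2 := norm_tail_le (F := fun u => (a (t + u) - a (t + δ)) * (g (t + u) *
          (deriv γ (t + u) / (γ (t + u) - γ t) -
          deriv γ (t + u) / (γ (t + u) - γ (t + δ))))) (α := α) (δ := δ) (a := L / 2)
          (D := 4 * |a'| * M * (B ^ 2 / c ^ 2)) hα1 (by positivity) hδ (by linarith) (by
      intro u hu huL
      obtain ⟨h1, h2, h3, h4, h5⟩ := half_abs_le_abs_sub hδ hu
      have hp := abs_pos.2 h5
      have k1 := h.norm_kernel_sub_le (s := t + u) (t := t) (t' := t + δ)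
        (by rwa [add_sub_cancel_left]) (by rw [add_sub_cancel_left]; linarith)
        (by rwa [add_sub_add_left_eq_sub]) (by rw [add_sub_add_left_eq_sub]; linarith)
      have k2 := hd (t + u) (t + δ)
      rw [add_sub_cancel_left, add_sub_add_left_eq_sub, sub_add_cancel_left, abs_neg,
        abs_of_pos hδ] at k1
      rw [add_sub_add_left_eq_sub] at k2
      have k3 : |u - δ| ^ α ≤ (2 * |u|) ^ α := Real.rpow_le_rpow (abs_nonneg _) h2 hα.le
      rw [norm_mul, norm_mul]
      calc _ ≤ (|a'| * (2 * |u|) ^ α) * (M * (B ^ 2 / c ^ 2 * δ / (|u| * |u - δ|))) := by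
            gcongr
            · exact k2.trans (by gcongr)
            · exact hM _
        _ = |a'| * M * (B ^ 2 / c ^ 2) * δ * ((2 * |u|) ^ α / (|u| * |u - δ|)) := by ring
        _ ≤ |a'| * M * (B ^ 2 / c ^ 2) * δ * (4 * |u| ^ (α - 2)) := by
            have := rpow_div_mul_le hα1.le hp h1
            gcongr
        _ = _ := by ring)
    have k4 := hd (t + δ) t
    rw [add_sub_cancel_left, abs_of_pos hδ] at k4
    rw [add_mul]
    refine le_trans ?_ (add_le_add (?_ : ‖(a (t + δ) - a t) *
      ((∫ u in -(L / 2)..-(2 * δ), g (t + u) * (deriv γ (t + u) / (γ (t + u) - γ t))) +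
      ∫ u in 2 * δ..L / 2, g (t + u) * (deriv γ (t + u) / (γ (t + u) - γ t)))‖ ≤ _) T2)
    · refine le_trans (le_of_eq ?_) (norm_add_le _ _)
      congr 1
      ring
    · rw [norm_mul]
      calc _ ≤ (|a'| * δ ^ α) * K := by gcongr
        _ = _ := by ring
  · intro t
    have i1 := intervalIntegrable_cauchyIntegrand hL hβ hγβ
      ((ha.mono_exponent hL hβ hβα).mul hL hβ (hβα.trans hα1.le) hg) t hL2' hL2
    have i2 := intervalIntegrable_cauchyIntegrand hL hβ hγβ hg t hL2' hL2
    unfold cauchyOp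
    rw [← intervalIntegral.integral_const_mul,
      ← intervalIntegral.integral_sub i1 (i2.const_mul _)]
    congr 1
    funext u
    simp only [N]
    ring

/-- The common singularity `1 / (s - t)` cancels in the difference of the kernels. What is left has
the size and the increments dictated by the exponent `α` of the two curves, and only the boundedness
of `g` matters. -/
theorem holderPer_cauchyOp_sub_zero {L α β : ℝ} {γ e g : ℝ → ℂ} (hL : 0 < L) (hβ : 0 < β)
    (hβα : β ≤ α) (hα1 : α < 1) (hγ : RegularCurve L α γ) (he : RegularCurve L α e)
    (hg : HolderPer L β 0 g) : HolderPer L α 0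
      fun t => cauchyOp L γ g t - cauchyOp L e g t := by
  have hα : 0 < α := hβ.trans_le hβα
  have hL2 : |L / 2| ≤ L / 2 := by rw [abs_of_pos (by positivity)]
  have hL2' : |-(L / 2)| ≤ L / 2 := by rwa [abs_neg]
  obtain ⟨A, B, c, h⟩ := hγ.exists_bounds hL hα
  obtain ⟨A', B', c', h'⟩ := he.exists_bounds hL hα
  obtain ⟨M, hM0, hM⟩ := hg.exists_norm_le hL hβ
  have hA := h.A_pos
  have hA' := h'.A_pos
  have hB := h.B_pos
  have hB' := h'.B_pos
  have hc := h.c_pos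
  have hc' := h'.c_pos
  have hgc := hg.continuous hβ
  let N : ℝ → ℝ → ℂ := fun t s => g s * (deriv γ s / (γ s - γ t) - deriv e s / (e s - e t))
  have hm : ∀ t, Measurable (N t) := fun t => hgc.measurable.mul
    ((measurable_cauchyKernel h.continuous h.continuous_deriv t).sub
      (measurable_cauchyKernel h'.continuous h'.continuous_deriv t))
  have hb : ∀ t u, u ≠ 0 → |u| ≤ L / 2 →
      ‖N t (t + u)‖ ≤ M * (A / c + A' / c') * |u| ^ (α - 1) := by
    intro t u hu huL
    have hu1 : t + u - t ≠ 0 := by rwa [add_sub_cancel_left]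
    have hu2 : |t + u - t| ≤ 3 * L / 4 := by rw [add_sub_cancel_left]; linarith
    have h2 := h.kernel_sub_inv hu1 hu2
    have h3 := h'.kernel_sub_inv hu1 hu2
    rw [add_sub_cancel_left] at h2 h3
    have h4 := (norm_sub_le _ _).trans (add_le_add h2 h3)
    rw [sub_sub_sub_cancel_right] at h4
    simp only [N, norm_mul]
    calc _ ≤ M * (A / c * |u| ^ (α - 1) + A' / c' * |u| ^ (α - 1)) := by
          gcongr
          exact hM _
      _ = _ := by ring
  have hγp := hγ.holder.periodic
  have hep := he.holder.periodic
  refine (holderPer_of_kernel (N := N) (C := M * (A / c + A' / c'))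
    (D := 2 * (4 * M * (3 * A * B / c ^ 2 + 3 * A' * B' / c' ^ 2)) / (1 - α)) hL hα
    (by positivity) hm ?_ ?_ hb ?_).congr ?_
  · intro t s
    simp only [N]
    rw [hg.1, hγp, hγp.deriv_periodic, hep, hep.deriv_periodic]
  · intro t s
    simp only [N]
    rw [hγp, hep]
  · intro t δ hδ hδL
    refine norm_tail_le (F := fun u => N t (t + u) - N (t + δ) (t + u)) hα1 (by positivity) hδ
      (by linarith) ?_
    intro u hu huL
    obtain ⟨h1, h2, h3, h4, h5⟩ := half_abs_le_abs_sub hδ hu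
    have hp := abs_pos.2 h5
    have q1 : t + u - t ≠ 0 := by rwa [add_sub_cancel_left]
    have q2 : |t + u - t| ≤ 3 * L / 4 := by rw [add_sub_cancel_left]; linarith
    have q3 : t + u - (t + δ) ≠ 0 := by rwa [add_sub_add_left_eq_sub]
    have q4 : |t + u - (t + δ)| ≤ 3 * L / 4 := by rw [add_sub_add_left_eq_sub]; linarith
    have q5 : |t + u - t| ≤ 2 * |u| := by rw [add_sub_cancel_left]; linarith
    have q6 : |t + u - (t + δ)| ≤ 2 * |u| := by rwa [add_sub_add_left_eq_sub]
    have k1 := h.norm_kernel_sub_sub_le q1 q2 q3 q4 q5 q6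
    have k2 := h'.norm_kernel_sub_sub_le q1 q2 q3 q4 q5 q6
    have k3 := (norm_sub_le _ _).trans (add_le_add k1 k2)
    rw [sub_sub_sub_cancel_right, add_sub_cancel_left, add_sub_add_left_eq_sub,
      sub_add_cancel_left, abs_neg, abs_of_pos hδ] at k3
    have eN : N t (t + u) - N (t + δ) (t + u) = g (t + u) *
        (deriv γ (t + u) / (γ (t + u) - γ t) - deriv γ (t + u) / (γ (t + u) - γ (t + δ)) -
        (deriv e (t + u) / (e (t + u) - e t) - deriv e (t + u) / (e (t + u) - e (t + δ)))) := by
      simp only [N]; ring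
    have hr := rpow_div_mul_le hα1.le hp h1
    simp only [eN]
    rw [norm_mul]
    calc _ ≤ M * (3 * A * B / c ^ 2 * δ * (2 * |u|) ^ α / (|u| * |u - δ|) +
          3 * A' * B' / c' ^ 2 * δ * (2 * |u|) ^ α / (|u| * |u - δ|)) := by
          gcongr
          exact hM _
      _ = M * (3 * A * B / c ^ 2 + 3 * A' * B' / c' ^ 2) * δ *
          ((2 * |u|) ^ α / (|u| * |u - δ|)) := by ring
      _ ≤ M * (3 * A * B / c ^ 2 + 3 * A' * B' / c' ^ 2) * δ * (4 * |u| ^ (α - 2)) := by gcongr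
      _ = _ := by ring
  · intro t
    have i1 := intervalIntegrable_cauchyIntegrand hL hβ (hγ.mono hL hβ hβα) hg t hL2' hL2
    have i2 := intervalIntegrable_cauchyIntegrand hL hβ (he.mono hL hβ hβα) hg t hL2' hL2
    unfold cauchyOp
    rw [← intervalIntegral.integral_sub i1 i2]
    congr 1
    funext u
    simp only [N]
    ring

/-! ### Differentiation of the Cauchy operator and higher-order commutators -/

/-- This is the derivative of the kernel along the diagonal, with `s = t + u` moving together with
`t`. The terms linear in `u` cancel in the numerator, so no singularity of order `u⁻²` appears. -/
theorem CurveBounds.norm_deriv_kernel_le {L β A B c A₂ B₂ : ℝ} {γ : ℝ → ℂ}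
    (h : CurveBounds L β A B c γ)
    (hA₂0 : 0 ≤ A₂) (hB₂ : ∀ t, ‖deriv (deriv γ) t‖ ≤ B₂) (hL1 : ∀ s t, ‖deriv γ s - deriv γ t -
      (s - t : ℝ) * deriv (deriv γ) s‖ ≤ A₂ * |s - t| ^ β * |s - t|)
    (t u : ℝ) (hu : u ≠ 0) (huL : |u| ≤ L / 2) :
    ‖(deriv (deriv γ) (t + u) * (γ (t + u) - γ t) - deriv γ (t + u) *
      (deriv γ (t + u) - deriv γ t)) / (γ (t + u) - γ t) ^ 2‖ ≤
      (B₂ * A + B * A₂) / c ^ 2 * |u| ^ (β - 1) := by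
  have hL := h.L_pos
  have hA := h.A_pos
  have hB := h.B_pos
  have hc := h.c_pos
  have hp := abs_pos.2 hu
  have hB₂0 : 0 ≤ B₂ := (norm_nonneg _).trans (hB₂ 0)
  have k1 := h.taylor (s := t + u) (t := t) (r := t + u) (ρ := |u|) (by simp) (by simp)
  have k2 := hL1 (t + u) t
  have k3 := h.chord t u (by linarith)
  rw [add_sub_cancel_left] at k1 k2
  have e : deriv (deriv γ) (t + u) * (γ (t + u) - γ t) - deriv γ (t + u) *
      (deriv γ (t + u) - deriv γ t) =
      deriv (deriv γ) (t + u) * (γ (t + u) - γ t - (u : ℂ) * deriv γ (t + u)) -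
      deriv γ (t + u) * (deriv γ (t + u) - deriv γ t - (u : ℂ) * deriv (deriv γ) (t + u)) := by
    ring
  rw [norm_div, norm_pow, e]
  calc _ ≤ (B₂ * (A * |u| ^ β * |u|) + B * (A₂ * |u| ^ β * |u|)) / (c * |u|) ^ 2 := by
        gcongr
        refine (norm_sub_le _ _).trans ?_
        rw [norm_mul, norm_mul]
        gcongr
        · exact hB₂ _
        · exact h.bound _
    _ = _ := by rw [Real.rpow_sub_one hp.ne']; field_simp

/-- In the variable `ζ = γ(t)` this says that differentiation `d/dζ` commutes with the Cauchy
integral. Differentiation under the integral sign is followed by an integration by parts over one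
period. -/
theorem hasDerivAt_cauchyOp {L β : ℝ} {γ g : ℝ → ℂ} (hL : 0 < L) (hβ : 0 < β) (hβ1 : β ≤ 1)
    (hγ : RegularCurve L β γ) (hγ2 : HolderPer L β 2 γ) (hg : HolderPer L β 1 g) (t : ℝ) :
    HasDerivAt (cauchyOp L γ g)
      (deriv γ t * cauchyOp L γ (fun t => deriv g t / deriv γ t) t) t := by
  obtain ⟨A, B, c, h⟩ := hγ.exists_bounds hL hβ
  have hA := h.A_pos
  have hB := h.B_pos
  have hc := h.c_pos
  have hL2 : |L / 2| ≤ L / 2 := by rw [abs_of_pos (by positivity)]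
  have hL2' : |-(L / 2)| ≤ L / 2 := by rwa [abs_neg]
  have hr : -1 < β - 1 := by linarith
  have hg0 : HolderPer L β 0 g := hg.of_succ hL hβ hβ1
  have hg' : HolderPer L β 0 (deriv g) := hg.2.2
  have hgd : Differentiable ℝ g := hg.2.1
  have hγd : Differentiable ℝ γ := hγ2.2.1
  have hγ'd : Differentiable ℝ (deriv γ) := hγ2.2.2.2.1
  have hγ'' : HolderPer L β 0 (deriv (deriv γ)) := hγ2.2.2.2.2
  have hgc := hgd.continuous
  have hg'c := hg'.continuous hβ
  have hγc := hγd.continuous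
  have hγ'c := hγ'd.continuous
  have hγ''c := hγ''.continuous hβ
  obtain ⟨G', hG'⟩ := hg'.2
  obtain ⟨M', -, hM'⟩ := hg'.exists_norm_le hL hβ
  obtain ⟨M, hM0, hM⟩ := hg0.exists_norm_le hL hβ
  obtain ⟨A₂', hA₂'⟩ := hγ''.2
  have hA₂ : ∀ s t, ‖deriv (deriv γ) s - deriv (deriv γ) t‖ ≤ |A₂'| * |s - t| ^ β := fun s t =>
    (hA₂' s t).trans (mul_le_mul_of_nonneg_right (le_abs_self A₂') (by positivity))
  obtain ⟨B₂, hB₂0, hB₂⟩ := hγ''.exists_norm_le hL hβ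
  have hT : ∀ s t, ‖deriv γ s - deriv γ t - (s - t : ℝ) * deriv (deriv γ) s‖ ≤
      |A₂'| * |s - t| ^ β * |s - t| := fun s t =>
    taylor_of_deriv_holder hγ'd hA₂ (abs_nonneg _) hβ.le (by simp) (by rw [abs_sub_comm])
  have hne : ∀ x u, u ≠ 0 → |u| ≤ L / 2 → γ (x + u) - γ x ≠ 0 := fun x u hu huL =>
    h.sub_ne_zero (by rwa [add_sub_cancel_left]) (by rw [add_sub_cancel_left]; linarith)
  have hs : ∀ (φ : ℝ → ℂ), Differentiable ℝ φ → ∀ x u : ℝ,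
      HasDerivAt (fun x => φ (x + u)) (deriv φ (x + u)) x := fun φ hφ x u =>
    (hφ (x + u)).hasDerivAt.comp_add_const x u
  have hs' : ∀ (φ : ℝ → ℂ), Differentiable ℝ φ → ∀ x u : ℝ,
      HasDerivAt (fun u => φ (x + u)) (deriv φ (x + u)) u := fun φ hφ x u =>
    (hφ (x + u)).hasDerivAt.comp_const_add x u
  let q : ℝ → ℝ → ℂ := fun t u => (deriv (deriv γ) (t + u) * (γ (t + u) - γ t) -
    deriv γ (t + u) * (deriv γ (t + u) - deriv γ t)) / (γ (t + u) - γ t) ^ 2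
  let F' : ℝ → ℝ → ℂ := fun t u =>
    (deriv g (t + u) * (deriv γ (t + u) / (γ (t + u) - γ t)) - deriv g t * (u : ℂ)⁻¹) +
    g (t + u) * q t u
  have hpar : ∀ p : ℝ → ℂ, Continuous p → Measurable fun u => p (t + u) := fun p hp =>
    (hp.comp (by fun_prop)).measurable
  have main := intervalIntegral.hasDerivAt_integral_of_dominated_loc_of_deriv_le
    (μ := volume) (a := -(L / 2)) (b := L / 2) (x₀ := t) (s := univ)
    (F := fun t u => g (t + u) * (deriv γ (t + u) / (γ (t + u) - γ t)) - g t * (u : ℂ)⁻¹)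
    (F' := F') (bound := fun u => (G' * (B / c) + M' * (A / c)) * |u| ^ (β - 1) +
      M * ((B₂ * A + B * |A₂'|) / c ^ 2 * |u| ^ (β - 1))) univ_mem
    (Eventually.of_forall fun x =>
      (measurable_cauchyIntegrand hγc hγ'c hgc x).aestronglyMeasurable)
    (intervalIntegrable_cauchyIntegrand hL hβ hγ hg0 t hL2' hL2) ?_ ?_ ?_ ?_
  · obtain ⟨m1, m2⟩ := main
    have hq0 : HolderPer L β 0 fun t => deriv g t / deriv γ t :=
      (hg'.mul hL hβ hβ1 (hγ.holder.2.2.inv hL hβ hβ1 hγ.regular)).congr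
        fun t => div_eq_mul_inv _ _
    have i2 := intervalIntegrable_cauchyIntegrand hL hβ hγ hq0 t hL2' hL2
    -- The difference of the two integrands is the `u`-derivative of `g(t+u) (γ'(t+u) - γ'(t)) /
    -- (γ(t+u) - γ(t))`, which takes equal values at `±L/2` by periodicity.
    have key : ∫ u in -(L / 2)..L / 2, (F' t u - deriv γ t * (deriv g (t + u) / deriv γ (t + u) *
        (deriv γ (t + u) / (γ (t + u) - γ t)) - deriv g t / deriv γ t * (u : ℂ)⁻¹)) = 0 := by
      -- Writing this primitive as a quotient of `dslope`s makes it continuous across `u = 0`, the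
      -- single point where differentiability is not checked.
      have hΨne : ∀ u ∈ Icc (-(L / 2)) (L / 2), dslope γ t (t + u) ≠ 0 := by
        intro u hu
        rcases eq_or_ne u 0 with rfl | hu0
        · simpa using hγ.regular t
        · rw [dslope_of_ne _ (by simpa using hu0), slope_def_module]
          refine smul_ne_zero (inv_ne_zero (by simpa using hu0)) ?_
          exact hne t u hu0 (abs_le.2 hu)
      have hds : ∀ φ : ℝ → ℂ, Differentiable ℝ φ → Continuous fun u => dslope φ t (t + u) := by
        intro φ hφ
        have : Continuous (dslope φ t) := by
          rw [← continuousOn_univ, continuousOn_dslope univ_mem]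
          exact ⟨hφ.continuous.continuousOn, hφ t⟩
        exact this.comp (by fun_prop)
      have hΨ : ∀ u, u ≠ 0 → u ∈ Icc (-(L / 2)) (L / 2) →
          g (t + u) * (dslope (deriv γ) t (t + u) / dslope γ t (t + u)) =
          g (t + u) * ((deriv γ (t + u) - deriv γ t) / (γ (t + u) - γ t)) := by
        intro u hu0 hu
        rw [dslope_of_ne _ (by simpa using hu0), dslope_of_ne _ (by simpa using hu0),
          slope_def_module, slope_def_module, add_sub_cancel_left, Complex.real_smul,
          Complex.real_smul]
        congr 1
        refine mul_div_mul_left _ _ ?_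
        exact_mod_cast inv_ne_zero hu0
      rw [integral_eq_of_hasDerivAt_off_countable_of_le
        (fun u => g (t + u) * (dslope (deriv γ) t (t + u) / dslope γ t (t + u))) _
        (by linarith) (countable_singleton 0) ?_ ?_ (m1.sub (i2.const_mul _))]
      · rw [hΨ _ (by linarith) ⟨by linarith, le_rfl⟩,
          hΨ _ (by linarith) ⟨le_rfl, by linarith⟩,
          show t + L / 2 = t + -(L / 2) + L by ring, hg0.1, hγ.holder.periodic,
          hγ.holder.periodic.deriv_periodic, sub_self]
      · exact (hgc.comp (by fun_prop)).continuousOn.mul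
          ((hds _ hγ'd).continuousOn.div (hds _ hγd).continuousOn hΨne)
      · intro u hu
        have hu0 : u ≠ 0 := hu.2
        have huL : u ∈ Icc (-(L / 2)) (L / 2) := Ioo_subset_Icc_self hu.1
        have hn := hne t u hu0 (abs_le.2 huL)
        have hn' := hγ.regular (t + u)
        have hn'' := hγ.regular t
        have d : HasDerivAt (fun u => g (t + u) *
            ((deriv γ (t + u) - deriv γ t) / (γ (t + u) - γ t))) _ u :=
          (hs' g hgd t u).fun_mul (((hs' _ hγ'd t u).sub_const (deriv γ t)).fun_div
            ((hs' _ hγd t u).sub_const (γ t)) hn)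
        have d2 := d.congr_of_eventuallyEq (f₁ := fun u => g (t + u) *
          (dslope (deriv γ) t (t + u) / dslope γ t (t + u))) (by
            filter_upwards [isOpen_Ioo.mem_nhds hu.1, isOpen_ne.mem_nhds hu0] with v hv hv0
            exact hΨ v hv0 (Ioo_subset_Icc_self hv))
        convert d2 using 1
        simp only [F', q]
        have hu0' : (u : ℂ) ≠ 0 := by exact_mod_cast hu0
        field_simp
        ring
    rw [intervalIntegral.integral_sub m1 (i2.const_mul _), intervalIntegral.integral_const_mul,
      sub_eq_zero] at key
    rw [key] at m2
    exact m2
  · refine Measurable.aestronglyMeasurable ?_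
    refine (measurable_cauchyIntegrand hγc hγ'c hg'c t).add ((hpar _ hgc).mul ?_)
    exact (((hpar _ hγ''c).mul ((hpar _ hγc).sub_const _)).sub
      ((hpar _ hγ'c).mul ((hpar _ hγ'c).sub_const _))).div (((hpar _ hγc).sub_const _).pow_const 2)
  · filter_upwards [ae_ne_zero] with u hu0 hu x _
    rw [uIoc_of_le (by linarith)] at hu
    have huL : |u| ≤ L / 2 := abs_le.2 ⟨hu.1.le, hu.2⟩
    refine (norm_add_le _ _).trans (add_le_add
      (norm_cauchyIntegrand_le h hG' hM' x u hu0 huL) ?_)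
    rw [norm_mul]
    exact mul_le_mul (hM _) (h.norm_deriv_kernel_le (abs_nonneg _) hB₂ hT x u hu0 huL)
      (norm_nonneg _) hM0.le
  · exact ((intervalIntegrable_abs_rpow hr _ _).const_mul _).add
      (((intervalIntegrable_abs_rpow hr _ _).const_mul _).const_mul _)
  · filter_upwards [ae_ne_zero] with u hu0 hu x _
    rw [uIoc_of_le (by linarith)] at hu
    have huL : |u| ≤ L / 2 := abs_le.2 ⟨hu.1.le, hu.2⟩
    have hn := hne x u hu0 huL
    have d := ((hs g hgd x u).fun_mul ((hs _ hγ'd x u).fun_div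
      ((hs _ hγd x u).fun_sub (hγd x).hasDerivAt) hn)).fun_sub
      ((hgd x).hasDerivAt.mul_const (u : ℂ)⁻¹)
    convert d using 1
    simp only [F', q]
    ring

/-- With `D = (1/γ') d/dt`, the rule `D [C, a] g = [C, D a] g + [C, a] D g` expresses the derivative
by commutators of one order less, and the induction ends at `holderPer_commutator_zero`. -/
theorem holderPer_commutator {L α β : ℝ} {k : ℕ} {γ a g : ℝ → ℂ} (hL : 0 < L) (hβ : 0 < β)
    (hβα : β ≤ α) (hα1 : α < 1) (hγ : RegularCurve L α γ) (hγk : HolderPer L α (k + 1) γ)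
    (ha : HolderPer L α k a) (hg : HolderPer L β k g) : HolderPer L α k
      fun t => cauchyOp L γ (fun t => a t * g t) t - a t * cauchyOp L γ g t := by
  have hα : 0 < α := hβ.trans_le hβα
  have hβ1 : β ≤ 1 := hβα.trans hα1.le
  induction k generalizing a g with
  | zero => exact holderPer_commutator_zero hL hβ hβα hα1 hγ ha hg
  | succ k ih =>
    have hγβ := hγ.mono hL hβ hβα
    have hγ2 : HolderPer L β 2 γ := (hγk.of_le hL hα hα1.le (by omega)).mono_exponent hL hβ hβα
    have hg1 : HolderPer L β 1 g := hg.of_le hL hβ hβ1 (by omega)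
    have haβ : HolderPer L β 1 a := (ha.of_le hL hα hα1.le (by omega)).mono_exponent hL hβ hβα
    have hg0 := hg1.of_succ hL hβ hβ1
    have ha0 := haβ.of_succ hL hβ hβ1
    have hγ'α : HolderPer L α k (deriv γ) := hγk.2.2.of_succ hL hα hα1.le
    have hiα : HolderPer L α k fun t => (deriv γ t)⁻¹ := hγ'α.inv hL hα hα1.le hγ.regular
    have hiβ := hiα.mono_exponent hL hβ hβα
    have hqg : HolderPer L β k fun t => deriv g t / deriv γ t :=
      (hg.2.2.mul hL hβ hβ1 hiβ).congr fun t => div_eq_mul_inv _ _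
    have hqa : HolderPer L α k fun t => deriv a t / deriv γ t :=
      (ha.2.2.mul hL hα hα1.le hiα).congr fun t => div_eq_mul_inv _ _
    have h1 := ih (hγk.of_succ hL hα hα1.le) hqa (hg.of_succ hL hβ hβ1)
    have h2 := ih (hγk.of_succ hL hα hα1.le) (ha.of_succ hL hα hα1.le) hqg
    have hd : ∀ t, HasDerivAt
        (fun t => cauchyOp L γ (fun t => a t * g t) t - a t * cauchyOp L γ g t)
        (deriv γ t * ((cauchyOp L γ (fun t => deriv a t / deriv γ t * g t) t -
          deriv a t / deriv γ t * cauchyOp L γ g t) +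
          (cauchyOp L γ (fun t => a t * (deriv g t / deriv γ t)) t -
          a t * cauchyOp L γ (fun t => deriv g t / deriv γ t) t))) t := by
      intro t
      have d1 := hasDerivAt_cauchyOp hL hβ hβ1 hγβ hγ2 (haβ.mul hL hβ hβ1 hg1) t
      have d2 := hasDerivAt_cauchyOp hL hβ hβ1 hγβ hγ2 hg1 t
      have d3 := d1.fun_sub ((ha.2.1 t).hasDerivAt.fun_mul d2)
      have e : (fun t => deriv (fun t => a t * g t) t / deriv γ t) =
          fun t => deriv a t / deriv γ t * g t + a t * (deriv g t / deriv γ t) := by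
        funext s
        rw [((ha.2.1 s).hasDerivAt.fun_mul (hg.2.1 s).hasDerivAt).deriv]
        ring
      rw [e, cauchyOp_add hL hβ hγβ
        (((hqa.of_le hL hα hα1.le (Nat.zero_le _)).mono_exponent hL hβ hβα).mul hL hβ hβ1 hg0)
        (ha0.mul hL hβ hβ1 (hqg.of_le hL hβ hβ1 (Nat.zero_le _)))] at d3
      refine d3.congr_deriv ?_
      have h0 := hγ.regular t
      field_simp
      ring
    refine ⟨?_, fun t => (hd t).differentiableAt, ?_⟩
    · have hp1 := cauchyOp_periodic hγ.holder.periodic (ha.periodic.mul hg.periodic)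
      have hp2 := cauchyOp_periodic hγ.holder.periodic hg.periodic
      exact hp1.sub (ha.periodic.mul hp2)
    · exact (hγ'α.mul hL hα hα1.le (h1.add h2)).congr fun t => (hd t).deriv

/-- This is `γ'` times the commutator with `1 / γ'`. It lets `γ'` be moved through the operator at
the cost of a `C^{k+α}` error. -/
theorem holderPer_mul_cauchyOp_div_sub {L α β : ℝ} {k : ℕ} {γ g : ℝ → ℂ} (hL : 0 < L)
    (hβ : 0 < β) (hβα : β ≤ α) (hα1 : α < 1) (hγ : RegularCurve L α γ)
    (hγk : HolderPer L α (k + 1) γ) (hg : HolderPer L β k g) : HolderPer L α k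
      fun t => deriv γ t * cauchyOp L γ (fun t => g t / deriv γ t) t - cauchyOp L γ g t := by
  have hα : 0 < α := hβ.trans_le hβα
  have h1 := holderPer_commutator hL hβ hβα hα1 hγ hγk
    (hγk.2.2.inv hL hα hα1.le hγ.regular) hg
  refine (hγk.2.2.mul hL hα hα1.le h1).congr fun t => ?_
  have := hγ.regular t
  simp only [div_eq_inv_mul]
  field_simp

/-! ### The circle: multipliers and regularity -/

/-- The standard parametrization of the unit circle with period `L`. -/
noncomputable def circleCurve (L t : ℝ) : ℂ := Complex.exp (2 * Real.pi * Complex.I / L * t)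

/-- The characters of period `L`. -/
noncomputable def circleChar (L : ℝ) (n : ℤ) (t : ℝ) : ℂ :=
  Complex.exp (n * (2 * Real.pi * Complex.I / L) * t)

theorem circleChar_one (L : ℝ) : circleChar L 1 = circleCurve L := by
  funext t; simp [circleChar, circleCurve]

theorem circleChar_add (L : ℝ) (n : ℤ) (s t : ℝ) :
    circleChar L n (s + t) = circleChar L n s * circleChar L n t := by
  rw [circleChar, circleChar, circleChar, ← Complex.exp_add]
  push_cast
  ring_nf

theorem circleChar_add_index (L : ℝ) (m n : ℤ) (t : ℝ) :
    circleChar L (m + n) t = circleChar L m t * circleChar L n t := by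
  rw [circleChar, circleChar, circleChar, ← Complex.exp_add]
  push_cast
  ring_nf

theorem circleChar_index_zero (L : ℝ) (t : ℝ) : circleChar L 0 t = 1 := by simp [circleChar]

theorem circleChar_zero (L : ℝ) (n : ℤ) : circleChar L n 0 = 1 := by simp [circleChar]

theorem norm_circleChar (L : ℝ) (n : ℤ) (t : ℝ) : ‖circleChar L n t‖ = 1 := by
  rw [circleChar, show (n : ℂ) * (2 * Real.pi * Complex.I / L) * t =
    ((n * (2 * Real.pi / L) * t : ℝ) : ℂ) * Complex.I by push_cast; ring]
  exact Complex.norm_exp_ofReal_mul_I _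

theorem circleChar_ne_zero (L : ℝ) (n : ℤ) (t : ℝ) : circleChar L n t ≠ 0 := Complex.exp_ne_zero _

theorem hasDerivAt_circleChar (L : ℝ) (n : ℤ) (t : ℝ) : HasDerivAt (circleChar L n)
    (n * (2 * Real.pi * Complex.I / L) * circleChar L n t) t := by
  have := ((Complex.ofRealCLM.hasDerivAt (x := t)).const_mul
    ((n : ℂ) * (2 * Real.pi * Complex.I / L))).cexp
  simp only [Complex.ofRealCLM_apply, Complex.ofReal_one, mul_one] at this
  rw [mul_comm]
  exact this

theorem deriv_circleChar (L : ℝ) (n : ℤ) : deriv (circleChar L n) =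
    fun t => n * (2 * Real.pi * Complex.I / L) * circleChar L n t :=
  funext fun t => (hasDerivAt_circleChar L n t).deriv

theorem circleChar_periodic {L : ℝ} (hL : 0 < L) (n : ℤ) :
    Function.Periodic (circleChar L n) L := by
  intro t
  have hL' : (L : ℂ) ≠ 0 := by exact_mod_cast hL.ne'
  rw [circleChar_add]
  have : circleChar L n L = 1 := by
    rw [circleChar, show (n : ℂ) * (2 * Real.pi * Complex.I / L) * L =
      n * (2 * Real.pi * Complex.I) by field_simp]
    exact Complex.exp_int_mul_two_pi_mul_I n
  rw [this, mul_one]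

theorem continuous_circleChar (L : ℝ) (n : ℤ) : Continuous (circleChar L n) := by
  unfold circleChar; fun_prop

theorem holderPer_circleChar {L α : ℝ} (hL : 0 < L) (hα : 0 < α) (hα1 : α ≤ 1) (n : ℤ) (k : ℕ) :
    HolderPer L α k (circleChar L n) := by
  have hd : Differentiable ℝ (circleChar L n) := fun t =>
    (hasDerivAt_circleChar L n t).differentiableAt
  induction k with
  | zero =>
    refine HolderPer.zero_of_deriv_continuous hL hα hα1 (circleChar_periodic hL n) hd ?_
    rw [deriv_circleChar]
    exact continuous_const.mul (continuous_circleChar L n)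
  | succ k ih =>
    refine ⟨circleChar_periodic hL n, hd, ?_⟩
    rw [deriv_circleChar]
    exact ih.const_mul hL hα hα1 _

theorem holderPer_circleCurve {L α : ℝ} (hL : 0 < L) (hα : 0 < α) (hα1 : α ≤ 1) (k : ℕ) :
    HolderPer L α k (circleCurve L) := by
  rw [← circleChar_one]
  exact holderPer_circleChar hL hα hα1 1 k

theorem deriv_circleCurve (L : ℝ) (t : ℝ) : deriv (circleCurve L) t =
    2 * Real.pi * Complex.I / L * circleCurve L t := by
  rw [← circleChar_one, deriv_circleChar]
  simp

theorem regularCurve_circleCurve {L α : ℝ} (hL : 0 < L) (hα : 0 < α) (hα1 : α ≤ 1) :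
    RegularCurve L α (circleCurve L) := by
  have hL' : (L : ℂ) ≠ 0 := by exact_mod_cast hL.ne'
  have hpi : (Real.pi : ℂ) ≠ 0 := by exact_mod_cast Real.pi_ne_zero
  refine ⟨holderPer_circleCurve hL hα hα1 1, ?_, fun t => ?_⟩
  · intro s hs t ht hst
    obtain ⟨n, hn⟩ := Complex.exp_eq_exp_iff_exists_int.1 hst
    have h1 : (s : ℂ) = t + n * L := by
      have hI := Complex.I_ne_zero
      field_simp at hn
      have h2 : (2 * Real.pi * Complex.I : ℂ) ≠ 0 := by simp [hpi]
      apply mul_left_cancel₀ h2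
      linear_combination hn * (2 * Real.pi * Complex.I : ℂ)
    have h3 : s = t + n * L := by exact_mod_cast h1
    have h4 : (n : ℝ) < 1 := by
      by_contra! h
      nlinarith [hs.2, ht.1]
    have h5 : (-1 : ℝ) < n := by
      by_contra! h
      nlinarith [hs.1, ht.2]
    have h6 : n = 0 := by
      have : n < 1 := by exact_mod_cast h4
      have : -1 < n := by exact_mod_cast h5
      omega
    rw [h3, h6]
    simp
  · rw [deriv_circleCurve]
    refine mul_ne_zero ?_ (Complex.exp_ne_zero _)
    simp [hL.ne', Real.pi_ne_zero]

/-- The kernel depends on `u = s - t` alone, so on the circle the operator is translation invariant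
and the characters are its eigenfunctions. -/
theorem circle_kernel (L t u : ℝ) :
    deriv (circleCurve L) (t + u) / (circleCurve L (t + u) - circleCurve L t) =
      2 * Real.pi * Complex.I / L * circleCurve L u / (circleCurve L u - 1) := by
  have h0 := circleChar_ne_zero L 1 t
  rw [deriv_circleCurve, ← circleChar_one, circleChar_add]
  rw [show circleChar L 1 t * circleChar L 1 u - circleChar L 1 t =
    circleChar L 1 t * (circleChar L 1 u - 1) by ring,
    show 2 * Real.pi * Complex.I / L * (circleChar L 1 t * circleChar L 1 u) =
    circleChar L 1 t * (2 * Real.pi * Complex.I / L * circleChar L 1 u) by ring]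
  exact mul_div_mul_left _ _ h0

theorem cauchyOp_circle (L : ℝ) (g : ℝ → ℂ) (t : ℝ) : cauchyOp L (circleCurve L) g t =
    ∫ u in -(L / 2)..L / 2, (g (t + u) * (2 * Real.pi * Complex.I / L * circleCurve L u /
      (circleCurve L u - 1)) - g t * (u : ℂ)⁻¹) := by
  simp only [cauchyOp, circle_kernel]

/-- The eigenvalue of the singular integral operator of the circle on a character. -/
noncomputable def circleMult (L : ℝ) (n : ℤ) : ℂ := cauchyOp L (circleCurve L) (circleChar L n) 0

theorem circleMult_eq (L : ℝ) (n : ℤ) : circleMult L n =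
    ∫ u in -(L / 2)..L / 2, (circleChar L n u * (2 * Real.pi * Complex.I / L * circleCurve L u /
      (circleCurve L u - 1)) - (u : ℂ)⁻¹) := by
  rw [circleMult, cauchyOp_circle]
  simp only [zero_add, circleChar_zero, one_mul]

theorem intervalIntegrable_circle {L : ℝ} (hL : 0 < L) (n : ℤ) : IntervalIntegrable
    (fun u : ℝ => circleChar L n u * (2 * Real.pi * Complex.I / L * circleCurve L u /
      (circleCurve L u - 1)) - (u : ℂ)⁻¹) volume (-(L / 2)) (L / 2) := by
  have hL2 : |L / 2| ≤ L / 2 := by rw [abs_of_pos (by positivity)]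
  have := intervalIntegrable_cauchyIntegrand hL one_pos (regularCurve_circleCurve hL one_pos le_rfl)
    (holderPer_circleChar hL one_pos le_rfl n 0) 0 (by rwa [abs_neg]) hL2
  simp only [circle_kernel, circleChar_zero, one_mul] at this
  simpa only [zero_add] using this

theorem circleCurve_sub_one_ne_zero {L u : ℝ} (hL : 0 < L) (hu : u ≠ 0)
    (huL : u ∈ Ioc (-(L / 2)) (L / 2)) : circleCurve L u - 1 ≠ 0 := by
  obtain ⟨A, B, c, h⟩ := (regularCurve_circleCurve hL one_pos le_rfl).exists_bounds hL one_pos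
  have := h.sub_ne_zero (s := u) (t := 0) (by simpa using hu) (by
    rw [sub_zero, abs_le]; exact ⟨by linarith [huL.1], by linarith [huL.2]⟩)
  rw [← circleChar_one, circleChar_zero] at this
  rwa [← circleChar_one]

theorem integral_circleChar {L : ℝ} (hL : 0 < L) (n : ℤ) (hn : n ≠ 0) (a : ℝ) :
    ∫ u in a..a + L, circleChar L n u = 0 := by
  have hL' : (L : ℂ) ≠ 0 := by exact_mod_cast hL.ne'
  have hpi : (Real.pi : ℂ) ≠ 0 := by exact_mod_cast Real.pi_ne_zero
  have h1 := intervalIntegral.integral_eq_sub_of_hasDerivAt (a := a) (b := a + L)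
    (fun t _ => hasDerivAt_circleChar L n t)
    ((continuous_const.mul (continuous_circleChar L n)).intervalIntegrable _ _)
  rw [circleChar_periodic hL n, sub_self, intervalIntegral.integral_const_mul] at h1
  refine (mul_eq_zero.1 h1).resolve_left ?_
  simp [hn, hL.ne', Real.pi_ne_zero]

/-- The factor `e(u) - 1`, with `e` the basic character, cancels the denominator, leaving the
integral of the character of index `n + 1`, nonzero only for `n = -1`. -/
theorem circleMult_succ {L : ℝ} (hL : 0 < L) (n : ℤ) :
    circleMult L (n + 1) - circleMult L n = if n + 1 = 0 then 2 * Real.pi * Complex.I else 0 := by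
  have hL' : (L : ℂ) ≠ 0 := by exact_mod_cast hL.ne'
  rw [circleMult_eq, circleMult_eq, ← intervalIntegral.integral_sub
    (intervalIntegrable_circle hL _) (intervalIntegrable_circle hL _)]
  have h1 : ∫ u in -(L / 2)..L / 2, (circleChar L (n + 1) u * (2 * Real.pi * Complex.I / L *
      circleCurve L u / (circleCurve L u - 1)) - (u : ℂ)⁻¹ - (circleChar L n u *
      (2 * Real.pi * Complex.I / L * circleCurve L u / (circleCurve L u - 1)) - (u : ℂ)⁻¹)) =
      ∫ u in -(L / 2)..-(L / 2) + L, 2 * Real.pi * Complex.I / L * circleChar L (n + 1) u := by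
    rw [show -(L / 2) + L = L / 2 by ring]
    refine intervalIntegral.integral_congr_ae ?_
    filter_upwards [ae_ne_zero] with u hu0 hu
    rw [uIoc_of_le (by linarith)] at hu
    have h2 := circleCurve_sub_one_ne_zero hL hu0 hu
    rw [circleChar_add_index, circleChar_one]
    field_simp
    ring
  rw [h1, intervalIntegral.integral_const_mul]
  split_ifs with h
  · simp only [h, circleChar_index_zero]
    simp
    field_simp
  · rw [integral_circleChar hL _ h, mul_zero]

/-- Averaging over `u ↦ -u` removes `1 / u`, and `e / (e - 1) + e⁻¹ / (e⁻¹ - 1) = 1`. -/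
theorem circleMult_zero {L : ℝ} (hL : 0 < L) : circleMult L 0 = Real.pi * Complex.I := by
  have hL' : (L : ℂ) ≠ 0 := by exact_mod_cast hL.ne'
  have i0 := intervalIntegrable_circle hL 0
  have h1 : circleMult L 0 + circleMult L 0 = 2 * Real.pi * Complex.I := by
    have h2 : circleMult L 0 = ∫ u in -(L / 2)..L / 2, (circleChar L 0 (-u) *
        (2 * Real.pi * Complex.I / L * circleCurve L (-u) / (circleCurve L (-u) - 1)) -
        ((-u : ℝ) : ℂ)⁻¹) := by
      rw [circleMult_eq]
      have := intervalIntegral.integral_comp_neg (a := -(L / 2)) (b := L / 2)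
        (fun u : ℝ => circleChar L 0 u * (2 * Real.pi * Complex.I / L * circleCurve L u /
          (circleCurve L u - 1)) - (u : ℂ)⁻¹)
      rw [this, neg_neg]
    have i1 : IntervalIntegrable (fun u : ℝ => circleChar L 0 (-u) *
        (2 * Real.pi * Complex.I / L * circleCurve L (-u) / (circleCurve L (-u) - 1)) -
        ((-u : ℝ) : ℂ)⁻¹) volume (-(L / 2)) (L / 2) := by
      have := i0.comp_mul_left (c := -1)
      have := this.symm
      simpa [div_neg] using this
    nth_rewrite 1 [circleMult_eq]
    rw [h2, ← intervalIntegral.integral_add i0 i1]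
    rw [intervalIntegral.integral_congr_ae (g := fun _ => 2 * Real.pi * Complex.I / L)]
    · simp
      field_simp
    · filter_upwards [ae_ne_zero] with u hu0 hu
      rw [uIoc_of_le (by linarith)] at hu
      have h3 := circleCurve_sub_one_ne_zero hL hu0 hu
      have h4 : circleCurve L (-u) = (circleCurve L u)⁻¹ := by
        rw [circleCurve, circleCurve, ← Complex.exp_neg]
        push_cast
        ring_nf
      have h5 : circleCurve L u ≠ 0 := Complex.exp_ne_zero _
      have h6 : (circleCurve L u)⁻¹ - 1 ≠ 0 := by
        intro h
        apply h3
        field_simp at h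
        rw [← neg_eq_zero, neg_sub, h, mul_zero]
      have h7 : 1 - circleCurve L u ≠ 0 := by
        rw [← neg_sub]; exact neg_ne_zero.2 h3
      rw [h4, circleChar_index_zero, circleChar_index_zero]
      push_cast
      have e1 : 2 * Real.pi * Complex.I / L * (circleCurve L u)⁻¹ / ((circleCurve L u)⁻¹ - 1) =
          -(2 * Real.pi * Complex.I / L / (circleCurve L u - 1)) := by
        rw [show (circleCurve L u)⁻¹ - 1 = -((circleCurve L u)⁻¹ * (circleCurve L u - 1)) by
          rw [mul_sub, inv_mul_cancel₀ h5]; ring, div_neg, mul_comm, mul_div_mul_left _ _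
            (inv_ne_zero h5)]
      rw [e1, inv_neg]
      field_simp
      ring
  have h2 : (2 : ℂ) * circleMult L 0 = 2 * (Real.pi * Complex.I) := by
    rw [two_mul, h1]; ring
  exact mul_left_cancel₀ two_ne_zero h2

/-- The multiplier is `π i` for `n ≥ 0` and `-π i` for `n < 0`, by induction from zero in both
directions. -/
theorem circleMult_sq {L : ℝ} (hL : 0 < L) (n : ℤ) : circleMult L n ^ 2 = -(Real.pi : ℂ) ^ 2 := by
  have h1 : ∀ k : ℕ, circleMult L k = Real.pi * Complex.I := by
    intro k
    induction k with
    | zero => exact circleMult_zero hL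
    | succ k ih =>
      have := circleMult_succ hL k
      rw [if_neg (by omega), ih, sub_eq_zero] at this
      exact_mod_cast this
  have h2 : ∀ k : ℕ, circleMult L (-(k + 1 : ℕ)) = -(Real.pi * Complex.I) := by
    intro k
    induction k with
    | zero =>
      have := circleMult_succ hL (-1)
      rw [if_pos (by omega), show (-1 : ℤ) + 1 = 0 by ring, circleMult_zero hL] at this
      simp only [zero_add, Nat.cast_one]
      linear_combination -this
    | succ k ih =>
      have := circleMult_succ hL (-(k + 1 + 1 : ℕ))
      rw [if_neg (by omega), show -((k + 1 + 1 : ℕ) : ℤ) + 1 = -(k + 1 : ℕ) by push_cast; ring,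
        ih] at this
      linear_combination -this
  obtain ⟨k, rfl | rfl⟩ := n.eq_nat_or_neg
  · rw [h1, mul_pow, Complex.I_sq]; ring
  · rcases k with _ | k
    · have := h1 0
      simp only [Nat.cast_zero, neg_zero] at this ⊢
      rw [this, mul_pow, Complex.I_sq]; ring
    · rw [h2, neg_sq, mul_pow, Complex.I_sq]; ring

theorem cauchyOp_circle_one (L t : ℝ) :
    cauchyOp L (circleCurve L) (fun _ => 1) t = circleMult L 0 := by
  rw [circleMult_eq, cauchyOp_circle]
  simp only [circleChar_index_zero, one_mul]

/-- At order zero, `H g = [H, g] 1 + g · H 1` and `H 1` is constant, so boundedness on Hölder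
functions is a case of the commutator estimate. At higher order the derivative is `H g'` up to a
commutator term. -/
theorem holderPer_cauchyOp_circle {L β : ℝ} {k : ℕ} {g : ℝ → ℂ} (hL : 0 < L) (hβ : 0 < β)
    (hβ1 : β < 1) (hg : HolderPer L β k g) : HolderPer L β k (cauchyOp L (circleCurve L) g) := by
  have he := regularCurve_circleCurve hL hβ hβ1.le
  induction k generalizing g with
  | zero =>
    have h1 := holderPer_commutator_zero hL hβ le_rfl hβ1 he hg (HolderPer.const 1)
    refine (h1.add (hg.mul hL hβ hβ1.le (HolderPer.const (circleMult L 0)))).congr fun t => ?_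
    simp [cauchyOp_circle_one]
  | succ k ih =>
    have hd := hasDerivAt_cauchyOp hL hβ hβ1.le he (holderPer_circleCurve hL hβ hβ1.le 2)
      (hg.of_le hL hβ hβ1.le (by omega))
    refine ⟨cauchyOp_periodic he.holder.periodic hg.periodic, fun t => (hd t).differentiableAt, ?_⟩
    refine ((holderPer_mul_cauchyOp_div_sub hL hβ le_rfl hβ1 he
      (holderPer_circleCurve hL hβ hβ1.le _) hg.2.2).add (ih hg.2.2)).congr fun t => ?_
    rw [(hd t).deriv]
    ring

/-- Differentiating replaces `g` by `g'`, up to the errors of `holderPer_mul_cauchyOp_div_sub` for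
the curve and for the circle. The induction thus descends to the cancellation of kernels at order
zero. -/
theorem holderPer_cauchyOp_sub_circle {L α β : ℝ} {k : ℕ} {γ g : ℝ → ℂ} (hL : 0 < L) (hβ : 0 < β)
    (hβα : β ≤ α) (hα1 : α < 1) (hγ : RegularCurve L α γ) (hγk : HolderPer L α (k + 1) γ)
    (hg : HolderPer L β k g) : HolderPer L α k
      fun t => cauchyOp L γ g t - cauchyOp L (circleCurve L) g t := by
  have hα : 0 < α := hβ.trans_le hβα
  have hβ1 : β < 1 := hβα.trans_lt hα1
  have he := regularCurve_circleCurve hL hα hα1.le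
  induction k generalizing g with
  | zero => exact holderPer_cauchyOp_sub_zero hL hβ hβα hα1 hγ he hg
  | succ k ih =>
    have hd := fun t => (hasDerivAt_cauchyOp hL hβ hβ1.le (hγ.mono hL hβ hβα)
      ((hγk.of_le hL hα hα1.le (by omega)).mono_exponent hL hβ hβα)
      (hg.of_le hL hβ hβ1.le (by omega)) t).fun_sub
      (hasDerivAt_cauchyOp hL hβ hβ1.le (he.mono hL hβ hβα)
        (holderPer_circleCurve hL hβ hβ1.le 2) (hg.of_le hL hβ hβ1.le (by omega)) t)
    have hγk' := hγk.of_succ hL hα hα1.le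
    have h1 := holderPer_mul_cauchyOp_div_sub hL hβ hβα hα1 hγ hγk' hg.2.2
    have h2 := holderPer_mul_cauchyOp_div_sub hL hβ hβα hα1 he
      (holderPer_circleCurve hL hα hα1.le _) hg.2.2
    refine ⟨(cauchyOp_periodic hγ.holder.periodic hg.periodic).sub
      (cauchyOp_periodic he.holder.periodic hg.periodic), fun t => (hd t).differentiableAt, ?_⟩
    refine ((h1.sub hL hα hα1.le h2).add (ih hγk' hg.2.2)).congr fun t => ?_
    rw [(hd t).deriv]
    ring

/-! ### Inversion and conjugation on the circle -/

theorem eq_zero_of_fourier_eq_zero {L : ℝ} (hL : 0 < L) {G : ℝ → ℂ} (hG : Continuous G)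
    (hp : Function.Periodic G L)
    (h : ∀ n : ℤ, ∫ t in (0 : ℝ)..L, circleChar L (-n) t * G t = 0) (t : ℝ) : G t = 0 := by
  have : Fact (0 < L) := ⟨hL⟩
  let f : C(AddCircle L, ℂ) := ⟨hp.lift, continuous_coinduced_dom.2 hG⟩
  have hf : ∀ t : ℝ, f (t : AddCircle L) = G t := fun t => rfl
  have hc : fourierCoeff f = 0 := by
    funext n
    rw [fourierCoeff_eq_intervalIntegral f n 0, zero_add]
    have : ∫ x in (0 : ℝ)..L, fourier (-n) (x : AddCircle L) • f (x : AddCircle L) =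
        ∫ t in (0 : ℝ)..L, circleChar L (-n) t * G t := by
      congr 1
      funext x
      rw [fourier_coe_apply, hf, smul_eq_mul, circleChar]
      congr 2
      push_cast
      ring
    rw [this, h, smul_zero]
    rfl
  have h1 := has_pointwise_sum_fourier_series_of_summable (f := f)
    (by rw [hc]; exact summable_zero) (t : AddCircle L)
  rw [hc] at h1
  simp only [Pi.zero_apply, zero_smul] at h1
  rw [← hf]
  exact h1.unique hasSum_zero

/-- Fubini and translation invariance. The term `g(t) / u` must stay inside the double integral,
since it provides the integrable majorant `|u|^{β-1}`. -/
theorem fourier_cauchyOp_circle {L β : ℝ} {g : ℝ → ℂ} (hL : 0 < L) (hβ : 0 < β) (hβ1 : β ≤ 1)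
    (hg : HolderPer L β 0 g) (n : ℤ) :
    ∫ t in (0 : ℝ)..L, circleChar L (-n) t * cauchyOp L (circleCurve L) g t =
      circleMult L n * ∫ t in (0 : ℝ)..L, circleChar L (-n) t * g t := by
  obtain ⟨A, B, c, h⟩ := (regularCurve_circleCurve hL hβ hβ1).exists_bounds hL hβ
  obtain ⟨G, hG⟩ := hg.2
  obtain ⟨M, -, hM⟩ := hg.exists_norm_le hL hβ
  have hgc := hg.continuous hβ
  let κ : ℝ → ℂ := fun u => 2 * Real.pi * Complex.I / L * circleCurve L u / (circleCurve L u - 1)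
  have hec : Continuous (circleCurve L) := by rw [← circleChar_one]; exact continuous_circleChar L 1
  have hκ : Measurable κ := (hec.measurable.const_mul _).div (hec.measurable.sub_const 1)
  let F : ℝ → ℝ → ℂ := fun t u => circleChar L (-n) t * (g (t + u) * κ u - g t * (u : ℂ)⁻¹)
  have hFm : Measurable F.uncurry := by
    have m1 : Measurable fun p : ℝ × ℝ => circleChar L (-n) p.1 :=
      ((continuous_circleChar L (-n)).comp continuous_fst).measurable
    have m2 : Measurable fun p : ℝ × ℝ => g (p.1 + p.2) :=
      (hgc.comp (by fun_prop)).measurable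
    have m3 : Measurable fun p : ℝ × ℝ => g p.1 := (hgc.comp continuous_fst).measurable
    have m4 : Measurable fun p : ℝ × ℝ => ((p.2 : ℂ))⁻¹ :=
      (Complex.measurable_ofReal.comp measurable_snd).inv
    exact m1.mul ((m2.mul (hκ.comp measurable_snd)).sub (m3.mul m4))
  have hFi : IntegrableOn F.uncurry (uIoc 0 L ×ˢ uIoc (-(L / 2)) (L / 2)) := by
    rw [IntegrableOn, Measure.volume_eq_prod, ← Measure.prod_restrict]
    have b1 : Integrable (fun _ : ℝ => (1 : ℝ)) (volume.restrict (uIoc 0 L)) := by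
      rw [uIoc_of_le hL.le]
      exact integrable_const _
    have b2 : Integrable (fun u : ℝ => (G * (B / c) + M * (A / c)) * |u| ^ (β - 1))
        (volume.restrict (uIoc (-(L / 2)) (L / 2))) :=
      intervalIntegrable_iff.1 ((intervalIntegrable_abs_rpow (by linarith) _ _).const_mul _)
    refine (b1.mul_prod b2).mono' hFm.aestronglyMeasurable ?_
    have hae : ∀ᵐ u ∂(volume.restrict (uIoc (-(L / 2)) (L / 2))), u ≠ 0 ∧ |u| ≤ L / 2 := by
      rw [ae_restrict_iff' measurableSet_uIoc]
      filter_upwards [ae_ne_zero] with u hu0 hu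
      rw [uIoc_of_le (by linarith)] at hu
      exact ⟨hu0, abs_le.2 ⟨hu.1.le, hu.2⟩⟩
    have hae2 := (Measure.quasiMeasurePreserving_snd
      (μ := volume.restrict (uIoc 0 L))
      (ν := volume.restrict (uIoc (-(L / 2)) (L / 2)))).ae hae
    filter_upwards [hae2] with p hp
    have h1 := norm_cauchyIntegrand_le h hG hM p.1 p.2 hp.1 hp.2
    rw [circle_kernel] at h1
    show ‖circleChar L (-n) p.1 * (g (p.1 + p.2) * κ p.2 - g p.1 * (p.2 : ℂ)⁻¹)‖ ≤ _
    rw [norm_mul, norm_circleChar]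
    gcongr
  have e1 : ∀ t, circleChar L (-n) t * cauchyOp L (circleCurve L) g t =
      ∫ u in -(L / 2)..L / 2, F t u := by
    intro t
    rw [cauchyOp_circle, ← intervalIntegral.integral_const_mul]
  simp only [e1]
  rw [intervalIntegral_intervalIntegral_swap hFi, circleMult_eq,
    ← intervalIntegral.integral_mul_const]
  congr 1
  funext u
  have c1 : Continuous fun t => circleChar L (-n) t * g t := (continuous_circleChar L _).mul hgc
  have c2 : Continuous fun t => circleChar L (-n) t * g (t + u) :=
    (continuous_circleChar L _).mul (hgc.comp (by fun_prop))
  have e2 : ∫ t in (0 : ℝ)..L, circleChar L (-n) t * g (t + u) =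
      circleChar L n u * ∫ t in (0 : ℝ)..L, circleChar L (-n) t * g t := by
    have hper : Function.Periodic (fun t => circleChar L (-n) t * g t) L :=
      (circleChar_periodic hL _).mul hg.1
    have h1 := hper.intervalIntegral_add_eq u 0
    rw [zero_add] at h1
    have h2 := intervalIntegral.integral_comp_add_right (a := 0) (b := L)
      (fun t => circleChar L (-n) t * g t) u
    rw [zero_add, add_comm L u] at h2
    rw [← h1, ← h2, ← intervalIntegral.integral_const_mul]
    congr 1
    funext t
    have h3 : circleChar L n u * circleChar L (-n) u = 1 := by
      rw [← circleChar_add_index, add_neg_cancel, circleChar_index_zero]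
    rw [circleChar_add]
    linear_combination (-circleChar L (-n) t * g (t + u)) * h3
  have e3 : ∀ t, F t u = κ u * (circleChar L (-n) t * g (t + u)) -
      (u : ℂ)⁻¹ * (circleChar L (-n) t * g t) := fun t => by simp only [F]; ring
  simp only [e3]
  rw [intervalIntegral.integral_sub ((c2.intervalIntegrable _ _).const_mul _)
    ((c1.intervalIntegrable _ _).const_mul _), intervalIntegral.integral_const_mul,
    intervalIntegral.integral_const_mul, e2]
  simp only [κ]
  ring

/-- The singular integral operator of the circle is invertible. -/
theorem cauchyOp_circle_cauchyOp_circle {L β : ℝ} {g : ℝ → ℂ} (hL : 0 < L) (hβ : 0 < β)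
    (hβ1 : β < 1) (hg : HolderPer L β 0 g) (t : ℝ) :
    cauchyOp L (circleCurve L) (cauchyOp L (circleCurve L) g) t = -(Real.pi : ℂ) ^ 2 * g t := by
  have h1 := holderPer_cauchyOp_circle hL hβ hβ1 hg
  have h2 := holderPer_cauchyOp_circle hL hβ hβ1 h1
  have hG := h2.add (hg.const_mul hL hβ hβ1.le ((Real.pi : ℂ) ^ 2))
  have := eq_zero_of_fourier_eq_zero hL (hG.continuous hβ) hG.periodic (fun n => by
    have c1 : Continuous fun t => circleChar L (-n) t * cauchyOp L (circleCurve L)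
        (cauchyOp L (circleCurve L) g) t :=
      (continuous_circleChar L (-n)).mul (h2.continuous hβ)
    have c2 : Continuous fun t => circleChar L (-n) t * g t :=
      (continuous_circleChar L (-n)).mul (hg.continuous hβ)
    have e : ∀ t, circleChar L (-n) t * (cauchyOp L (circleCurve L)
        (cauchyOp L (circleCurve L) g) t + (Real.pi : ℂ) ^ 2 * g t) =
        circleChar L (-n) t * cauchyOp L (circleCurve L) (cauchyOp L (circleCurve L) g) t +
        (Real.pi : ℂ) ^ 2 * (circleChar L (-n) t * g t) := fun t => by ring
    simp only [e]
    rw [intervalIntegral.integral_add (c1.intervalIntegrable _ _)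
      ((c2.intervalIntegrable _ _).const_mul _), intervalIntegral.integral_const_mul,
      fourier_cauchyOp_circle hL hβ hβ1.le h1, fourier_cauchyOp_circle hL hβ hβ1.le hg,
      ← mul_assoc, ← add_mul, ← pow_two, circleMult_sq hL]
    ring) t
  linear_combination this

/-- Since `g = -π⁻² H (H g)` and `H` preserves `C^{k+α}`, regularity of `H g` returns to `g`. This
is the source of the negative half of the theorem. -/
theorem HolderPer.of_cauchyOp_circle {L α β : ℝ} {k : ℕ} {g : ℝ → ℂ} (hL : 0 < L) (hβ : 0 < β)
    (hβα : β ≤ α) (hα1 : α < 1) (hg : HolderPer L β k g)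
    (h : HolderPer L α k (cauchyOp L (circleCurve L) g)) : HolderPer L α k g := by
  have hα : 0 < α := hβ.trans_le hβα
  have hβ1 : β < 1 := hβα.trans_lt hα1
  refine ((holderPer_cauchyOp_circle hL hα hα1 h).const_mul hL hα hα1.le
    (-(Real.pi : ℂ) ^ 2)⁻¹).congr fun t => ?_
  rw [cauchyOp_circle_cauchyOp_circle hL hβ hβ1 (hg.of_le hL hβ hβ1.le (Nat.zero_le _)),
    inv_mul_cancel_left₀]
  simp [Real.pi_ne_zero]

/-- The conjugate of the circle kernel is the kernel minus the constant `2 π i / L`. -/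
theorem cauchyOp_circle_conj {L β : ℝ} {g : ℝ → ℂ} (hL : 0 < L) (hβ : 0 < β) (hβ1 : β ≤ 1)
    (hg : HolderPer L β 0 g) (t : ℝ) :
    (starRingEnd ℂ) (cauchyOp L (circleCurve L) (fun t => (starRingEnd ℂ) (g t)) t) =
      cauchyOp L (circleCurve L) g t -
        2 * Real.pi * Complex.I / L * ∫ t in -(L / 2)..L / 2, g t := by
  have hL2 : |L / 2| ≤ L / 2 := by rw [abs_of_pos (by positivity)]
  have hL' : (L : ℂ) ≠ 0 := by exact_mod_cast hL.ne'
  have hgc := hg.continuous hβ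
  have i1 := intervalIntegrable_cauchyIntegrand hL hβ (regularCurve_circleCurve hL hβ hβ1) hg t
    (by rwa [abs_neg]) hL2
  simp only [circle_kernel] at i1
  have e1 : ∫ u in -(L / 2)..L / 2, g u = ∫ u in -(L / 2)..L / 2, g (t + u) := by
    have h1 := intervalIntegral.integral_comp_add_left (a := -(L / 2)) (b := L / 2) g t
    have h2 := hg.1.intervalIntegral_add_eq (t + -(L / 2)) (-(L / 2))
    rw [show t + -(L / 2) + L = t + L / 2 by ring, show -(L / 2) + L = L / 2 by ring] at h2
    rw [h1, h2]
  have c2 : Continuous fun u => 2 * Real.pi * Complex.I / L * g (t + u) :=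
    continuous_const.mul (hgc.comp (by fun_prop))
  rw [e1, cauchyOp_circle, cauchyOp_circle, ← intervalIntegral.integral_const_mul,
    ← intervalIntegral.integral_sub i1 (c2.intervalIntegrable _ _),
    intervalIntegral.intervalIntegral_eq_integral_uIoc,
    intervalIntegral.intervalIntegral_eq_integral_uIoc]
  simp only [if_pos (show -(L / 2) ≤ L / 2 by linarith), one_smul]
  rw [← integral_conj]
  refine setIntegral_congr_ae measurableSet_uIoc ?_
  filter_upwards [ae_ne_zero] with u hu0 hu
  rw [uIoc_of_le (by linarith)] at hu
  have h3 := circleCurve_sub_one_ne_zero hL hu0 hu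
  have h5 : circleCurve L u ≠ 0 := Complex.exp_ne_zero _
  have h4 : (starRingEnd ℂ) (circleCurve L u) = (circleCurve L u)⁻¹ := by
    rw [circleCurve, ← Complex.exp_conj, ← Complex.exp_neg]
    simp only [map_mul, map_div₀, Complex.conj_ofReal, Complex.conj_I, map_ofNat]
    ring_nf
  have e2 : (circleCurve L u)⁻¹ / ((circleCurve L u)⁻¹ - 1) = -(1 / (circleCurve L u - 1)) := by
    rw [show (circleCurve L u)⁻¹ - 1 = (circleCurve L u)⁻¹ * -(circleCurve L u - 1) by
      rw [mul_neg, mul_sub, inv_mul_cancel₀ h5]; ring]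
    rw [div_mul_eq_div_div, div_self (inv_ne_zero h5), div_neg]
  simp only [map_sub, map_mul, map_div₀, map_one, map_inv₀, Complex.conj_conj, h4,
    Complex.conj_ofReal, Complex.conj_I, map_ofNat]
  rw [mul_div_assoc (2 * Real.pi * -Complex.I / L : ℂ), e2]
  field_simp
  ring

/-! ### The logarithmic potential along the curve -/

theorem Function.Periodic.integral_eq_integral_shift {E : Type*} [NormedAddCommGroup E]
    [NormedSpace ℝ E] {F : ℝ → E} {L : ℝ} (hF : Function.Periodic F L) (t : ℝ) :
    ∫ s in (0 : ℝ)..L, F s = ∫ u in -(L / 2)..L / 2, F (t + u) := by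
  have h1 := intervalIntegral.integral_comp_add_left (a := -(L / 2)) (b := L / 2) F t
  have h2 := hF.intervalIntegral_add_eq (t + -(L / 2)) 0
  rw [show t + -(L / 2) + L = t + L / 2 by ring, zero_add] at h2
  rw [h1, h2]

/-- The power `1/4` is chosen so that inserting a square, as in the regularized logarithm, still
gives an integrable `|u|^{-1/2}`. -/
theorem abs_log_le {y : ℝ} (hy : 0 < y) : |Real.log y| ≤ y + 4 * y ^ (-(1 / 4) : ℝ) := by
  have h1 : Real.log y ≤ y := (Real.log_le_sub_one_of_pos hy).trans (by linarith)
  have h2 : 0 < y ^ (-(1 / 4) : ℝ) := Real.rpow_pos_of_pos hy _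
  have h3 := Real.log_le_sub_one_of_pos h2
  rw [Real.log_rpow hy] at h3
  rw [abs_le]
  constructor <;> linarith

/-- The logarithmic potential of a density with respect to the parameter, along the curve. -/
noncomputable def logPot (L : ℝ) (γ g : ℝ → ℂ) (t : ℝ) : ℂ :=
  ∫ s in (0 : ℝ)..L, g s * ((Real.log ‖γ t - γ s‖ : ℝ) : ℂ)

/-- Regularization of `logPot`. -/
noncomputable def logPotReg (L : ℝ) (γ g : ℝ → ℂ) (ε t : ℝ) : ℂ :=
  ∫ s in (0 : ℝ)..L, g s * ((1 / 2 * Real.log (‖γ t - γ s‖ ^ 2 + ε ^ 2) : ℝ) : ℂ)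

/-- The derivative of `logPotReg`. -/
noncomputable def logPotRegDeriv (L : ℝ) (γ g : ℝ → ℂ) (ε t : ℝ) : ℂ :=
  ∫ s in (0 : ℝ)..L,
    g s * ((inner ℝ (γ t - γ s) (deriv γ t) / (‖γ t - γ s‖ ^ 2 + ε ^ 2) : ℝ) : ℂ)

/-- The derivative of `logPot`. -/
noncomputable def logPotDeriv (L : ℝ) (γ g : ℝ → ℂ) (t : ℝ) : ℂ :=
  -∫ u in -(L / 2)..L / 2,
    (g (t + u) * (((deriv γ t / (γ (t + u) - γ t)).re : ℝ) : ℂ) - g t * (u : ℂ)⁻¹)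

theorem hasDerivAt_logPotReg {L A B c β : ℝ} {γ g : ℝ → ℂ} (h : CurveBounds L β A B c γ)
    (hγ : Function.Periodic γ L) (hg : Continuous g) (hgp : Function.Periodic g L) {ε : ℝ}
    (hε : 0 < ε) (t : ℝ) :
    HasDerivAt (logPotReg L γ g ε) (logPotRegDeriv L γ g ε t) t := by
  have hγc := h.continuous
  obtain ⟨R, hR0, hR⟩ := hγ.exists_norm_le h.L_pos hγc
  obtain ⟨M, hM0, hM⟩ := hgp.exists_norm_le h.L_pos hg
  have hB := h.B_pos
  have hpos : ∀ x s, 0 < ‖γ x - γ s‖ ^ 2 + ε ^ 2 := fun x s => by positivity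
  have cont : Continuous fun s => g s * ((1 / 2 * Real.log (‖γ t - γ s‖ ^ 2 + ε ^ 2) : ℝ) : ℂ) := by
    refine hg.mul (Complex.continuous_ofReal.comp (continuous_const.mul (Continuous.log ?_ ?_)))
    · fun_prop
    · exact fun s => (hpos t s).ne'
  have cont' : Continuous fun s =>
      g s * ((inner ℝ (γ t - γ s) (deriv γ t) / (‖γ t - γ s‖ ^ 2 + ε ^ 2) : ℝ) : ℂ) := by
    refine hg.mul (Complex.continuous_ofReal.comp (Continuous.div ?_ ?_ ?_))
    · fun_prop
    · fun_prop
    · exact fun s => (hpos t s).ne'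
  refine (intervalIntegral.hasDerivAt_integral_of_dominated_loc_of_deriv_le (μ := volume)
    (s := univ)
    (F := fun t s => g s * ((1 / 2 * Real.log (‖γ t - γ s‖ ^ 2 + ε ^ 2) : ℝ) : ℂ))
    (F' := fun t s => g s * ((inner ℝ (γ t - γ s) (deriv γ t) /
      (‖γ t - γ s‖ ^ 2 + ε ^ 2) : ℝ) : ℂ))
    (bound := fun _ => M * (2 * R * B / ε ^ 2)) univ_mem ?_ (cont.intervalIntegrable _ _)
    cont'.aestronglyMeasurable ?_ intervalIntegrable_const ?_).2
  · refine Eventually.of_forall fun x => Continuous.aestronglyMeasurable ?_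
    refine hg.mul (Complex.continuous_ofReal.comp (continuous_const.mul (Continuous.log ?_ ?_)))
    · fun_prop
    · exact fun s => (hpos x s).ne'
  · refine Eventually.of_forall fun s _ x _ => ?_
    rw [norm_mul, Complex.norm_real, norm_div, Real.norm_of_nonneg (hpos x s).le]
    have h1 := norm_inner_le_norm (𝕜 := ℝ) (γ x - γ s) (deriv γ x)
    have h2 : ‖γ x - γ s‖ ≤ 2 * R := (norm_sub_le _ _).trans (by linarith [hR x, hR s])
    gcongr
    · exact hM s
    · exact h1.trans (by gcongr; exact h.bound x)
    · nlinarith [norm_nonneg (γ x - γ s)]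
  · refine Eventually.of_forall fun s _ x _ => ?_
    have d1 := (((h.differentiable x).hasDerivAt.sub_const (γ s)).norm_sq).add_const (ε ^ 2)
    have d2 := ((d1.log (hpos x s).ne').const_mul (1 / 2)).ofReal_comp.const_mul (g s)
    convert d2 using 1
    congr 2
    ring_nf

theorem continuous_logPotRegDeriv {L A B c β : ℝ} {γ g : ℝ → ℂ} (h : CurveBounds L β A B c γ)
    (hg : Continuous g) {ε : ℝ} (hε : 0 < ε) : Continuous (logPotRegDeriv L γ g ε) := by
  have hγc := h.continuous
  have hγ'c := h.continuous_deriv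
  refine intervalIntegral.continuous_parametric_intervalIntegral_of_continuous' ?_ _ _
  refine (hg.comp continuous_snd).mul (Complex.continuous_ofReal.comp (Continuous.div ?_ ?_ ?_))
  · fun_prop
  · fun_prop
  · exact fun p => by positivity

/-- The subtracted term is the regularized kernel with the chord replaced by its tangent `u γ'(t)`.
The bound is independent of `ε`, as the dominated convergence below requires. -/
theorem CurveBounds.norm_reg_sub_le {L A B c β G M : ℝ} {γ g : ℝ → ℂ}
    (h : CurveBounds L β A B c γ) (hreg : ∀ t, deriv γ t ≠ 0)
    (hG : ∀ s t, ‖g s - g t‖ ≤ G * |s - t| ^ β)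
    (hM : ∀ t, ‖g t‖ ≤ M) {ε : ℝ} (t u : ℝ) (hu : u ≠ 0) (huL : |u| ≤ L / 2) :
    ‖g (t + u) * ((inner ℝ (γ (t + u) - γ t) (deriv γ t) /
      (‖γ (t + u) - γ t‖ ^ 2 + ε ^ 2) : ℝ) : ℂ) -
      g t * ((‖deriv γ t‖ ^ 2 * u / (‖deriv γ t‖ ^ 2 * u ^ 2 + ε ^ 2) : ℝ) : ℂ)‖ ≤
    (G * (B / c) + M * (3 * A * B / c ^ 2)) * |u| ^ (β - 1) := by
  have hL := h.L_pos
  have hA := h.A_pos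
  have hB := h.B_pos
  have hc := h.c_pos
  have hp := abs_pos.2 hu
  set Δ := γ (t + u) - γ t with hΔ
  set p := deriv γ t with hp'
  have hp0 : 0 < ‖p‖ := norm_pos_iff.2 (hreg t)
  have k1 : ‖Δ - (u : ℂ) * p‖ ≤ A * |u| ^ β * |u| := by
    have := h.taylor (s := t + u) (t := t) (r := t) (ρ := |u|) (by simp) (by simp)
    rwa [add_sub_cancel_left] at this
  have k2 : c * |u| ≤ ‖Δ‖ := h.chord t u (by linarith)
  have k3 : ‖Δ‖ ≤ B * |u| := by
    have := h.lipschitz (t + u) t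
    rwa [add_sub_cancel_left] at this
  have k4 : ‖p‖ ≤ B := h.bound t
  have hΔ0 : 0 < ‖Δ‖ := lt_of_lt_of_le (by positivity) k2
  have hu2 : 0 < u ^ 2 := by positivity
  have hd : 0 < ‖Δ‖ ^ 2 + ε ^ 2 := by positivity
  have hd' : 0 < ‖p‖ ^ 2 * u ^ 2 + ε ^ 2 := by positivity
  have bX : |inner ℝ Δ p / (‖Δ‖ ^ 2 + ε ^ 2)| ≤ B / c * |u|⁻¹ := by
    rw [abs_div, abs_of_pos hd]
    calc _ ≤ ‖Δ‖ * B / (‖Δ‖ ^ 2) := by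
          gcongr
          · exact (abs_real_inner_le_norm _ _).trans (by gcongr)
          · nlinarith [sq_nonneg ε]
      _ = B / ‖Δ‖ := by field_simp
      _ ≤ B / (c * |u|) := by gcongr
      _ = _ := by field_simp
  have hI : |inner ℝ Δ p - u * ‖p‖ ^ 2| ≤ A * |u| ^ β * |u| * B := by
    have e : inner ℝ Δ p - u * ‖p‖ ^ 2 = inner ℝ (Δ - (u : ℂ) * p) p := by
      rw [← Complex.real_smul, inner_sub_left Δ, real_inner_smul_left, real_inner_self_eq_norm_sq]
    rw [e]
    exact (abs_real_inner_le_norm _ _).trans (by gcongr)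
  have hD : |‖p‖ ^ 2 * u ^ 2 - ‖Δ‖ ^ 2| ≤ A * |u| ^ β * |u| * (2 * B * |u|) := by
    have e : ‖p‖ ^ 2 * u ^ 2 - ‖Δ‖ ^ 2 = (‖(u : ℂ) * p‖ - ‖Δ‖) * (‖(u : ℂ) * p‖ + ‖Δ‖) := by
      rw [norm_mul, Complex.norm_real, Real.norm_eq_abs]
      rw [← sq_abs u]
      ring
    have e2 : ‖(u : ℂ) * p‖ ≤ B * |u| := by
      rw [norm_mul, Complex.norm_real, Real.norm_eq_abs, mul_comm]
      gcongr
    have e3 : |‖(u : ℂ) * p‖ - ‖Δ‖| ≤ A * |u| ^ β * |u| :=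
      (abs_norm_sub_norm_le _ _).trans (by rwa [norm_sub_rev])
    rw [e, abs_mul, abs_of_nonneg (by positivity : 0 ≤ ‖(u : ℂ) * p‖ + ‖Δ‖)]
    gcongr
    linarith
  have bXY : |inner ℝ Δ p / (‖Δ‖ ^ 2 + ε ^ 2) -
      ‖p‖ ^ 2 * u / (‖p‖ ^ 2 * u ^ 2 + ε ^ 2)| ≤ 3 * A * B / c ^ 2 * |u| ^ (β - 1) := by
    have e : inner ℝ Δ p / (‖Δ‖ ^ 2 + ε ^ 2) - ‖p‖ ^ 2 * u / (‖p‖ ^ 2 * u ^ 2 + ε ^ 2) =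
        (inner ℝ Δ p - u * ‖p‖ ^ 2) / (‖Δ‖ ^ 2 + ε ^ 2) +
        ‖p‖ ^ 2 * u * (‖p‖ ^ 2 * u ^ 2 - ‖Δ‖ ^ 2) /
          ((‖Δ‖ ^ 2 + ε ^ 2) * (‖p‖ ^ 2 * u ^ 2 + ε ^ 2)) := by
      field_simp
      ring
    have b0 : c ^ 2 * |u| ^ 2 ≤ ‖Δ‖ ^ 2 + ε ^ 2 := by
      rw [← mul_pow]
      have : (c * |u|) ^ 2 ≤ ‖Δ‖ ^ 2 := by gcongr
      nlinarith [sq_nonneg ε]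
    have b1 : ‖p‖ ^ 2 * |u| ^ 2 ≤ ‖p‖ ^ 2 * u ^ 2 + ε ^ 2 := by
      rw [sq_abs]
      nlinarith [sq_nonneg ε]
    rw [e]
    refine (abs_add_le _ _).trans ?_
    rw [abs_div, abs_div, abs_mul, abs_mul, abs_mul, abs_of_pos hd, abs_of_pos hd',
      abs_of_nonneg (sq_nonneg ‖p‖)]
    calc _ ≤ A * |u| ^ β * |u| * B / (c ^ 2 * |u| ^ 2) +
          ‖p‖ ^ 2 * |u| * (A * |u| ^ β * |u| * (2 * B * |u|)) /
            ((c ^ 2 * |u| ^ 2) * (‖p‖ ^ 2 * |u| ^ 2)) := by gcongr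
      _ = _ := by
        rw [Real.rpow_sub_one hp.ne']
        field_simp
        ring
  have e : g (t + u) * ((inner ℝ Δ p / (‖Δ‖ ^ 2 + ε ^ 2) : ℝ) : ℂ) -
      g t * ((‖p‖ ^ 2 * u / (‖p‖ ^ 2 * u ^ 2 + ε ^ 2) : ℝ) : ℂ) =
      (g (t + u) - g t) * ((inner ℝ Δ p / (‖Δ‖ ^ 2 + ε ^ 2) : ℝ) : ℂ) +
      g t * ((inner ℝ Δ p / (‖Δ‖ ^ 2 + ε ^ 2) -
      ‖p‖ ^ 2 * u / (‖p‖ ^ 2 * u ^ 2 + ε ^ 2) : ℝ) : ℂ) := by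
    push_cast
    ring
  rw [e]
  refine (norm_add_le _ _).trans ?_
  rw [norm_mul, norm_mul, Complex.norm_real, Complex.norm_real, Real.norm_eq_abs, Real.norm_eq_abs,
    add_mul]
  have k5 := hG (t + u) t
  rw [add_sub_cancel_left] at k5
  have k6 := (norm_nonneg _).trans k5
  refine add_le_add ?_ ?_
  · calc _ ≤ (G * |u| ^ β) * (B / c * |u|⁻¹) := by gcongr
      _ = _ := by rw [Real.rpow_sub_one hp.ne']; ring
  · calc _ ≤ M * (3 * A * B / c ^ 2 * |u| ^ (β - 1)) := by
          have := (norm_nonneg _).trans (hM t)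
          gcongr
          exact hM t
      _ = _ := by ring

/-- The subtracted term is odd in `u` and integrates to zero over the symmetric window; the overall
sign comes from reversing the chord. -/
theorem logPotRegDeriv_eq {L A B c β : ℝ} {γ g : ℝ → ℂ} (h : CurveBounds L β A B c γ)
    (hγ : Function.Periodic γ L) (hg : Continuous g)
    (hgp : Function.Periodic g L) {ε : ℝ} (hε : 0 < ε) (t : ℝ) :
    logPotRegDeriv L γ g ε t = -∫ u in -(L / 2)..L / 2,
      (g (t + u) * ((inner ℝ (γ (t + u) - γ t) (deriv γ t) /
        (‖γ (t + u) - γ t‖ ^ 2 + ε ^ 2) : ℝ) : ℂ) -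
      g t * ((‖deriv γ t‖ ^ 2 * u / (‖deriv γ t‖ ^ 2 * u ^ 2 + ε ^ 2) : ℝ) : ℂ)) := by
  have hγc := h.continuous
  have c1 : Continuous fun u => g (t + u) * ((inner ℝ (γ (t + u) - γ t) (deriv γ t) /
        (‖γ (t + u) - γ t‖ ^ 2 + ε ^ 2) : ℝ) : ℂ) := by
    refine (hg.comp (by fun_prop)).mul (Complex.continuous_ofReal.comp (Continuous.div ?_ ?_ ?_))
    · fun_prop
    · fun_prop
    · exact fun s => by positivity
  have c2 : Continuous fun u : ℝ =>
      g t * ((‖deriv γ t‖ ^ 2 * u / (‖deriv γ t‖ ^ 2 * u ^ 2 + ε ^ 2) : ℝ) : ℂ) := by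
    refine continuous_const.mul (Complex.continuous_ofReal.comp (Continuous.div ?_ ?_ ?_))
    · fun_prop
    · fun_prop
    · exact fun s => by positivity
  have hodd : ∫ u in -(L / 2)..L / 2,
      g t * ((‖deriv γ t‖ ^ 2 * u / (‖deriv γ t‖ ^ 2 * u ^ 2 + ε ^ 2) : ℝ) : ℂ) = 0 := by
    have h1 := intervalIntegral.integral_comp_neg (a := -(L / 2)) (b := L / 2) fun u : ℝ =>
      g t * ((‖deriv γ t‖ ^ 2 * u / (‖deriv γ t‖ ^ 2 * u ^ 2 + ε ^ 2) : ℝ) : ℂ)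
    rw [neg_neg] at h1
    rw [← self_eq_neg, ← intervalIntegral.integral_neg]
    nth_rewrite 1 [← h1]
    congr 1
    funext u
    rw [neg_sq]
    push_cast
    ring
  rw [intervalIntegral.integral_sub (c1.intervalIntegrable _ _) (c2.intervalIntegrable _ _), hodd,
    sub_zero, logPotRegDeriv, Function.Periodic.integral_eq_integral_shift (t := t),
    ← intervalIntegral.integral_neg]
  · congr 1
    funext u
    rw [← neg_sub (γ (t + u)) (γ t), inner_neg_left, norm_neg]
    push_cast
    ring
  · intro s
    simp only [hγ s, hgp s]

theorem inner_div_norm_sq (z w : ℂ) : inner ℝ z w / ‖z‖ ^ 2 = (w / z).re := by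
  rw [Complex.inner, ← Complex.normSq_eq_norm_sq, Complex.div_re]
  simp
  ring

/-- Pointwise convergence together with a bound uniform in both `ε` and `t` is what is needed to
pass to the limit in the integrated identity of `hasDerivAt_logPot`. -/
theorem tendsto_logPotRegDeriv {L β : ℝ} {γ g : ℝ → ℂ} (hL : 0 < L) (hβ : 0 < β)
    (hγ : RegularCurve L β γ) (hg : HolderPer L β 0 g) :
    (∃ K : ℝ, ∀ ε, 0 < ε → ∀ t, ‖logPotRegDeriv L γ g ε t‖ ≤ K) ∧
    ∀ t, Tendsto (fun ε => logPotRegDeriv L γ g ε t) (𝓝[>] 0) (𝓝 (logPotDeriv L γ g t)) := by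
  obtain ⟨A, B, c, h⟩ := hγ.exists_bounds hL hβ
  obtain ⟨G', hG'⟩ := hg.2
  obtain ⟨M, hM0, hM⟩ := hg.exists_norm_le hL hβ
  have hA := h.A_pos
  have hB := h.B_pos
  have hc := h.c_pos
  have hG : ∀ s t, ‖g s - g t‖ ≤ |G'| * |s - t| ^ β := fun s t =>
    (hG' s t).trans (mul_le_mul_of_nonneg_right (le_abs_self G') (by positivity))
  have hgc := hg.continuous hβ
  have hγc := h.continuous
  have hr : -1 < β - 1 := by linarith
  have eq := fun ε (hε : 0 < ε) t =>
    logPotRegDeriv_eq h hγ.holder.periodic hgc hg.1 hε t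
  refine ⟨⟨(|G'| * (B / c) + M * (3 * A * B / c ^ 2)) *
    (2 * (L / 2) ^ (β - 1 + 1) / (β - 1 + 1)), fun ε hε t => ?_⟩, fun t => ?_⟩
  · rw [eq ε hε t, norm_neg]
    exact norm_integral_le_of_le_abs_rpow hr (by positivity)
      (h.norm_reg_sub_le hγ.regular hG hM t) le_rfl (by linarith) le_rfl
  · refine Tendsto.congr' (f₁ := fun ε => -∫ u in -(L / 2)..L / 2,
      (g (t + u) * ((inner ℝ (γ (t + u) - γ t) (deriv γ t) /
        (‖γ (t + u) - γ t‖ ^ 2 + ε ^ 2) : ℝ) : ℂ) -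
      g t * ((‖deriv γ t‖ ^ 2 * u / (‖deriv γ t‖ ^ 2 * u ^ 2 + ε ^ 2) : ℝ) : ℂ))) ?_ ?_
    · filter_upwards [self_mem_nhdsWithin] with ε hε
      exact (eq ε hε t).symm
    · refine Tendsto.neg ?_
      refine intervalIntegral.tendsto_integral_filter_of_dominated_convergence
        (fun u => (|G'| * (B / c) + M * (3 * A * B / c ^ 2)) * |u| ^ (β - 1)) ?_ ?_
        ((intervalIntegrable_abs_rpow hr _ _).const_mul _) ?_
      · filter_upwards [self_mem_nhdsWithin] with ε hε
        have hε : 0 < ε := hε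
        refine Continuous.aestronglyMeasurable (Continuous.sub ?_ ?_)
        · refine (hgc.comp (by fun_prop)).mul
            (Complex.continuous_ofReal.comp (Continuous.div ?_ ?_ ?_))
          · fun_prop
          · fun_prop
          · exact fun s => by positivity
        · refine continuous_const.mul (Complex.continuous_ofReal.comp (Continuous.div ?_ ?_ ?_))
          · fun_prop
          · fun_prop
          · exact fun s => by positivity
      · refine Eventually.of_forall fun ε => ?_
        filter_upwards [ae_ne_zero] with u hu0 hu
        rw [uIoc_of_le (by linarith)] at hu
        exact h.norm_reg_sub_le hγ.regular hG hM t u hu0 (abs_le.2 ⟨hu.1.le, hu.2⟩)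
      · filter_upwards [ae_ne_zero] with u hu0 hu
        rw [uIoc_of_le (by linarith)] at hu
        have huL : |u| ≤ L / 2 := abs_le.2 ⟨hu.1.le, hu.2⟩
        have hΔ : γ (t + u) - γ t ≠ 0 := h.sub_ne_zero (by rwa [add_sub_cancel_left])
          (by rw [add_sub_cancel_left]; linarith)
        have hn : ‖γ (t + u) - γ t‖ ^ 2 ≠ 0 := by simpa using hΔ
        have hp : ‖deriv γ t‖ ≠ 0 := by simpa using hγ.regular t
        have l1 : Tendsto (fun ε : ℝ => inner ℝ (γ (t + u) - γ t) (deriv γ t) /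
            (‖γ (t + u) - γ t‖ ^ 2 + ε ^ 2)) (𝓝[>] 0)
            (𝓝 ((deriv γ t / (γ (t + u) - γ t)).re)) := by
          rw [← inner_div_norm_sq]
          have : ContinuousAt (fun ε : ℝ => inner ℝ (γ (t + u) - γ t) (deriv γ t) /
            (‖γ (t + u) - γ t‖ ^ 2 + ε ^ 2)) 0 := by
            refine ContinuousAt.div (by fun_prop) (by fun_prop) (by simpa using hΔ)
          have h2 := this.tendsto
          simp only [ne_eq, OfNat.ofNat_ne_zero, not_false_eq_true, zero_pow, add_zero] at h2
          exact h2.mono_left nhdsWithin_le_nhds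
        have l2 : Tendsto (fun ε : ℝ => ‖deriv γ t‖ ^ 2 * u /
            (‖deriv γ t‖ ^ 2 * u ^ 2 + ε ^ 2)) (𝓝[>] 0) (𝓝 u⁻¹) := by
          have : ContinuousAt (fun ε : ℝ => ‖deriv γ t‖ ^ 2 * u /
            (‖deriv γ t‖ ^ 2 * u ^ 2 + ε ^ 2)) 0 := by
            refine ContinuousAt.div (by fun_prop) (by fun_prop) (by simp [hu0, hγ.regular t])
          have h2 := this.tendsto
          simp only [ne_eq, OfNat.ofNat_ne_zero, not_false_eq_true, zero_pow, add_zero] at h2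
          have e : ‖deriv γ t‖ ^ 2 * u / (‖deriv γ t‖ ^ 2 * u ^ 2) = u⁻¹ := by
            field_simp
          rw [e] at h2
          exact h2.mono_left nhdsWithin_le_nhds
        have l1' := ((Complex.continuous_ofReal.tendsto _).comp l1).const_mul (g (t + u))
        have l2' := ((Complex.continuous_ofReal.tendsto _).comp l2).const_mul (g t)
        have := l1'.sub l2'
        rw [Complex.ofReal_inv] at this
        exact this

theorem tendsto_logPotReg {L β : ℝ} {γ g : ℝ → ℂ} (hL : 0 < L) (hβ : 0 < β)
    (hγ : RegularCurve L β γ) (hg : Continuous g) (hgp : Function.Periodic g L) (t : ℝ) :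
    Tendsto (fun ε => logPotReg L γ g ε t) (𝓝[>] 0) (𝓝 (logPot L γ g t)) := by
  obtain ⟨A, B, c, h⟩ := hγ.exists_bounds hL hβ
  have hγp := hγ.holder.periodic
  obtain ⟨M, hM0, hM⟩ := hgp.exists_norm_le hL hg
  obtain ⟨R, hR0, hR⟩ := hγp.exists_norm_le hL h.continuous
  have hc := h.c_pos
  have hγc := h.continuous
  have e1 : logPot L γ g t = ∫ u in -(L / 2)..L / 2,
      g (t + u) * ((Real.log ‖γ t - γ (t + u)‖ : ℝ) : ℂ) :=
    Function.Periodic.integral_eq_integral_shift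
      (F := fun s => g s * ((Real.log ‖γ t - γ s‖ : ℝ) : ℂ))
      (fun s => by simp only [hγp s, hgp s]) t
  have e2 : (fun ε => logPotReg L γ g ε t) = fun ε => ∫ u in -(L / 2)..L / 2,
      g (t + u) * ((1 / 2 * Real.log (‖γ t - γ (t + u)‖ ^ 2 + ε ^ 2) : ℝ) : ℂ) := by
    funext ε
    exact Function.Periodic.integral_eq_integral_shift
      (F := fun s => g s * ((1 / 2 * Real.log (‖γ t - γ s‖ ^ 2 + ε ^ 2) : ℝ) : ℂ))
      (fun s => by simp only [hγp s, hgp s]) t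
  rw [e1, e2]
  -- The majorant is `abs_log_le` at `|chord|² + ε²`, which is at least `(c |u|)²` and, for `ε < 1`,
  -- at most `(2R)² + 1`.
  refine intervalIntegral.tendsto_integral_filter_of_dominated_convergence
    (fun u => M * (1 / 2 * ((2 * R) ^ 2 + 1 + 4 * ((c ^ (-(1 / 2) : ℝ)) * |u| ^ (-(1 / 2) : ℝ)))))
    ?_ ?_ ?_ ?_
  · refine Eventually.of_forall fun ε => Measurable.aestronglyMeasurable ?_
    refine (hg.comp (by fun_prop)).measurable.mul (Complex.measurable_ofReal.comp ?_)
    refine (Real.measurable_log.comp ?_).const_mul _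
    have : Continuous fun u => ‖γ t - γ (t + u)‖ ^ 2 + ε ^ 2 := by fun_prop
    exact this.measurable
  · have hε1 : ∀ᶠ ε : ℝ in 𝓝[>] 0, ε < 1 :=
      mem_nhdsWithin_of_mem_nhds (Iio_mem_nhds one_pos)
    filter_upwards [self_mem_nhdsWithin, hε1] with ε hε hε1
    have hε : 0 < ε := hε
    filter_upwards [ae_ne_zero] with u hu0 hu
    rw [uIoc_of_le (by linarith)] at hu
    have huL : |u| ≤ L / 2 := abs_le.2 ⟨hu.1.le, hu.2⟩
    have hp := abs_pos.2 hu0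
    have k2 : c * |u| ≤ ‖γ t - γ (t + u)‖ := by
      rw [norm_sub_rev]
      exact h.chord t u (by linarith)
    have k3 : ‖γ t - γ (t + u)‖ ≤ 2 * R :=
      (norm_sub_le _ _).trans (by linarith [hR t, hR (t + u)])
    have hy : 0 < ‖γ t - γ (t + u)‖ ^ 2 + ε ^ 2 := by positivity
    have hy2 : (c * |u|) ^ 2 ≤ ‖γ t - γ (t + u)‖ ^ 2 + ε ^ 2 := by
      have : (c * |u|) ^ 2 ≤ ‖γ t - γ (t + u)‖ ^ 2 := by gcongr
      nlinarith [sq_nonneg ε]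
    have k4 := abs_log_le hy
    have k5 : (‖γ t - γ (t + u)‖ ^ 2 + ε ^ 2) ^ (-(1 / 4) : ℝ) ≤
        c ^ (-(1 / 2) : ℝ) * |u| ^ (-(1 / 2) : ℝ) := by
      rw [← Real.mul_rpow hc.le hp.le]
      calc _ ≤ ((c * |u|) ^ 2) ^ (-(1 / 4) : ℝ) :=
            Real.rpow_le_rpow_of_nonpos (by positivity) hy2 (by norm_num)
        _ = _ := by
          rw [← Real.rpow_natCast, ← Real.rpow_mul (by positivity)]
          norm_num
    have k6 : ‖γ t - γ (t + u)‖ ^ 2 + ε ^ 2 ≤ (2 * R) ^ 2 + 1 := by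
      have : ε ^ 2 ≤ 1 := by nlinarith
      gcongr
    rw [norm_mul, Complex.norm_real, Real.norm_eq_abs, abs_mul, abs_of_pos (by norm_num : (0:ℝ) <
      1 / 2)]
    gcongr
    · exact hM _
    · linarith
  · refine (((intervalIntegrable_const (c := (2 * R) ^ 2 + 1)).add
      (((intervalIntegrable_abs_rpow (by norm_num) _ _).const_mul _).const_mul _)).const_mul
      _).const_mul _
  · filter_upwards [ae_ne_zero] with u hu0 hu
    rw [uIoc_of_le (by linarith)] at hu
    have huL : |u| ≤ L / 2 := abs_le.2 ⟨hu.1.le, hu.2⟩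
    have hΔ : γ (t + u) - γ t ≠ 0 := h.sub_ne_zero (by rwa [add_sub_cancel_left])
      (by rw [add_sub_cancel_left]; linarith)
    have hΔ' : γ t - γ (t + u) ≠ 0 := by rw [← neg_sub]; exact neg_ne_zero.2 hΔ
    refine Tendsto.const_mul _ ((Complex.continuous_ofReal.tendsto _).comp ?_)
    have : ContinuousAt (fun ε : ℝ => 1 / 2 * Real.log (‖γ t - γ (t + u)‖ ^ 2 + ε ^ 2)) 0 :=
      continuousAt_const.mul (ContinuousAt.log (by fun_prop) (by simpa using hΔ'))
    have h2 := this.tendsto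
    simp only [ne_eq, OfNat.ofNat_ne_zero, not_false_eq_true, zero_pow, add_zero,
      Real.log_pow] at h2
    have e : 1 / 2 * (((2 : ℕ) : ℝ) * Real.log ‖γ t - γ (t + u)‖) =
        Real.log ‖γ t - γ (t + u)‖ := by push_cast; ring
    rw [e] at h2
    exact h2.mono_left nhdsWithin_le_nhds

/-- Write the real part as half the sum with the conjugate. The kernel carries `γ'(t)` and not
`γ'(s)`, hence the division by `γ'` inside the operator. -/
theorem logPotDeriv_eq {L β : ℝ} {γ g : ℝ → ℂ} (hL : 0 < L) (hβ : 0 < β) (hβ1 : β ≤ 1)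
    (hγ : RegularCurve L β γ) (hg : HolderPer L β 0 g) (t : ℝ) :
    logPotDeriv L γ g t = -(1 / 2 * (deriv γ t * cauchyOp L γ (fun t => g t / deriv γ t) t +
      (starRingEnd ℂ) (deriv γ t *
        cauchyOp L γ (fun t => (starRingEnd ℂ) (g t) / deriv γ t) t))) := by
  have hL2 : |L / 2| ≤ L / 2 := by rw [abs_of_pos (by positivity)]
  have hi := hγ.holder.2.2.inv hL hβ hβ1 hγ.regular
  have h1 : HolderPer L β 0 fun t => g t / deriv γ t :=
    (hg.mul hL hβ hβ1 hi).congr fun t => div_eq_mul_inv _ _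
  have h2 : HolderPer L β 0 fun t => (starRingEnd ℂ) (g t) / deriv γ t :=
    (hg.conj.mul hL hβ hβ1 hi).congr fun t => div_eq_mul_inv _ _
  have i1 := (intervalIntegrable_cauchyIntegrand hL hβ hγ h1 t (p := -(L / 2)) (q := L / 2)
    (by rwa [abs_neg]) hL2).const_mul (deriv γ t)
  have i2 := (intervalIntegrable_cauchyIntegrand hL hβ hγ h2 t (p := -(L / 2)) (q := L / 2)
    (by rwa [abs_neg]) hL2).const_mul (deriv γ t)
  have i3 : IntervalIntegrable (fun u => (starRingEnd ℂ) (deriv γ t *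
      ((starRingEnd ℂ) (g (t + u)) / deriv γ (t + u) * (deriv γ (t + u) / (γ (t + u) - γ t)) -
      (starRingEnd ℂ) (g t) / deriv γ t * (u : ℂ)⁻¹))) volume (-(L / 2)) (L / 2) :=
    ⟨Complex.conjCLE.toContinuousLinearMap.integrable_comp i2.1,
      Complex.conjCLE.toContinuousLinearMap.integrable_comp i2.2⟩
  have e3 : (starRingEnd ℂ) (∫ u in -(L / 2)..L / 2, deriv γ t *
      ((starRingEnd ℂ) (g (t + u)) / deriv γ (t + u) * (deriv γ (t + u) / (γ (t + u) - γ t)) -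
      (starRingEnd ℂ) (g t) / deriv γ t * (u : ℂ)⁻¹)) =
      ∫ u in -(L / 2)..L / 2, (starRingEnd ℂ) (deriv γ t *
      ((starRingEnd ℂ) (g (t + u)) / deriv γ (t + u) * (deriv γ (t + u) / (γ (t + u) - γ t)) -
      (starRingEnd ℂ) (g t) / deriv γ t * (u : ℂ)⁻¹)) := by
    rw [intervalIntegral.integral_of_le (by linarith), intervalIntegral.integral_of_le
      (by linarith)]
    exact integral_conj.symm
  rw [logPotDeriv, cauchyOp, cauchyOp, ← intervalIntegral.integral_const_mul,
    ← intervalIntegral.integral_const_mul, e3, ← intervalIntegral.integral_add i1 i3,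
    ← intervalIntegral.integral_const_mul]
  congr 2
  funext u
  have n1 := hγ.regular t
  have n2 := hγ.regular (t + u)
  have n3 : (starRingEnd ℂ) (deriv γ t) ≠ 0 := by simpa using n1
  have n4 : (starRingEnd ℂ) (deriv γ (t + u)) ≠ 0 := by simpa using n2
  have e4 : deriv γ t * (g (t + u) / deriv γ (t + u) * (deriv γ (t + u) / (γ (t + u) - γ t)) -
      g t / deriv γ t * (u : ℂ)⁻¹) =
      g (t + u) * (deriv γ t / (γ (t + u) - γ t)) - g t * (u : ℂ)⁻¹ := by
    rw [div_mul_div_cancel₀ n2]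
    field_simp
  have e5 : (starRingEnd ℂ) (deriv γ t *
      ((starRingEnd ℂ) (g (t + u)) / deriv γ (t + u) * (deriv γ (t + u) / (γ (t + u) - γ t)) -
      (starRingEnd ℂ) (g t) / deriv γ t * (u : ℂ)⁻¹)) =
      g (t + u) * (starRingEnd ℂ) (deriv γ t / (γ (t + u) - γ t)) - g t * (u : ℂ)⁻¹ := by
    rw [div_mul_div_cancel₀ n2]
    simp only [map_sub, map_mul, map_div₀, map_inv₀, Complex.conj_conj, Complex.conj_ofReal]
    field_simp
  rw [e4, e5, Complex.re_eq_add_conj]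
  ring

theorem holderPer_cauchyOp_zero {L β : ℝ} {γ g : ℝ → ℂ} (hL : 0 < L) (hβ : 0 < β) (hβ1 : β < 1)
    (hγ : RegularCurve L β γ) (hg : HolderPer L β 0 g) : HolderPer L β 0 (cauchyOp L γ g) :=
  ((holderPer_cauchyOp_sub_circle hL hβ le_rfl hβ1 hγ hγ.holder hg).add
    (holderPer_cauchyOp_circle hL hβ hβ1 hg)).congr fun t => by ring

theorem continuous_logPotDeriv {L β : ℝ} {γ g : ℝ → ℂ} (hL : 0 < L) (hβ : 0 < β) (hβ1 : β < 1)
    (hγ : RegularCurve L β γ) (hg : HolderPer L β 0 g) : Continuous (logPotDeriv L γ g) := by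
  have hi := hγ.holder.2.2.inv hL hβ hβ1.le hγ.regular
  have h1 : HolderPer L β 0 fun t => g t / deriv γ t :=
    (hg.mul hL hβ hβ1.le hi).congr fun t => div_eq_mul_inv _ _
  have h2 : HolderPer L β 0 fun t => (starRingEnd ℂ) (g t) / deriv γ t :=
    (hg.conj.mul hL hβ hβ1.le hi).congr fun t => div_eq_mul_inv _ _
  have c0 := hγ.holder.2.2.continuous hβ
  have c1 := (holderPer_cauchyOp_zero hL hβ hβ1 hγ h1).continuous hβ
  have c2 := (holderPer_cauchyOp_zero hL hβ hβ1 hγ h2).continuous hβ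
  rw [show logPotDeriv L γ g = _ from funext (logPotDeriv_eq hL hβ hβ1.le hγ hg)]
  exact (continuous_const.mul ((c0.mul c1).add (Complex.continuous_conj.comp (c0.mul c2)))).neg

theorem hasDerivAt_logPot {L β : ℝ} {γ g : ℝ → ℂ} (hL : 0 < L) (hβ : 0 < β) (hβ1 : β < 1)
    (hγ : RegularCurve L β γ) (hg : HolderPer L β 0 g) (t : ℝ) :
    HasDerivAt (logPot L γ g) (logPotDeriv L γ g t) t := by
  obtain ⟨A, B, c, h⟩ := hγ.exists_bounds hL hβ
  obtain ⟨⟨K, hK⟩, hlim⟩ := tendsto_logPotRegDeriv hL hβ hγ hg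
  have hgc := hg.continuous hβ
  have hv := continuous_logPotDeriv hL hβ hβ1 hγ hg
  -- The fundamental theorem of calculus holds for each regularization, and both sides converge as
  -- `ε → 0`. Differentiability then follows from the continuity of the limiting derivative.
  have key : ∀ x, logPot L γ g x = logPot L γ g 0 + ∫ τ in (0 : ℝ)..x, logPotDeriv L γ g τ := by
    intro x
    have l1 := (tendsto_logPotReg hL hβ hγ hgc hg.1 x).sub (tendsto_logPotReg hL hβ hγ hgc hg.1 0)
    have l2 : Tendsto (fun ε => ∫ τ in (0 : ℝ)..x, logPotRegDeriv L γ g ε τ) (𝓝[>] 0)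
        (𝓝 (∫ τ in (0 : ℝ)..x, logPotDeriv L γ g τ)) := by
      refine intervalIntegral.tendsto_integral_filter_of_dominated_convergence (fun _ => K) ?_ ?_
        intervalIntegrable_const (Eventually.of_forall fun τ _ => hlim τ)
      · filter_upwards [self_mem_nhdsWithin] with ε hε
        exact (continuous_logPotRegDeriv h hgc hε).aestronglyMeasurable
      · filter_upwards [self_mem_nhdsWithin] with ε hε
        exact Eventually.of_forall fun τ _ => hK ε hε τ
    have l3 : Tendsto (fun ε => ∫ τ in (0 : ℝ)..x, logPotRegDeriv L γ g ε τ) (𝓝[>] 0)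
        (𝓝 (logPot L γ g x - logPot L γ g 0)) := by
      refine l1.congr' ?_
      filter_upwards [self_mem_nhdsWithin] with ε hε
      exact (intervalIntegral.integral_eq_sub_of_hasDerivAt
        (fun τ _ => hasDerivAt_logPotReg h hγ.holder.periodic hgc hg.1 hε τ)
        ((continuous_logPotRegDeriv h hgc hε).intervalIntegrable _ _)).symm
    rw [tendsto_nhds_unique l2 l3]
    ring
  rw [show logPot L γ g = _ from funext key]
  exact (intervalIntegral.integral_hasDerivAt_right (hv.intervalIntegrable _ _)
    (hv.stronglyMeasurableAtFilter _ _) hv.continuousAt).const_add _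

/-- The derivative of the logarithmic potential agrees with the model operator up to a function
whose regularity is that of the curve. -/
theorem holderPer_logPotDeriv_add {L α β : ℝ} {k : ℕ} {γ g : ℝ → ℂ} (hL : 0 < L) (hβ : 0 < β)
    (hβα : β ≤ α) (hα1 : α < 1) (hγ : RegularCurve L α γ) (hγk : HolderPer L α (k + 1) γ)
    (hg : HolderPer L β k g) : HolderPer L α k
      fun t => logPotDeriv L γ g t + cauchyOp L (circleCurve L) g t := by
  have hα : 0 < α := hβ.trans_le hβα
  have hβ1 : β < 1 := hβα.trans_lt hα1
  have hg0 := hg.of_le hL hβ hβ1.le (Nat.zero_le _)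
  have key : ∀ φ : ℝ → ℂ, HolderPer L β k φ → HolderPer L α k fun t =>
      deriv γ t * cauchyOp L γ (fun t => φ t / deriv γ t) t - cauchyOp L (circleCurve L) φ t :=
    fun φ hφ => ((holderPer_mul_cauchyOp_div_sub hL hβ hβα hα1 hγ hγk hφ).add
      (holderPer_cauchyOp_sub_circle hL hβ hβα hα1 hγ hγk hφ)).congr fun t => by ring
  -- The added constant compensates the mean produced by `cauchyOp_circle_conj`.
  refine ((((key g hg).add (key _ hg.conj).conj).const_mul hL hα hα1.le (-(1 / 2))).add
    (HolderPer.const (1 / 2 * (2 * Real.pi * Complex.I / L * ∫ t in -(L / 2)..L / 2, g t)))).congr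
      fun t => ?_
  rw [logPotDeriv_eq hL hβ hβ1.le (hγ.mono hL hβ hβα) hg0, map_sub,
    cauchyOp_circle_conj hL hβ hβ1.le hg0]
  ring

/-! ### The potential in the plane: Hölder continuity -/

/-- The logarithmic potential in the plane of a density with respect to the parameter. -/
noncomputable def planePot (L : ℝ) (γ g : ℝ → ℂ) (z : ℂ) : ℂ :=
  ∫ s in (0 : ℝ)..L, g s * ((Real.log ‖z - γ s‖ : ℝ) : ℂ)

/-- The Cauchy integral in the plane of a density with respect to the parameter. -/
noncomputable def planeCauchy (L : ℝ) (γ g : ℝ → ℂ) (z : ℂ) : ℂ :=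
  ∫ s in (0 : ℝ)..L, g s / (z - γ s)

/-- A local primitive of `planeCauchy` near `z₀`. -/
noncomputable def planeLog (L : ℝ) (γ g : ℝ → ℂ) (z₀ z : ℂ) : ℂ :=
  ∫ s in (0 : ℝ)..L, g s * Complex.log (1 + (z - z₀) / (z₀ - γ s))

section Global

variable {L α : ℝ} {γ g : ℝ → ℂ}

/-- Take `γ(s₀)` nearest to `z`. The chord from it to `γ(s₀ + u)` is at most twice the distance from
`z` to `γ(s₀ + u)`, whence the half of the chord constant, uniformly over the plane. -/
theorem RegularCurve.exists_foot (hL : 0 < L) (hα : 0 < α) (hγ : RegularCurve L α γ) :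
    ∃ c : ℝ, 0 < c ∧ ∀ z : ℂ, ∃ s₀ : ℝ, ∀ u, |u| ≤ L / 2 → c * |u| ≤ ‖z - γ (s₀ + u)‖ := by
  obtain ⟨A, B, c, h⟩ := hγ.exists_bounds hL hα
  refine ⟨c / 2, half_pos h.c_pos, fun z => ?_⟩
  have hγc := h.continuous
  obtain ⟨s₀, -, hs₀⟩ := (isCompact_Icc (a := (0 : ℝ)) (b := L)).exists_isMinOn
    ⟨0, le_rfl, hL.le⟩ (by fun_prop : Continuous fun s => ‖z - γ s‖).continuousOn
  refine ⟨s₀, fun u hu => ?_⟩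
  obtain ⟨s, hs, hst⟩ := hγ.holder.periodic.exists_mem_Ico₀ hL (s₀ + u)
  have h1 : ‖z - γ s₀‖ ≤ ‖z - γ (s₀ + u)‖ := by
    rw [hst]
    exact hs₀ ⟨hs.1, hs.2.le⟩
  have h2 := h.chord s₀ u (by linarith)
  have h3 : ‖γ (s₀ + u) - γ s₀‖ ≤ ‖z - γ s₀‖ + ‖z - γ (s₀ + u)‖ := by
    have : γ (s₀ + u) - γ s₀ = (z - γ s₀) - (z - γ (s₀ + u)) := by ring
    rw [this]
    exact norm_sub_le _ _
  linarith

theorem RegularCurve.ae_ne (hL : 0 < L) (hγ : RegularCurve L α γ) (z : ℂ) :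
    ∀ᵐ s : ℝ, s ∈ Ioc 0 L → z - γ s ≠ 0 := by
  have hs : {s : ℝ | ¬ (s ∈ Ioc 0 L → z - γ s ≠ 0)}.Subsingleton := by
    intro s hs t ht
    simp only [mem_ofPred_eq, Classical.not_imp, not_not] at hs ht
    have e : γ s = γ t := (sub_eq_zero.1 hs.2).symm.trans (sub_eq_zero.1 ht.2)
    rcases lt_trichotomy s t with hst | hst | hst
    · exact absurd e.symm (hγ.ne hL hst (by linarith [hs.1.1, ht.1.2]))
    · exact hst
    · exact absurd e (hγ.ne hL hst (by linarith [ht.1.1, hs.1.2]))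
  rw [ae_iff]
  exact hs.measure_zero _

theorem RegularCurve.exists_integral_rpow_le (hL : 0 < L) (hα : 0 < α) (hγ : RegularCurve L α γ)
    {θ : ℝ} (hθ0 : 0 ≤ θ) (hθ : θ < 1) :
    ∃ K : ℝ, ∀ z : ℂ, IntervalIntegrable (fun s => ‖z - γ s‖ ^ (-θ)) volume 0 L ∧
      ∫ s in (0 : ℝ)..L, ‖z - γ s‖ ^ (-θ) ≤ K := by
  obtain ⟨c, hc, hfoot⟩ := hγ.exists_foot hL hα
  have hγc := hγ.holder.continuous hα
  have hp := hγ.holder.periodic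
  have hr : -1 < -θ := by linarith
  refine ⟨c ^ (-θ) * (2 * (L / 2) ^ (-θ + 1) / (-θ + 1)), fun z => ?_⟩
  obtain ⟨s₀, hs₀⟩ := hfoot z
  have hper : Function.Periodic (fun s => ‖z - γ s‖ ^ (-θ)) L := fun s => by simp only [hp s]
  have hb : ∀ u, u ≠ 0 → |u| ≤ L / 2 → ‖‖z - γ (s₀ + u)‖ ^ (-θ)‖ ≤ c ^ (-θ) * |u| ^ (-θ) := by
    intro u hu huL
    have hp := abs_pos.2 hu
    rw [Real.norm_of_nonneg (by positivity), ← Real.mul_rpow hc.le hp.le]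
    exact Real.rpow_le_rpow_of_nonpos (by positivity) (hs₀ u huL) (by linarith)
  have hm : Measurable fun u => ‖z - γ (s₀ + u)‖ ^ (-θ) := by
    have : Continuous fun u => ‖z - γ (s₀ + u)‖ := by fun_prop
    exact this.measurable.pow_const _
  have hi := intervalIntegrable_of_le_abs_rpow hr hm hb (p := -(L / 2)) (q := L / 2)
    (by rw [abs_neg, abs_of_pos (by positivity)]) (by rw [abs_of_pos (by positivity)])
  constructor
  · refine hper.intervalIntegrable hL.ne' (t := s₀ - L / 2) ?_ _ _
    have := hi.comp_sub_right s₀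
    simp only [add_sub_cancel] at this
    rw [show -(L / 2) + s₀ = s₀ - L / 2 by ring,
      show L / 2 + s₀ = s₀ - L / 2 + L by ring] at this
    exact this
  · rw [hper.integral_eq_integral_shift s₀]
    exact (Real.le_norm_self _).trans
      (norm_integral_le_of_le_abs_rpow hr (by positivity) hb le_rfl (by linarith) le_rfl)

theorem intervalIntegrable_planePot (hL : 0 < L) (hα : 0 < α) (hγ : RegularCurve L α γ)
    (hg : Continuous g) (z : ℂ) : IntervalIntegrable
      (fun s => g s * ((Real.log ‖z - γ s‖ : ℝ) : ℂ)) volume 0 L := by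
  have hγc := hγ.holder.continuous hα
  obtain ⟨K, hK⟩ := hγ.exists_integral_rpow_le hL hα (θ := 1 / 4) (by norm_num) (by norm_num)
  have c1 : Continuous fun s => ‖z - γ s‖ := by fun_prop
  have hlog : IntervalIntegrable (fun s => ((Real.log ‖z - γ s‖ : ℝ) : ℂ)) volume 0 L := by
    refine ((c1.intervalIntegrable _ _).add ((hK z).1.const_mul 4)).mono_fun' ?_ ?_
    · exact (Complex.measurable_ofReal.comp
        (Real.measurable_log.comp c1.measurable)).aestronglyMeasurable
    · rw [uIoc_of_le hL.le, EventuallyLE, ae_restrict_iff' measurableSet_Ioc]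
      filter_upwards [hγ.ae_ne hL z] with s hs hs'
      rw [Complex.norm_real, Real.norm_eq_abs]
      exact abs_log_le (norm_pos_iff.2 (hs hs'))
  exact hlog.continuousOn_mul hg.continuousOn

/-- For `b ≤ a`, combine `log x ≤ (x^θ - 1) / θ` at `x = a / b` with the subadditivity of `x ↦ x^θ`.
The sum of both powers on the right makes the bound symmetric. -/
theorem abs_log_sub_log_le {a b θ : ℝ} (ha : 0 < a) (hb : 0 < b) (hθ : 0 < θ) (hθ1 : θ ≤ 1) :
    |Real.log a - Real.log b| ≤ 1 / θ * |a - b| ^ θ * (a ^ (-θ) + b ^ (-θ)) := by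
  have key : ∀ a b : ℝ, 0 < b → b ≤ a →
      Real.log a - Real.log b ≤ 1 / θ * (a - b) ^ θ * b ^ (-θ) := by
    intro a b hb hba
    have ha : 0 < a := hb.trans_le hba
    have hab : 0 ≤ a - b := by linarith
    rw [← Real.log_div ha.ne' hb.ne']
    have h1 : a / b = 1 + (a - b) / b := by field_simp; ring
    have h2 : (a / b) ^ θ ≤ 1 + ((a - b) / b) ^ θ := by
      rw [h1]
      calc _ ≤ (1 : ℝ) ^ θ + ((a - b) / b) ^ θ :=
            Real.rpow_add_le_add_rpow zero_le_one (by positivity) hθ.le hθ1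
        _ = _ := by rw [Real.one_rpow]
    have h3 := Real.log_le_sub_one_of_pos (Real.rpow_pos_of_pos (div_pos ha hb) θ)
    rw [Real.log_rpow (div_pos ha hb)] at h3
    have h4 : ((a - b) / b) ^ θ = (a - b) ^ θ * b ^ (-θ) := by
      rw [Real.div_rpow hab hb.le, Real.rpow_neg hb.le]
      rfl
    rw [mul_assoc, ← h4, one_div, inv_mul_eq_div, le_div_iff₀ hθ]
    linarith
  have ha' : 0 < a ^ (-θ) := Real.rpow_pos_of_pos ha _
  have hb' : 0 < b ^ (-θ) := Real.rpow_pos_of_pos hb _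
  rcases le_total b a with hba | hba
  · rw [abs_of_nonneg (sub_nonneg.2 (Real.log_le_log hb hba)), abs_of_nonneg (sub_nonneg.2 hba)]
    have h0 : 0 ≤ (a - b) ^ θ := Real.rpow_nonneg (sub_nonneg.2 hba) _
    refine (key a b hb hba).trans (mul_le_mul_of_nonneg_left (by linarith) (by positivity))
  · rw [abs_sub_comm, abs_sub_comm a b, abs_of_nonneg (sub_nonneg.2 (Real.log_le_log ha hba)),
      abs_of_nonneg (sub_nonneg.2 hba)]
    have h0 : 0 ≤ (b - a) ^ θ := Real.rpow_nonneg (sub_nonneg.2 hba) _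
    refine (key b a ha hba).trans (mul_le_mul_of_nonneg_left (by linarith) (by positivity))

theorem planePot_holder (hL : 0 < L) (hα : 0 < α) (hγ : RegularCurve L α γ)
    (hg : Continuous g) (hgp : Function.Periodic g L) {θ : ℝ} (hθ : 0 < θ) (hθ1 : θ < 1) :
    ∃ C : ℝ, ∀ z w : ℂ, ‖planePot L γ g z - planePot L γ g w‖ ≤ C * ‖z - w‖ ^ θ := by
  obtain ⟨M, hM0, hM⟩ := hgp.exists_norm_le hL hg
  obtain ⟨K, hK⟩ := hγ.exists_integral_rpow_le hL hα hθ.le hθ1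
  refine ⟨M * (1 / θ) * (K + K), fun z w => ?_⟩
  unfold planePot
  rw [← intervalIntegral.integral_sub (intervalIntegrable_planePot hL hα hγ hg z)
    (intervalIntegrable_planePot hL hα hγ hg w)]
  have hi := (((hK z).1.add (hK w).1).const_mul (M * (1 / θ) * ‖z - w‖ ^ θ))
  refine (intervalIntegral.norm_integral_le_of_norm_le hL.le ?_ hi).trans ?_
  · filter_upwards [hγ.ae_ne hL z, hγ.ae_ne hL w] with s h1 h2 hs
    have h3 := abs_log_sub_log_le (norm_pos_iff.2 (h1 hs)) (norm_pos_iff.2 (h2 hs)) hθ hθ1.le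
    have h4 : |‖z - γ s‖ - ‖w - γ s‖| ≤ ‖z - w‖ := by
      refine (abs_norm_sub_norm_le _ _).trans (le_of_eq ?_)
      congr 1
      ring
    rw [← mul_sub, norm_mul, ← Complex.ofReal_sub, Complex.norm_real, Real.norm_eq_abs]
    calc _ ≤ M * (1 / θ * ‖z - w‖ ^ θ * (‖z - γ s‖ ^ (-θ) + ‖w - γ s‖ ^ (-θ))) := by
          gcongr
          · exact hM s
          · refine h3.trans ?_
            gcongr
      _ = _ := by ring
  · rw [intervalIntegral.integral_const_mul, intervalIntegral.integral_add (hK z).1 (hK w).1]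
    calc _ ≤ M * (1 / θ) * ‖z - w‖ ^ θ * (K + K) := by
          gcongr
          · exact (hK z).2
          · exact (hK w).2
      _ = _ := by ring

end Global

/-! ### The potential off the curve: harmonicity and composition -/

section Off

variable {L : ℝ} {γ g : ℝ → ℂ} {z₀ : ℂ} {d : ℝ}

theorem exists_dist_curve (hL : 0 < L) (hγ : Continuous γ) (hp : Function.Periodic γ L)
    (hz : z₀ ∉ range γ) : ∃ d : ℝ, 0 < d ∧ ∀ s, d ≤ ‖z₀ - γ s‖ := by
  obtain ⟨x, -, hx⟩ := (isCompact_Icc (a := (0 : ℝ)) (b := L)).exists_isMinOn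
    ⟨0, le_rfl, hL.le⟩ (by fun_prop : Continuous fun s => ‖z₀ - γ s‖).continuousOn
  refine ⟨‖z₀ - γ x‖, norm_pos_iff.2 (sub_ne_zero.2 fun h => hz ⟨x, h.symm⟩), fun t => ?_⟩
  obtain ⟨s, hs, hst⟩ := hp.exists_mem_Ico₀ hL t
  rw [hst]
  exact hx ⟨hs.1, hs.2.le⟩

theorem mem_slitPlane_one_add (hd : 0 < d) (hdist : ∀ s, d ≤ ‖z₀ - γ s‖) {z : ℂ}
    (hz : z ∈ Metric.ball z₀ (d / 2)) (s : ℝ) :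
    1 + (z - z₀) / (z₀ - γ s) ∈ Complex.slitPlane := by
  apply Complex.mem_slitPlane_of_norm_lt_one
  rw [norm_div, div_lt_one (hd.trans_le (hdist s))]
  rw [mem_ball_iff_norm] at hz
  linarith [hdist s]

theorem le_norm_sub_curve (hdist : ∀ s, d ≤ ‖z₀ - γ s‖) {z : ℂ}
    (hz : z ∈ Metric.ball z₀ (d / 2)) (s : ℝ) : d / 2 ≤ ‖z - γ s‖ := by
  rw [mem_ball_iff_norm] at hz
  have h1 : ‖z₀ - γ s‖ ≤ ‖z - γ s‖ + ‖z - z₀‖ := by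
    have : z₀ - γ s = (z - γ s) - (z - z₀) := by ring
    rw [this]
    exact norm_sub_le _ _
  linarith [hdist s]

theorem continuous_log_integrand (hγ : Continuous γ) (hd : 0 < d)
    (hdist : ∀ s, d ≤ ‖z₀ - γ s‖) (hg : Continuous g) {z : ℂ}
    (hz : z ∈ Metric.ball z₀ (d / 2)) :
    Continuous fun s => g s * Complex.log (1 + (z - z₀) / (z₀ - γ s)) := by
  refine hg.mul (Continuous.clog ?_ fun s => mem_slitPlane_one_add hd hdist hz s)
  refine continuous_const.add (continuous_const.div (by fun_prop) fun s => ?_)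
  exact norm_pos_iff.1 (hd.trans_le (hdist s))

theorem hasDerivAt_planeLog (hL : 0 < L) (hγ : Continuous γ) (hd : 0 < d)
    (hdist : ∀ s, d ≤ ‖z₀ - γ s‖) (hg : Continuous g) (hgp : Function.Periodic g L) {z : ℂ}
    (hz : z ∈ Metric.ball z₀ (d / 2)) :
    HasDerivAt (planeLog L γ g z₀) (planeCauchy L γ g z) z := by
  obtain ⟨M, hM0, hM⟩ := hgp.exists_norm_le hL hg
  have hne : ∀ x ∈ Metric.ball z₀ (d / 2), ∀ s, x - γ s ≠ 0 := fun x hx s =>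
    norm_pos_iff.1 ((half_pos hd).trans_le (le_norm_sub_curve hdist hx s))
  refine (intervalIntegral.hasDerivAt_integral_of_dominated_loc_of_deriv_le (μ := volume)
    (s := Metric.ball z₀ (d / 2))
    (F := fun z s => g s * Complex.log (1 + (z - z₀) / (z₀ - γ s)))
    (F' := fun z s => g s / (z - γ s)) (bound := fun _ => M / (d / 2))
    (Metric.isOpen_ball.mem_nhds hz) ?_
    ((continuous_log_integrand hγ hd hdist hg hz).intervalIntegrable _ _) ?_ ?_
    intervalIntegrable_const ?_).2
  · filter_upwards [Metric.isOpen_ball.mem_nhds hz] with x hx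
    exact (continuous_log_integrand hγ hd hdist hg hx).aestronglyMeasurable
  · exact (hg.div (by fun_prop) (hne z hz)).aestronglyMeasurable
  · refine Eventually.of_forall fun s _ x hx => ?_
    rw [norm_div]
    gcongr
    · exact hM s
    · exact le_norm_sub_curve hdist hx s
  · refine Eventually.of_forall fun s _ x hx => ?_
    have h0 : z₀ - γ s ≠ 0 := norm_pos_iff.1 (hd.trans_le (hdist s))
    have h1 := ((((hasDerivAt_id x).sub_const z₀).div_const (z₀ - γ s)).const_add 1).clog
      (mem_slitPlane_one_add hd hdist hx s)
    refine (h1.const_mul (g s)).congr_deriv ?_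
    have h2 := hne x hx s
    have h3 : 1 + (x - z₀) / (z₀ - γ s) = (x - γ s) / (z₀ - γ s) := by
      field_simp
      ring
    rw [id, h3]
    field_simp

theorem analyticAt_planeLog (hL : 0 < L) (hγ : Continuous γ) (hd : 0 < d)
    (hdist : ∀ s, d ≤ ‖z₀ - γ s‖) (hg : Continuous g) (hgp : Function.Periodic g L) :
    AnalyticAt ℂ (planeLog L γ g z₀) z₀ := by
  have h : DifferentiableOn ℂ (planeLog L γ g z₀) (Metric.ball z₀ (d / 2)) := fun z hz =>
    (hasDerivAt_planeLog hL hγ hd hdist hg hgp hz).differentiableAt.differentiableWithinAt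
  exact h.analyticAt (Metric.ball_mem_nhds _ (half_pos hd))

theorem analyticAt_planeCauchy (hL : 0 < L) (hγ : Continuous γ) (hp : Function.Periodic γ L)
    (hg : Continuous g) (hgp : Function.Periodic g L) (hz : z₀ ∉ range γ) :
    AnalyticAt ℂ (planeCauchy L γ g) z₀ := by
  obtain ⟨d, hd, hdist⟩ := exists_dist_curve hL hγ hp hz
  refine (analyticAt_planeLog hL hγ hd hdist hg hgp).deriv.congr ?_
  filter_upwards [Metric.ball_mem_nhds z₀ (half_pos hd)] with z hz
  exact (hasDerivAt_planeLog hL hγ hd hdist hg hgp hz).deriv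

/-- Here `log |z - γ(s)| = log |z₀ - γ(s)| + Re Log(1 + (z - z₀) / (z₀ - γ(s)))`, with the argument
of `Log` in the slit plane near `z₀`. As the density is complex, the real part is split into a
holomorphic and an antiholomorphic half. -/
theorem planePot_eq (hγ : Continuous γ) (hd : 0 < d)
    (hdist : ∀ s, d ≤ ‖z₀ - γ s‖) (hg : Continuous g) (hL : 0 < L) {z : ℂ}
    (hz : z ∈ Metric.ball z₀ (d / 2)) :
    planePot L γ g z = planePot L γ g z₀ + 1 / 2 * (planeLog L γ g z₀ z +
      (starRingEnd ℂ) (planeLog L γ (fun s => (starRingEnd ℂ) (g s)) z₀ z)) := by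
  have c0 : Continuous fun s => g s * ((Real.log ‖z₀ - γ s‖ : ℝ) : ℂ) := by
    refine hg.mul (Complex.continuous_ofReal.comp (Continuous.log (by fun_prop) fun s => ?_))
    exact (hd.trans_le (hdist s)).ne'
  have c1 := continuous_log_integrand hγ hd hdist hg hz
  have c2 : Continuous fun s => (starRingEnd ℂ) ((starRingEnd ℂ) (g s) *
      Complex.log (1 + (z - z₀) / (z₀ - γ s))) :=
    Complex.continuous_conj.comp (continuous_log_integrand hγ hd hdist
      (Complex.continuous_conj.comp hg) hz)
  have e : (starRingEnd ℂ) (planeLog L γ (fun s => (starRingEnd ℂ) (g s)) z₀ z) =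
      ∫ s in (0 : ℝ)..L, (starRingEnd ℂ) ((starRingEnd ℂ) (g s) *
        Complex.log (1 + (z - z₀) / (z₀ - γ s))) := by
    rw [planeLog, intervalIntegral.integral_of_le hL.le, intervalIntegral.integral_of_le hL.le]
    exact integral_conj.symm
  rw [e, planeLog, planePot, planePot]
  rw [← intervalIntegral.integral_add (c1.intervalIntegrable _ _) (c2.intervalIntegrable _ _),
    ← intervalIntegral.integral_const_mul,
    ← intervalIntegral.integral_add (c0.intervalIntegrable _ _)
      (((c1.intervalIntegrable _ _).add (c2.intervalIntegrable _ _)).const_mul _)]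
  congr 1
  funext s
  have h0 : z₀ - γ s ≠ 0 := norm_pos_iff.1 (hd.trans_le (hdist s))
  have h3 : 1 + (z - z₀) / (z₀ - γ s) = (z - γ s) / (z₀ - γ s) := by
    field_simp
    ring
  have h4 : z - γ s ≠ 0 := norm_pos_iff.1 ((half_pos hd).trans_le (le_norm_sub_curve hdist hz s))
  have h5 : Real.log ‖z - γ s‖ = Real.log ‖z₀ - γ s‖ +
      (Complex.log (1 + (z - z₀) / (z₀ - γ s))).re := by
    rw [Complex.log_re, h3, norm_div, Real.log_div (by simpa using h4) (by simpa using h0)]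
    ring
  rw [h5, map_mul, Complex.conj_conj, Complex.ofReal_add, Complex.re_eq_add_conj]
  ring

theorem harmonicAt_planePot (hL : 0 < L) (hγ : Continuous γ) (hp : Function.Periodic γ L)
    (hg : Continuous g) (hgp : Function.Periodic g L) (hz : z₀ ∉ range γ) :
    InnerProductSpace.HarmonicAt (planePot L γ g) z₀ := by
  obtain ⟨d, hd, hdist⟩ := exists_dist_curve hL hγ hp hz
  have hg' : Continuous fun s => (starRingEnd ℂ) (g s) := Complex.continuous_conj.comp hg
  have hgp' : Function.Periodic (fun s => (starRingEnd ℂ) (g s)) L := fun s => by simp only [hgp s]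
  have h1 := (analyticAt_planeLog hL hγ hd hdist hg hgp).harmonicAt
  have h2 := (analyticAt_planeLog hL hγ hd hdist hg' hgp').harmonicAt.comp_CLM
    Complex.conjCLE.toContinuousLinearMap
  have h3 := (InnerProductSpace.harmonicAt_const (planePot L γ g z₀) (x := z₀)).add
    ((h1.add h2).const_smul (c := (1 / 2 : ℝ)))
  refine (InnerProductSpace.harmonicAt_congr_nhds ?_).2 h3
  filter_upwards [Metric.ball_mem_nhds z₀ (half_pos hd)] with z hz
  rw [planePot_eq hγ hd hdist hg hL hz]
  simp [mul_add]

theorem hasDerivAt_planePot_comp (hL : 0 < L) (hγ : Continuous γ) (hp : Function.Periodic γ L)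
    (hg : Continuous g) (hgp : Function.Periodic g L) {η : ℝ → ℂ} {t : ℝ} {η' : ℂ}
    (hη : HasDerivAt η η' t) (ht : η t ∉ range γ) :
    HasDerivAt (fun t => planePot L γ g (η t)) (1 / 2 * (planeCauchy L γ g (η t) * η' +
      (starRingEnd ℂ) (planeCauchy L γ (fun s => (starRingEnd ℂ) (g s)) (η t) * η'))) t := by
  obtain ⟨d, hd, hdist⟩ := exists_dist_curve hL hγ hp ht
  have hg' : Continuous fun s => (starRingEnd ℂ) (g s) := Complex.continuous_conj.comp hg
  have hgp' : Function.Periodic (fun s => (starRingEnd ℂ) (g s)) L := fun s => by simp only [hgp s]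
  have hz : η t ∈ Metric.ball (η t) (d / 2) := Metric.mem_ball_self (half_pos hd)
  have h1 := (hasDerivAt_planeLog hL hγ hd hdist hg hgp hz).comp_of_eq t hη rfl
  have h2 := (hasDerivAt_planeLog hL hγ hd hdist hg' hgp' hz).comp_of_eq t hη rfl
  have h3 := Complex.conjCLE.toContinuousLinearMap.hasFDerivAt.comp_hasDerivAt t h2
  have h4 := ((h1.fun_add h3).const_mul (1 / 2)).const_add (planePot L γ g (η t))
  refine h4.congr_of_eventuallyEq ?_
  filter_upwards [hη.continuousAt.preimage_mem_nhds (Metric.ball_mem_nhds _ (half_pos hd))]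
    with s hs
  rw [planePot_eq hγ hd hdist hg hL hs]
  rfl

theorem HolderPer.of_contDiff {α : ℝ} {k : ℕ} (hL : 0 < L) (hα : 0 < α) (hα1 : α ≤ 1)
    (hp : Function.Periodic g L) (hg : ContDiff ℝ (k + 1) g) : HolderPer L α k g := by
  induction k generalizing g with
  | zero =>
    have h1 : ContDiff ℝ 1 g := by simpa using hg
    exact zero_of_deriv_continuous hL hα hα1 hp (h1.differentiable one_ne_zero)
      (h1.continuous_deriv le_rfl)
  | succ k ih =>
    rw [contDiff_succ_iff_deriv] at hg
    exact ⟨hp, hg.1, ih hp.deriv_periodic (by exact_mod_cast hg.2.2)⟩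

theorem HolderPer.contDiff {α : ℝ} {k : ℕ} (hα : 0 < α) (hg : HolderPer L α k g) :
    ContDiff ℝ k g := ((HolderPer.iff_isHolderClass hα).1 hg).2.1

/-- The derivative is built from Cauchy integrals along `η`, which are of class `C^{k+1}`, and from
`η'`, of class `C^{k+α}`. This is the interaction between distinct boundary curves. -/
theorem holderPer_planePot_comp {α : ℝ} {k : ℕ} (hL : 0 < L) (hγ : Continuous γ)
    (hp : Function.Periodic γ L) (hg : Continuous g) (hgp : Function.Periodic g L) {L' : ℝ}
    (hL' : 0 < L') (hα : 0 < α) (hα1 : α ≤ 1) {η : ℝ → ℂ} (hη : HolderPer L' α (k + 1) η)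
    (hd : Disjoint (range η) (range γ)) :
    HolderPer L' α (k + 1) fun t => planePot L γ g (η t) := by
  have hne : ∀ t, η t ∉ range γ := fun t => Set.disjoint_left.1 hd ⟨t, rfl⟩
  have hg' : Continuous fun s => (starRingEnd ℂ) (g s) := Complex.continuous_conj.comp hg
  have hgp' : Function.Periodic (fun s => (starRingEnd ℂ) (g s)) L := fun s => by simp only [hgp s]
  have hder := fun t => hasDerivAt_planePot_comp hL hγ hp hg hgp (hη.2.1 t).hasDerivAt (hne t)
  have hC : ∀ φ : ℝ → ℂ, Continuous φ → Function.Periodic φ L →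
      HolderPer L' α k fun t => planeCauchy L γ φ (η t) := by
    intro φ hφ hφp
    refine HolderPer.of_contDiff hL' hα hα1 (fun t => by simp only [hη.1 t]) ?_
    rw [contDiff_iff_contDiffAt]
    intro t
    exact ((analyticAt_planeCauchy hL hγ hp hφ hφp (hne t)).contDiffAt.restrict_scalars ℝ).comp t
      (by exact_mod_cast (hη.contDiff hα).contDiffAt)
  refine ⟨fun t => by simp only [hη.1 t], fun t => (hder t).differentiableAt, ?_⟩
  refine ((((hC g hg hgp).mul hL' hα hα1 hη.2.2).add ((hC _ hg' hgp').mul hL' hα hα1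
    hη.2.2).conj).const_mul hL' hα hα1 (1 / 2)).congr fun t => (hder t).deriv

end Off

/-! ### Assembly over the boundary curves -/

namespace HolderBoundary

variable {Ω : Set ℂ} {k : ℕ} {α β : ℝ} {f : ℂ → ℂ}

theorem holderPer_curve {l : ℕ} (hα : 0 < α) (Γ : HolderBoundary Ω l α) (i : Fin Γ.n) :
    HolderPer (Γ.period i) α l (Γ.curve i) :=
  (HolderPer.iff_isHolderClass hα).2 ⟨Γ.periodic i, Γ.holder i⟩

theorem regularCurve (hα : 0 < α) (hα1 : α ≤ 1) (Γ : HolderBoundary Ω (k + 1) α) (i : Fin Γ.n) :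
    RegularCurve (Γ.period i) α (Γ.curve i) :=
  ⟨(Γ.holderPer_curve hα i).of_le (Γ.period_pos i) hα hα1 (by omega), Γ.simple i, Γ.regular i⟩

theorem memHolder_iff {l j : ℕ} (hβ : 0 < β) (Γ : HolderBoundary Ω l α) :
    Γ.MemHolder j β f ↔
      ∀ i, HolderPer (Γ.period i) β j fun t => f (Γ.curve i t) :=
  forall_congr' fun i => by
    rw [HolderPer.iff_isHolderClass hβ]
    exact (and_iff_right fun t => by simp only [Γ.periodic i t]).symm

/-- The density with respect to the parameter. -/
noncomputable def density {l : ℕ} (Γ : HolderBoundary Ω l α) (f : ℂ → ℂ) (i : Fin Γ.n)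
    (t : ℝ) : ℂ :=
  f (Γ.curve i t) * ((‖deriv (Γ.curve i) t‖ : ℝ) : ℂ)

theorem layerIntegrand_eq {l : ℕ} (Γ : HolderBoundary Ω l α) (f : ℂ → ℂ) (z : ℂ)
    (i : Fin Γ.n) : Γ.layerIntegrand f z i =
      fun t => Γ.density f i t * ((Real.log ‖z - Γ.curve i t‖ : ℝ) : ℂ) := by
  funext t
  rw [layerIntegrand, density]
  push_cast
  ring

theorem singleLayer_eq {l : ℕ} (Γ : HolderBoundary Ω l α) (f : ℂ → ℂ) (z : ℂ) :
    Γ.singleLayer f z = ((1 / Real.pi : ℝ) : ℂ) *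
      ∑ i, planePot (Γ.period i) (Γ.curve i) (Γ.density f i) z := by
  rw [singleLayer]
  simp only [layerIntegrand_eq]
  rfl

theorem holderPer_norm_deriv (hα : 0 < α) (hα1 : α ≤ 1) (Γ : HolderBoundary Ω (k + 1) α)
    (i : Fin Γ.n) :
    HolderPer (Γ.period i) α k fun t => ((‖deriv (Γ.curve i) t‖ : ℝ) : ℂ) :=
  (Γ.holderPer_curve hα i).2.2.norm (Γ.period_pos i) hα hα1 (Γ.regular i)

theorem holderPer_density (hβ : 0 < β) (hβα : β ≤ α) (hα1 : α ≤ 1)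
    (Γ : HolderBoundary Ω (k + 1) α) (hf : Γ.MemHolder k β f) (i : Fin Γ.n) :
    HolderPer (Γ.period i) β k (Γ.density f i) :=
  ((Γ.memHolder_iff hβ).1 hf i).mul (Γ.period_pos i) hβ (hβα.trans hα1)
    ((Γ.holderPer_norm_deriv (hβ.trans_le hβα) hα1 i).mono_exponent (Γ.period_pos i) hβ hβα)

/-- On the `i`-th curve the boundary value of the single layer potential is the contribution of
that curve plus a function as regular as the curve. -/
theorem holderPer_singleLayer_sub (hβ : 0 < β) (hβα : β ≤ α) (hα1 : α ≤ 1)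
    (Γ : HolderBoundary Ω (k + 1) α) (hf : Γ.MemHolder k β f) (i : Fin Γ.n) :
    HolderPer (Γ.period i) α (k + 1) fun t => (Real.pi : ℂ) * Γ.singleLayer f (Γ.curve i t) -
      logPot (Γ.period i) (Γ.curve i) (Γ.density f i) t := by
  classical
  have hα : 0 < α := hβ.trans_le hβα
  refine (HolderPer.finsetSum (Finset.univ.erase i) (fun j t =>
    planePot (Γ.period j) (Γ.curve j) (Γ.density f j) (Γ.curve i t)) fun j hj => ?_).congr
      fun t => ?_
  · have hg := Γ.holderPer_density hβ hβα hα1 hf j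
    exact holderPer_planePot_comp (Γ.period_pos j) ((Γ.holderPer_curve hα j).continuous hα)
      (Γ.periodic j) (hg.continuous hβ) hg.periodic (Γ.period_pos i) hα hα1
      (Γ.holderPer_curve hα i) (Γ.disjoint (Finset.ne_of_mem_erase hj).symm)
  · have hpi : (Real.pi : ℂ) ≠ 0 := by exact_mod_cast Real.pi_ne_zero
    rw [singleLayer_eq, ← Finset.add_sum_erase _ _ (Finset.mem_univ i)]
    have e : planePot (Γ.period i) (Γ.curve i) (Γ.density f i) (Γ.curve i t) =
        logPot (Γ.period i) (Γ.curve i) (Γ.density f i) t := rfl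
    rw [e]
    push_cast
    field_simp
    ring

theorem holderPer_logPot (hβ : 0 < β) (hβα : β ≤ α) (hα1 : α < 1)
    (Γ : HolderBoundary Ω (k + 1) α) (hf : Γ.MemHolder k β f) (i : Fin Γ.n) :
    HolderPer (Γ.period i) β (k + 1)
      (logPot (Γ.period i) (Γ.curve i) (Γ.density f i)) := by
  have hα : 0 < α := hβ.trans_le hβα
  have hβ1 : β < 1 := hβα.trans_lt hα1
  have hL := Γ.period_pos i
  have hγ := Γ.regularCurve hα hα1.le i
  have hg := Γ.holderPer_density hβ hβα hα1.le hf i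
  have hd := hasDerivAt_logPot hL hβ hβ1 (hγ.mono hL hβ hβα)
    (hg.of_le hL hβ hβ1.le (Nat.zero_le _))
  refine ⟨fun t => ?_, fun t => (hd t).differentiableAt, ?_⟩
  · simp only [logPot, Γ.periodic i t]
  · refine (((holderPer_logPotDeriv_add hL hβ hβα hα1 hγ (Γ.holderPer_curve hα i)
      hg).mono_exponent hL hβ hβα).sub hL hβ hβ1.le
      (holderPer_cauchyOp_circle hL hβ hβ1 hg)).congr fun t => ?_
    rw [(hd t).deriv]
    ring

theorem memHolder_singleLayer (hβ : 0 < β) (hβα : β ≤ α) (hα1 : α < 1)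
    (Γ : HolderBoundary Ω (k + 1) α) (hf : Γ.MemHolder k β f) :
    Γ.MemHolder (k + 1) β (Γ.singleLayer f) := by
  rw [Γ.memHolder_iff hβ]
  intro i
  have hL := Γ.period_pos i
  have hpi : (Real.pi : ℂ) ≠ 0 := by exact_mod_cast Real.pi_ne_zero
  refine (((Γ.holderPer_singleLayer_sub hβ hβα hα1.le hf i).mono_exponent hL hβ hβα).add
    (Γ.holderPer_logPot hβ hβα hα1 hf i)).const_mul hL hβ (hβα.trans hα1.le)
      (Real.pi : ℂ)⁻¹ |>.congr fun t => ?_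
  rw [sub_add_cancel, inv_mul_cancel_left₀ hpi]

/-- Removing the other curves and then the `C^{k+α}` error from the derivative leaves the circle
operator applied to the density, which can be inverted; dividing by `|γ'|` recovers `f`. -/
theorem memHolder_of_singleLayer (hβ : 0 < β) (hβα : β ≤ α) (hα1 : α < 1)
    (Γ : HolderBoundary Ω (k + 1) α) (hf : Γ.MemHolder k β f)
    (hW : Γ.MemHolder (k + 1) α (Γ.singleLayer f)) : Γ.MemHolder k α f := by
  have hα : 0 < α := hβ.trans_le hβα
  have hβ1 : β < 1 := hβα.trans_lt hα1
  rw [Γ.memHolder_iff hα] at hW ⊢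
  intro i
  have hL := Γ.period_pos i
  have hγ := Γ.regularCurve hα hα1.le i
  have hg := Γ.holderPer_density hβ hβα hα1.le hf i
  have hd := hasDerivAt_logPot hL hβ hβ1 (hγ.mono hL hβ hβα)
    (hg.of_le hL hβ hβ1.le (Nat.zero_le _))
  have h1 : HolderPer (Γ.period i) α (k + 1)
      (logPot (Γ.period i) (Γ.curve i) (Γ.density f i)) :=
    (((hW i).const_mul hL hα hα1.le (Real.pi : ℂ)).sub hL hα hα1.le
      (Γ.holderPer_singleLayer_sub hβ hβα hα1.le hf i)).congr fun t => by ring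
  have h2 : HolderPer (Γ.period i) α k
      (cauchyOp (Γ.period i) (circleCurve (Γ.period i)) (Γ.density f i)) :=
    ((holderPer_logPotDeriv_add hL hβ hβα hα1 hγ (Γ.holderPer_curve hα i) hg).sub hL hα hα1.le
      h1.2.2).congr fun t => by rw [(hd t).deriv]; ring
  have h3 := hg.of_cauchyOp_circle hL hβ hβα hα1 h2
  have hn : ∀ t, ((‖deriv (Γ.curve i) t‖ : ℝ) : ℂ) ≠ 0 := fun t => by simpa using Γ.regular i t
  refine (h3.mul hL hα hα1.le ((Γ.holderPer_norm_deriv hα hα1.le i).inv hL hα hα1.le hn)).congr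
    fun t => ?_
  rw [density, mul_inv_cancel_right₀ (hn t)]

theorem exists_norm_singleLayer_sub_le (hβ : 0 < β) (hβα : β ≤ α) (hα1 : α ≤ 1)
    (Γ : HolderBoundary Ω (k + 1) α) (hf : Γ.MemHolder k β f) {θ : ℝ} (hθ : 0 < θ)
    (hθ1 : θ < 1) : ∃ C : ℝ, ∀ z w : ℂ,
      ‖Γ.singleLayer f z - Γ.singleLayer f w‖ ≤ C * ‖z - w‖ ^ θ := by
  have hα : 0 < α := hβ.trans_le hβα
  have h := fun i => planePot_holder (Γ.period_pos i) hα (Γ.regularCurve hα hα1 i)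
    ((Γ.holderPer_density hβ hβα hα1 hf i).continuous hβ)
    (Γ.holderPer_density hβ hβα hα1 hf i).periodic hθ hθ1
  choose C hC using h
  refine ⟨1 / Real.pi * ∑ i, C i, fun z w => ?_⟩
  have hpi := Real.pi_pos
  rw [singleLayer_eq, singleLayer_eq, ← mul_sub, ← Finset.sum_sub_distrib, norm_mul,
    Complex.norm_real, Real.norm_of_nonneg (by positivity), mul_assoc, Finset.sum_mul]
  gcongr
  exact (norm_sum_le _ _).trans (Finset.sum_le_sum fun i _ => hC i z w)

theorem harmonicAt_singleLayer (hβ : 0 < β) (hβα : β ≤ α) (hα1 : α ≤ 1)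
    (Γ : HolderBoundary Ω (k + 1) α) (hf : Γ.MemHolder k β f) {z : ℂ} (hz : z ∉ frontier Ω) :
    InnerProductSpace.HarmonicAt (Γ.singleLayer f) z := by
  have hα : 0 < α := hβ.trans_le hβα
  have hsum : ∀ s : Finset (Fin Γ.n), InnerProductSpace.HarmonicAt
      (∑ i ∈ s, planePot (Γ.period i) (Γ.curve i) (Γ.density f i)) z := by
    classical
    intro s
    induction s using Finset.induction_on with
    | empty => exact InnerProductSpace.harmonicAt_const (0 : ℂ)
    | insert i s hi ih =>
      rw [Finset.sum_insert hi]
      have hg := Γ.holderPer_density hβ hβα hα1 hf i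
      refine (harmonicAt_planePot (Γ.period_pos i) ((Γ.holderPer_curve hα i).continuous hα)
        (Γ.periodic i) (hg.continuous hβ) hg.periodic fun h => hz ?_).add ih
      rw [Γ.frontier_eq]
      exact mem_iUnion_of_mem i h
  have h := (hsum Finset.univ).const_smul (c := 1 / Real.pi)
  refine (InnerProductSpace.harmonicAt_congr_nhds (Eventually.of_forall fun w => ?_)).2 h
  rw [singleLayer_eq, Pi.smul_apply, Finset.sum_apply, Complex.real_smul]

end HolderBoundary

theorem mainTheorem7 (k : ℕ) (α β : ℝ) (hβ : 0 < β) (hβα : β < α) (hα : α < 1)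
    (Ω : Set ℂ) (hΩ_open : IsOpen Ω) (hΩ_conn : IsConnected Ω) (hΩ_bdd : Bornology.IsBounded Ω)
    (Γ : HolderBoundary Ω (k + 1) α) (f : ℂ → ℂ)
    (hf : Γ.MemHolder k β f) (hf' : ¬ Γ.MemHolder k α f) :
    -- the integral defining the potential converges absolutely at every point of the plane
    (∀ (z : ℂ) (i : Fin Γ.n),
      IntervalIntegrable (Γ.layerIntegrand f z i) volume 0 (Γ.period i)) ∧
    -- it is harmonic on the domain and on its exterior
    InnerProductSpace.HarmonicOnNhd (Γ.singleLayer f) Ω ∧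
    InnerProductSpace.HarmonicOnNhd (Γ.singleLayer f) (closure Ω)ᶜ ∧
    -- the two harmonic functions have the same boundary value
    (∀ ζ ∈ frontier Ω,
      Tendsto (Γ.singleLayer f) (𝓝[Ω] ζ) (𝓝 (Γ.singleLayer f ζ)) ∧
      Tendsto (Γ.singleLayer f) (𝓝[(closure Ω)ᶜ] ζ) (𝓝 (Γ.singleLayer f ζ))) ∧
    -- regularity of the boundary value
    Γ.MemHolder (k + 1) β (Γ.singleLayer f) ∧
    ¬ Γ.MemHolder (k + 1) α (Γ.singleLayer f) ∧
    -- Hölder regularity on the whole plane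
    ∀ ε : ℝ, 0 < ε → ε < 1 →
      ∃ C : ℝ, ∀ z w : ℂ,
        ‖Γ.singleLayer f z - Γ.singleLayer f w‖ ≤ C * ‖z - w‖ ^ (1 - ε) := by
  have hα0 : 0 < α := hβ.trans hβα
  -- Any single Hölder exponent suffices for continuity on the whole plane, which gives both
  -- one-sided boundary limits at once.
  have hcont : Continuous (Γ.singleLayer f) := by
    obtain ⟨C, hC⟩ := Γ.exists_norm_singleLayer_sub_le hβ hβα.le hα.le hf (θ := 1 / 2)
      (by norm_num) (by norm_num)
    rw [continuous_iff_continuousAt]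
    intro w
    rw [ContinuousAt, tendsto_iff_norm_sub_tendsto_zero]
    have h1 : ContinuousAt (fun z : ℂ => C * ‖z - w‖ ^ (1 / 2 : ℝ)) w :=
      continuousAt_const.mul (ContinuousAt.rpow_const (by fun_prop) (Or.inr (by norm_num)))
    have h2 := h1.tendsto
    rw [sub_self, norm_zero, Real.zero_rpow (by norm_num), mul_zero] at h2
    exact squeeze_zero (fun _ => norm_nonneg _) (fun z => hC z w) h2
  refine ⟨fun z i => ?_, fun z hz => ?_, fun z hz => ?_, fun ζ _ => ⟨?_, ?_⟩, ?_, ?_, ?_⟩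
  · rw [Γ.layerIntegrand_eq]
    exact intervalIntegrable_planePot (Γ.period_pos i) hα0 (Γ.regularCurve hα0 hα.le i)
      ((Γ.holderPer_density hβ hβα.le hα.le hf i).continuous hβ) z
  · refine Γ.harmonicAt_singleLayer hβ hβα.le hα.le hf fun h => ?_
    rw [hΩ_open.frontier_eq] at h
    exact h.2 hz
  · exact Γ.harmonicAt_singleLayer hβ hβα.le hα.le hf fun h => hz (frontier_subset_closure h)
  · exact (hcont.tendsto ζ).mono_left nhdsWithin_le_nhds
  · exact (hcont.tendsto ζ).mono_left nhdsWithin_le_nhds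
  · exact Γ.memHolder_singleLayer hβ hβα.le hα hf
  · exact fun hW => hf' (Γ.memHolder_of_singleLayer hβ hβα.le hα hf hW)
  · exact fun ε hε hε1 => Γ.exists_norm_singleLayer_sub_le hβ hβα.le hα.le hf (by linarith)
      (by linarith)
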